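/- **Lemma 3.14.** Fix an integer $k\ge 1$ and let $q=e^{\pi i/(k+2)}$, $[i]=\dfrac{q^{i}-q^{-i}}{q-q^{-1}}$ and $\delta=-[2]$. Let $\mathcal L$ be the $\mathbb C$-linear monoidal category with objects the natural numbers $0,1,2,\dots$, in which a morphism $m\to n$ is a $\mathbb C$-linear combination of planar diagrams in a rectangle with $m$ dots on the bottom edge and $n$ dots on the top edge, every dot being joined to exactly one other dot by non-crossing lines, up to isotopy. Composition $g\circ f$ stacks $g$ on top of $f$, every closed loop being replaced by the factor $\delta$; the monoidal product is $m\otimes n=m+n$ on objects and horizontal juxtaposition on diagrams. Let $TL$ be the idempotent completion of the additive completion of $\mathcal L$, with the induced monoidal structure. Define $f_i:i\to i$ for $0\le i\le k+1$ by $f_0=1_0$, $f_1=1_1$ and, for $2\le i\le k+1$, $$f_i=f_{i-1}\otimes 1_1+\frac{[i-1]}{[i]}\,(f_{i-1}\otimes 1_1)\circ U_{i-1}\circ(f_{i-1}\otimes 1_1),$$ where $U_{i-1}=1_{i-2}\otimes(\cup\circ\cap):i\to i$, with $\cap:2\to0$ the cap and $\cup:0\to2$ the cup. These are idempotents (the Jones–Wenzl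 projections); write $F_i=(i,f_i)$ for the corresponding objects of $TL$. Let $(F_{k+1})$ be the two-sided monoidal ideal of morphisms of $TL$ generated by $1_{F_{k+1}}$, that is, the smallest class of morphisms which contains $1_{F_{k+1}}$ and all zero morphisms and is closed under sums and under composition and monoidal product, on either side, with arbitrary morphisms. Let $\widetilde{TL}=TL/(F_{k+1})$. Let $\cap^{(k)}:2k\to0$ and $\cup^{(k)}:0\to2k$ be the diagrams of $k$ nested caps and of $k$ nested cups, and let $$e_k=\cap^{(k)}\circ(f_k\otimes f_k):F_k\otimes F_k\to F_0,\qquad c_k=(f_k\otimes f_k)\circ\cup^{(k)}:F_0\to F_k\otimes F_k ,$$ where $F_0$ is the unit object. Then in $\widetilde{TL}$ $$c_k\circ e_k=(-1)^k\,1_{F_k}\otimes 1_{F_k}:F_k\otimes F_k\to F_k\otimes F_k .$$ -/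

import Mathlib

open CategoryTheory

attribute [-instance] CategoryTheory.catToReflQuiver

namespace TemperleyLieb

section Gluing

variable {A B C : Type}

/-- `A ⊕ B` inside the glued set of dots `(A ⊕ C) ⊕ B`. -/
def inFirst : A ⊕ B → (A ⊕ C) ⊕ B := Sum.elim (Sum.inl ∘ Sum.inl) Sum.inr

/-- `B ⊕ C` inside the glued set of dots `(A ⊕ C) ⊕ B`. -/
def inSecond : B ⊕ C → (A ⊕ C) ⊕ B := Sum.elim Sum.inr (Sum.inl ∘ Sum.inr)

/-- Stacking a diagram with dots `A` (bottom) and `B` (top) below a diagram with dots `B` (bottom)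
and `C` (top): two dots are equivalent if they lie on the same connected component of the
stacked picture. -/
def glue (r : Setoid (A ⊕ B)) (s : Setoid (B ⊕ C)) : Setoid ((A ⊕ C) ⊕ B) :=
  Relation.EqvGen.setoid fun x y =>
    (∃ a b, r a b ∧ inFirst a = x ∧ inFirst b = y) ∨
    (∃ a b, s a b ∧ inSecond a = x ∧ inSecond b = y)

/-- The outer dots which are connected in the stacked picture. -/
def stack (r : Setoid (A ⊕ B)) (s : Setoid (B ⊕ C)) : Setoid (A ⊕ C) :=
  (glue r s).comap Sum.inl

/-- The number of closed loops: components of the stacked picture without outer dots. -/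
noncomputable def loops (r : Setoid (A ⊕ B)) (s : Setoid (B ⊕ C)) : ℕ :=
  Nat.card {q : Quotient (glue r s) // ∀ x : A ⊕ C, (Quotient.mk _ (Sum.inl x)) ≠ q}

/-- A two-colouring of the dots which is constant on components. -/
def Resp {X : Type} (r : Setoid X) (φ : X → Bool) : Prop := ∀ x y, r x y → φ x = φ y

theorem glue_resp (r : Setoid (A ⊕ B)) (s : Setoid (B ⊕ C)) (φ : (A ⊕ C) ⊕ B → Bool) :
    Resp (glue r s) φ ↔ Resp r (φ ∘ inFirst) ∧ Resp s (φ ∘ inSecond) := by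
  constructor
  · intro h
    exact ⟨fun x y hxy => h _ _ (.rel _ _ (.inl ⟨x, y, hxy, rfl, rfl⟩)),
      fun x y hxy => h _ _ (.rel _ _ (.inr ⟨x, y, hxy, rfl, rfl⟩))⟩
  · rintro ⟨h1, h2⟩ x y hxy
    induction hxy with
    | rel x y h =>
      rcases h with ⟨a, b, hab, rfl, rfl⟩ | ⟨a, b, hab, rfl, rfl⟩
      · exact h1 _ _ hab
      · exact h2 _ _ hab
    | refl x => rfl
    | symm x y _ ih => exact ih.symm
    | trans x y z _ _ ih1 ih2 => exact ih1.trans ih2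

theorem resp_ext {X : Type} {r s : Setoid X} (h : ∀ φ, Resp r φ ↔ Resp s φ) : r = s := by
  classical
  have key : ∀ r s : Setoid X, (∀ φ, Resp r φ ↔ Resp s φ) → ∀ x y, r x y → s x y := by
    intro r s h x y hxy
    have h1 : Resp s (fun z => decide (s x z)) := by
      intro a b hab
      simp only [decide_eq_decide]
      exact ⟨fun h => s.trans h hab, fun h => s.trans h (s.symm hab)⟩
    have h2 := (h _).2 h1 x y hxy
    simp only [decide_eq_decide] at h2
    exact h2.1 (s.refl x)
  ext x y
  exact ⟨key r s h x y, key s r (fun φ => (h φ).symm) x y⟩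

open Classical in
theorem card_extend {X Y : Type} [Finite X] [Finite Y] (r : Setoid (X ⊕ Y)) (α : X → Bool) :
    Nat.card {β : Y → Bool // Resp r (Sum.elim α β)} =
      if Resp (r.comap Sum.inl) α then
        2 ^ Nat.card {q : Quotient r // ∀ x : X, (Quotient.mk _ (Sum.inl x)) ≠ q} else 0 := by
  split_ifs with h
  · have e : {β : Y → Bool // Resp r (Sum.elim α β)} ≃
        ({q : Quotient r // ∀ x : X, (Quotient.mk _ (Sum.inl x)) ≠ q} → Bool) := by
      refine
        { toFun := fun β q => Quotient.lift (Sum.elim α β.1) β.2 q.1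
          invFun := fun f => ⟨fun y =>
            if hq : ∃ x : X, (Quotient.mk r (Sum.inl x)) = Quotient.mk r (Sum.inr y)
              then α hq.choose
              else f ⟨Quotient.mk r (Sum.inr y), fun x hx => hq ⟨x, hx⟩⟩, ?_⟩
          left_inv := ?_
          right_inv := ?_ }
      · have hα : ∀ x x', Quotient.mk r (Sum.inl x) = Quotient.mk r (Sum.inl x') → α x = α x' :=
          fun x x' hx => h x x' (Quotient.exact (s := r) hx)
        rintro (x | y) (x' | y') hxy
        · exact h x x' hxy
        · have hq : ∃ x : X, (Quotient.mk r (Sum.inl x)) = Quotient.mk r (Sum.inr y') :=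
            ⟨x, Quotient.sound hxy⟩
          simp only [Sum.elim_inl, Sum.elim_inr, dif_pos hq]
          exact hα _ _ ((Quotient.sound hxy).trans hq.choose_spec.symm)
        · have hq : ∃ x : X, (Quotient.mk r (Sum.inl x)) = Quotient.mk r (Sum.inr y) :=
            ⟨x', (Quotient.sound hxy).symm⟩
          simp only [Sum.elim_inl, Sum.elim_inr, dif_pos hq]
          exact hα _ _ (hq.choose_spec.trans (Quotient.sound hxy))
        · have e : Quotient.mk r (Sum.inr y) = Quotient.mk r (Sum.inr y') := Quotient.sound hxy
          simp only [Sum.elim_inr, e]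
      · rintro ⟨β, hβ⟩
        ext y
        dsimp only
        split_ifs with hq
        · exact hβ _ _ (Quotient.exact hq.choose_spec)
        · rfl
      · intro f
        funext ⟨q, hq⟩
        induction q using Quotient.inductionOn with
        | h z =>
          rcases z with x | y
          · exact absurd rfl (hq x)
          · have hn : ¬ ∃ x : X, (Quotient.mk r (Sum.inl x)) = Quotient.mk r (Sum.inr y) :=
              fun ⟨x, hx⟩ => hq x hx
            simp [hn]
    rw [Nat.card_congr e, Nat.card_fun]
    simp
  · have : IsEmpty {β : Y → Bool // Resp r (Sum.elim α β)} :=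
      ⟨fun β => h fun x x' hx => β.2 (Sum.inl x) (Sum.inl x') hx⟩
    simp

open Classical in
/-- The 0-1 matrix recording which two-colourings of the dots are constant on components. -/
noncomputable def mat (r : Setoid (A ⊕ B)) (α : A → Bool) (β : B → Bool) : ℕ :=
  if Resp r (Sum.elim α β) then 1 else 0

theorem mat_false (r : Setoid (A ⊕ B)) : mat r (fun _ => false) (fun _ => false) = 1 := by
  unfold mat
  rw [if_pos]
  rintro (x | x) (y | y) _ <;> rfl

theorem mat_inj {r s : Setoid (A ⊕ B)} (h : mat r = mat s) : r = s := by
  apply resp_ext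
  intro φ
  have := congrFun (congrFun h (φ ∘ Sum.inl)) (φ ∘ Sum.inr)
  simp only [mat, Sum.elim_comp_inl_inr] at this
  split_ifs at this <;> simp_all

theorem mat_stack [Finite A] [Fintype B] [Finite C] [DecidableEq B]
    (r : Setoid (A ⊕ B)) (s : Setoid (B ⊕ C))
    (α : A → Bool) (γ : C → Bool) :
    ∑ β, mat r α β * mat s β γ = 2 ^ loops r s * mat (stack r s) α γ := by
  classical
  have h := card_extend (glue r s) (Sum.elim α γ)
  have e : ∀ β : B → Bool, Resp (glue r s) (Sum.elim (Sum.elim α γ) β) ↔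
      Resp r (Sum.elim α β) ∧ Resp s (Sum.elim β γ) := by
    intro β
    rw [glue_resp]
    have h1 : Sum.elim (Sum.elim α γ) β ∘ inFirst = Sum.elim α β := by
      ext (x | x) <;> rfl
    have h2 : Sum.elim (Sum.elim α γ) β ∘ inSecond = Sum.elim β γ := by
      ext (x | x) <;> rfl
    rw [h1, h2]
  have h1 : ∑ β, mat r α β * mat s β γ =
      Nat.card {β : B → Bool // Resp (glue r s) (Sum.elim (Sum.elim α γ) β)} := by
    rw [Nat.card_eq_fintype_card, Fintype.card_subtype, Finset.card_filter]
    refine Finset.sum_congr rfl fun β _ => ?_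
    simp only [mat, e β, ite_and]
    split_ifs <;> simp
  rw [h1, h, mat, loops, stack]
  split_ifs <;> simp

/-- A scaled matrix determines the scale and the relation. -/
theorem scaled_mat_inj {r s : Setoid (A ⊕ B)} {a b : ℕ}
    (h : ∀ α β, 2 ^ a * mat r α β = 2 ^ b * mat s α β) : a = b ∧ r = s := by
  have hab : a = b := by
    have := h (fun _ => false) (fun _ => false)
    rw [mat_false, mat_false, mul_one, mul_one] at this
    exact Nat.pow_right_injective le_rfl this
  subst hab
  refine ⟨rfl, mat_inj ?_⟩
  funext α β
  exact Nat.eq_of_mul_eq_mul_left (by positivity) (h α β)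

theorem stack_assoc {D : Type} [Fintype A] [Fintype B] [Fintype C] [Fintype D]
    (r : Setoid (A ⊕ B)) (s : Setoid (B ⊕ C)) (t : Setoid (C ⊕ D)) :
    loops r s + loops (stack r s) t = loops s t + loops r (stack s t) ∧
      stack (stack r s) t = stack r (stack s t) := by
  classical
  apply scaled_mat_inj
  intro α δ
  have h1 : 2 ^ (loops r s + loops (stack r s) t) * mat (stack (stack r s) t) α δ =
      ∑ γ, ∑ β, mat r α β * (mat s β γ * mat t γ δ) := by
    rw [pow_add, mul_assoc, ← mat_stack, Finset.mul_sum]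
    refine Finset.sum_congr rfl fun γ _ => ?_
    rw [← mul_assoc, ← mat_stack, Finset.sum_mul]
    exact Finset.sum_congr rfl fun β _ => mul_assoc _ _ _
  have h2 : 2 ^ (loops s t + loops r (stack s t)) * mat (stack r (stack s t)) α δ =
      ∑ β, ∑ γ, mat r α β * (mat s β γ * mat t γ δ) := by
    rw [pow_add, mul_assoc, ← mat_stack, Finset.mul_sum]
    refine Finset.sum_congr rfl fun β _ => ?_
    rw [mul_left_comm, ← mat_stack, Finset.mul_sum]
  rw [h1, h2, Finset.sum_comm]

/-- The components of the identity diagram: vertical strands. -/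
def idRel (A : Type) : Setoid (A ⊕ A) := Setoid.ker (Sum.elim id id)

open Classical in
theorem mat_idRel (α β : A → Bool) :
    mat (idRel A) α β = if α = β then 1 else 0 := by
  unfold mat
  congr 1
  rw [eq_iff_iff]
  constructor
  · intro h
    funext a
    exact h (Sum.inl a) (Sum.inr a) rfl
  · rintro rfl (x | x) (y | y) h <;> exact congrArg α h

theorem id_stack [Fintype A] [Fintype B] (r : Setoid (A ⊕ B)) :
    loops (idRel A) r = 0 ∧ stack (idRel A) r = r := by
  classical
  apply scaled_mat_inj
  intro α β
  rw [← mat_stack]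
  simp [mat_idRel]

theorem stack_id [Fintype A] [Fintype B] (r : Setoid (A ⊕ B)) :
    loops r (idRel B) = 0 ∧ stack r (idRel B) = r := by
  classical
  apply scaled_mat_inj
  intro α β
  rw [← mat_stack]
  simp [mat_idRel]

end Gluing

section Planarity

/-- Every dot is joined to exactly one other dot. -/
def IsMatching {X : Type} (r : Setoid X) : Prop := ∀ x, ∃! y, y ≠ x ∧ r x y

/-- `p` lists the dots in their cyclic order along the boundary of the rectangle; no two lines
`{a, c}` and `{b, d}` cross. -/
def IsNoncrossing {X : Type} (p : X → ℕ) (r : Setoid X) : Prop :=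
  ∀ a b c d, p a < p b → p b < p c → p c < p d → r a c → ¬ r b d

theorem IsMatching.exists_partner {X : Type} {r : Setoid X} (h : IsMatching r) :
    ∃ σ : X → X, (∀ x, σ (σ x) = x) ∧ (∀ x, σ x ≠ x) ∧ ∀ x y, r x y ↔ y = x ∨ y = σ x := by
  choose σ hσ using h
  have h2 : ∀ x y, r x y ↔ y = x ∨ y = σ x := by
    intro x y
    constructor
    · intro hxy
      by_cases hy : y = x
      · exact .inl hy
      · exact .inr ((hσ x).2 y ⟨hy, hxy⟩)
    · rintro (rfl | rfl)
      · exact r.refl y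
      · exact (hσ x).1.2
  refine ⟨σ, fun x => ?_, fun x => (hσ x).1.1, h2⟩
  exact ((hσ (σ x)).2 x ⟨(hσ x).1.1.symm, r.symm (hσ x).1.2⟩).symm

theorem sum_invariant_eq_zero {X : Type} [Fintype X] (σ : X → X) (h1 : ∀ x, σ (σ x) = x)
    (h2 : ∀ x, σ x ≠ x) (f : X → ZMod 2) (hf : ∀ x, f x + f (σ x) = 0) : ∑ x, f x = 0 :=
  Finset.sum_involution (fun x _ => σ x) (fun x _ => hf x) (fun x _ _ => h2 x)
    (fun _ _ => Finset.mem_univ _) (fun x _ => h1 x)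

open Classical in
theorem link_eq_zero {X : Type} [Fintype X] (p : X → ℕ) (hp : Function.Injective p)
    (r : Setoid X) (hr : IsNoncrossing p r) (σ : X → X) (h1 : ∀ x, σ (σ x) = x)
    (h2 : ∀ x, σ x ≠ x) (h3 : ∀ x y, r x y ↔ y = x ∨ y = σ x)
    (χ ψ : X → ZMod 2) (hχ : ∀ x, χ (σ x) = χ x) (hψ : ∀ x, ψ (σ x) = ψ x)
    (h : ∀ x, χ x * ψ x = 0) :
    ∑ x, ∑ y, χ x * ψ y * (if p x < p y then 1 else 0) = 0 := by
  refine sum_invariant_eq_zero σ h1 h2 _ fun x => ?_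
  rw [← Finset.sum_add_distrib]
  refine sum_invariant_eq_zero σ h1 h2 _ fun y => ?_
  rw [hχ, hψ]
  by_cases hz : χ x * ψ y = 0
  · simp [hz]
  have d1 : p x ≠ p y := fun e => hz (by rw [hp e]; exact h y)
  have d2 : p (σ x) ≠ p y := fun e => hz (by rw [← hχ x, hp e]; exact h y)
  have d3 : p x ≠ p (σ y) := fun e => hz (by rw [← hψ y, ← hp e]; exact h x)
  have d4 : p (σ x) ≠ p (σ y) := fun e => hz (by rw [← hχ x, ← hψ y, ← hp e]; exact h _)
  have rx : r x (σ x) := (h3 _ _).2 (.inr rfl)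
  have ry : r y (σ y) := (h3 _ _).2 (.inr rfl)
  have c : ∀ x x' y y', r x x' → r y y' → ¬ (p x < p y ∧ p y < p x' ∧ p x' < p y') :=
    fun x x' y y' h h' hh => hr x y x' y' hh.1 hh.2.1 hh.2.2 h h'
  have c1 := c x (σ x) y (σ y) rx ry
  have c2 := c x (σ x) (σ y) y rx (r.symm ry)
  have c3 := c (σ x) x y (σ y) (r.symm rx) ry
  have c4 := c (σ x) x (σ y) y (r.symm rx) (r.symm ry)
  have c5 := c y (σ y) x (σ x) ry rx
  have c6 := c (σ y) y x (σ x) (r.symm ry) rx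
  have c7 := c y (σ y) (σ x) x ry (r.symm rx)
  have c8 := c (σ y) y (σ x) x (r.symm ry) (r.symm rx)
  clear c hr
  rw [← mul_add, ← mul_add, ← mul_add]
  refine mul_eq_zero_of_right _ ?_
  split_ifs <;> first | rfl | (exfalso; omega)

theorem ends_le_two {K : Type} [Fintype K] [DecidableEq K] [Nonempty K] (s t : K → K)
    (hs : ∀ x, s (s x) = x) (ht : ∀ x, t (t x) = x)
    (conn : ∀ x y, Relation.EqvGen (fun x y => s x = y ∨ t x = y) x y) :
    (Finset.univ.filter fun x => s x = x).card + (Finset.univ.filter fun x => t x = x).card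
      ≤ 2 := by
  classical
  let G : SimpleGraph K :=
    { Adj := fun x y => x ≠ y ∧ (s x = y ∨ t x = y)
      symm := ⟨by
        rintro x y ⟨h1, h2 | h2⟩
        · exact ⟨h1.symm, .inl (by rw [← h2, hs])⟩
        · exact ⟨h1.symm, .inr (by rw [← h2, ht])⟩⟩
      loopless := ⟨fun x h => h.1 rfl⟩ }
  have hG : G.Connected := by
    rw [SimpleGraph.connected_iff]
    refine ⟨fun x y => ?_, inferInstance⟩
    induction conn x y with
    | rel x y h =>
      by_cases e : x = y
      · rw [e]
      · exact SimpleGraph.Adj.reachable (G := G) ⟨e, h⟩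
    | refl x => exact .refl _
    | symm x y _ ih => exact ih.symm
    | trans x y z _ _ h1 h2 => exact h1.trans h2
  have h1 := hG.card_vert_le_card_edgeSet_add_one
  have h2 := G.sum_degrees_eq_twice_card_edges
  rw [Nat.card_eq_fintype_card, Nat.card_eq_fintype_card, ← SimpleGraph.edgeFinset_card] at h1
  have h3 : ∀ x, G.degree x + ((if s x = x then 1 else 0) + (if t x = x then 1 else 0)) ≤ 2 := by
    intro x
    have hsub : G.neighborFinset x ⊆ ({s x, t x} : Finset K).erase x := by
      intro y hy
      rw [SimpleGraph.mem_neighborFinset] at hy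
      rcases hy with ⟨hy, h | h⟩ <;> simp [h, hy.symm]
    have hc := Finset.card_le_card hsub
    rw [SimpleGraph.card_neighborFinset_eq_degree] at hc
    refine le_trans (Nat.add_le_add_right hc _) ?_
    have hp := Finset.card_le_two (a := s x) (b := t x)
    split_ifs with a b b
    · simp [a, b]
    · rw [a, Finset.erase_insert (by simpa using Ne.symm b)]; simp
    · rw [b, Finset.pair_comm, Finset.erase_insert (by simpa using Ne.symm a)]; simp
    · exact (Finset.card_le_card (Finset.erase_subset _ _)).trans hp
  have h4 := Finset.sum_le_sum (s := Finset.univ) fun x _ => h3 x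
  rw [Finset.sum_add_distrib, Finset.sum_add_distrib, ← Finset.card_filter, ← Finset.card_filter,
    h2] at h4
  simp only [Finset.sum_const, Finset.card_univ, smul_eq_mul] at h4
  omega

theorem even_fixed {K : Type} [Fintype K] [DecidableEq K] (s : K → K) (hs : ∀ x, s (s x) = x) :
    ((Finset.univ.filter fun x => s x = x).card : ZMod 2) = Fintype.card K := by
  have h : ((Finset.univ.filter fun x => ¬ s x = x).card : ZMod 2) = 0 := by
    rw [Finset.card_eq_sum_ones, Nat.cast_sum]
    refine Finset.sum_involution (fun x _ => s x) (fun x _ => by decide)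
      (fun x hx _ => (Finset.mem_filter.1 hx).2) (fun x hx => ?_) (fun x _ => hs x)
    simp only [Finset.mem_filter, Finset.mem_univ, true_and] at hx ⊢
    rw [hs]
    exact Ne.symm hx
  have h2 := Finset.card_filter_add_card_filter_not (s := (Finset.univ : Finset K))
    (fun x => s x = x)
  rw [Finset.card_univ] at h2
  rw [← h2, Nat.cast_add, h, add_zero]

variable {A B C : Type} [Fintype A] [Fintype B] [Fintype C]

theorem isMatching_stack {r : Setoid (A ⊕ B)} {s : Setoid (B ⊕ C)}
    (hr : IsMatching r) (hs : IsMatching s) : IsMatching (stack r s) := by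
  classical
  obtain ⟨σ, σ1, σ2, σ3⟩ := hr.exists_partner
  obtain ⟨τ, τ1, τ2, τ3⟩ := hs.exists_partner
  let S : (A ⊕ C) ⊕ B → (A ⊕ C) ⊕ B := Sum.elim (Sum.elim (fun a => inFirst (σ (Sum.inl a)))
    (fun c => Sum.inl (Sum.inr c))) (fun b => inFirst (σ (Sum.inr b)))
  let T : (A ⊕ C) ⊕ B → (A ⊕ C) ⊕ B := Sum.elim (Sum.elim (fun a => Sum.inl (Sum.inl a))
    (fun c => inSecond (τ (Sum.inr c)))) (fun b => inSecond (τ (Sum.inl b)))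
  have S1 : ∀ x, S (inFirst x) = inFirst (σ x) := by rintro (x | x) <;> rfl
  have T1 : ∀ x, T (inSecond x) = inSecond (τ x) := by rintro (x | x) <;> rfl
  have F1 : Function.Injective (inFirst : A ⊕ B → (A ⊕ C) ⊕ B) := by
    rintro (x | x) (y | y) h <;> simp_all [inFirst]
  have F2 : Function.Injective (inSecond : B ⊕ C → (A ⊕ C) ⊕ B) := by
    rintro (x | x) (y | y) h <;> simp_all [inSecond]
  have SS : ∀ x, S (S x) = x := by
    rintro ((x | x) | x)
    · exact (S1 _).trans (congrArg inFirst (σ1 (Sum.inl x)))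
    · rfl
    · exact (S1 _).trans (congrArg inFirst (σ1 (Sum.inr x)))
  have TT : ∀ x, T (T x) = x := by
    rintro ((x | x) | x)
    · rfl
    · exact (T1 _).trans (congrArg inSecond (τ1 (Sum.inr x)))
    · exact (T1 _).trans (congrArg inSecond (τ1 (Sum.inl x)))
  have Sfix : ∀ x, S x = x ↔ ∃ c, x = Sum.inl (Sum.inr c) := by
    rintro ((x | x) | x)
    · exact ⟨fun h => absurd (F1 (a₁ := σ (Sum.inl x)) (a₂ := Sum.inl x) h) (σ2 _), by simp⟩
    · simp [S]
    · exact ⟨fun h => absurd (F1 (a₁ := σ (Sum.inr x)) (a₂ := Sum.inr x) h) (σ2 _), by simp⟩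
  have Tfix : ∀ x, T x = x ↔ ∃ a, x = Sum.inl (Sum.inl a) := by
    rintro ((x | x) | x)
    · simp [T]
    · exact ⟨fun h => absurd (F2 (a₁ := τ (Sum.inr x)) (a₂ := Sum.inr x) h) (τ2 _), by simp⟩
    · exact ⟨fun h => absurd (F2 (a₁ := τ (Sum.inl x)) (a₂ := Sum.inl x) h) (τ2 _), by simp⟩
  have gS : ∀ x, glue r s x (S x) := by
    have : ∀ x, glue r s (inFirst x) (S (inFirst x)) := fun x =>
      .rel _ _ (.inl ⟨x, σ x, (σ3 _ _).2 (.inr rfl), rfl, (S1 x).symm⟩)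
    rintro ((x | x) | x)
    · exact this (Sum.inl x)
    · exact .refl _
    · exact this (Sum.inr x)
  have gT : ∀ x, glue r s x (T x) := by
    have : ∀ x, glue r s (inSecond x) (T (inSecond x)) := fun x =>
      .rel _ _ (.inr ⟨x, τ x, (τ3 _ _).2 (.inr rfl), rfl, (T1 x).symm⟩)
    rintro ((x | x) | x)
    · exact .refl _
    · exact this (Sum.inr x)
    · exact this (Sum.inl x)
  intro x
  let K := {y : (A ⊕ C) ⊕ B // glue r s (Sum.inl x) y}
  let x0 : K := ⟨Sum.inl x, (glue r s).refl _⟩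
  let S' : K → K := fun y => ⟨S y.1, (glue r s).trans y.2 (gS _)⟩
  let T' : K → K := fun y => ⟨T y.1, (glue r s).trans y.2 (gT _)⟩
  have : Nonempty K := ⟨x0⟩
  have conn : ∀ y : K, ∀ z (h : glue r s y.1 z), Relation.EqvGen (fun x y => S' x = y ∨ T' x = y) y
      ⟨z, (glue r s).trans y.2 h⟩ := by
    have : ∀ y z, glue r s y z → ∀ (hy : glue r s (Sum.inl x) y) (hz : glue r s (Sum.inl x) z),
        Relation.EqvGen (fun x y => S' x = y ∨ T' x = y) (⟨y, hy⟩ : K) ⟨z, hz⟩ := by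
      intro y z hyz
      induction hyz with
      | rel y z h =>
        intro hy hz
        rcases h with ⟨a, b, hab, rfl, rfl⟩ | ⟨a, b, hab, rfl, rfl⟩
        · rcases (σ3 _ _).1 hab with rfl | rfl
          · exact .refl _
          · exact .rel _ _ (.inl (Subtype.ext (S1 a)))
        · rcases (τ3 _ _).1 hab with rfl | rfl
          · exact .refl _
          · exact .rel _ _ (.inr (Subtype.ext (T1 a)))
      | refl y => intro _ _; exact .refl _
      | symm y z _ ih => intro hy hz; exact (ih hz hy).symm
      | trans y z w h1 h2 ih1 ih2 =>
        intro hy hw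
        have hz : glue r s (Sum.inl x) z := (glue r s).trans hy h1
        exact (ih1 hy hz).trans _ _ _ (ih2 hz hw)
    exact fun y z h => this _ _ h _ _
  have two := ends_le_two S' T' (fun y => Subtype.ext (SS _)) (fun y => Subtype.ext (TT _))
    (fun y z => conn y z.1 ((glue r s).trans ((glue r s).symm y.2) z.2))
  have ev : ((Finset.univ.filter fun x => S' x = x).card +
      (Finset.univ.filter fun x => T' x = x).card : ZMod 2) = 0 := by
    rw [even_fixed S' (fun y => Subtype.ext (SS _)), even_fixed T' (fun y => Subtype.ext (TT _))]
    exact CharTwo.add_self_eq_zero _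
  let E : Finset K := Finset.univ.filter fun y => ∃ z, y.1 = Sum.inl z
  have Sfix' : ∀ y : K, S' y = y ↔ ∃ c, y.1 = Sum.inl (Sum.inr c) :=
    fun y => Subtype.ext_iff.trans (Sfix y.1)
  have Tfix' : ∀ y : K, T' y = y ↔ ∃ a, y.1 = Sum.inl (Sum.inl a) :=
    fun y => Subtype.ext_iff.trans (Tfix y.1)
  have hE : E.card = (Finset.univ.filter fun x => S' x = x).card +
      (Finset.univ.filter fun x => T' x = x).card := by
    rw [← Finset.card_union_of_disjoint]
    · congr 1
      ext y
      simp only [E, Finset.mem_filter, Finset.mem_univ, true_and, Finset.mem_union, Sfix', Tfix']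
      constructor
      · rintro ⟨z | z, h⟩
        · exact .inr ⟨z, h⟩
        · exact .inl ⟨z, h⟩
      · rintro (⟨z, h⟩ | ⟨z, h⟩) <;> exact ⟨_, h⟩
    · rw [Finset.disjoint_left]
      intro y h1 h2
      simp only [Finset.mem_filter, Finset.mem_univ, true_and, Sfix', Tfix'] at h1 h2
      obtain ⟨c, hc⟩ := h1
      obtain ⟨a, ha⟩ := h2
      simp [hc] at ha
  have hx0 : x0 ∈ E := Finset.mem_filter.2 ⟨Finset.mem_univ _, x, rfl⟩
  have hE2 : E.card = 2 := by
    have h0 : 0 < E.card := Finset.card_pos.2 ⟨_, hx0⟩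
    have h1 : E.card ≤ 2 := hE ▸ two
    have h3 : (E.card : ZMod 2) = 0 := by rw [hE, Nat.cast_add]; exact ev
    interval_cases E.card
    · exact absurd h3 (by decide)
    · rfl
  obtain ⟨y, hy⟩ : ∃ y, E.erase x0 = {y} := by
    rw [← Finset.card_eq_one, Finset.card_erase_of_mem hx0, hE2]
  have hyE : y ∈ E.erase x0 := by rw [hy]; simp
  obtain ⟨z, hz⟩ : ∃ z, y.1 = Sum.inl z := by
    have := (Finset.mem_erase.1 hyE).2
    simpa [E] using this
  refine ⟨z, ⟨?_, ?_⟩, ?_⟩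
  · rintro rfl
    exact (Finset.mem_erase.1 hyE).1 (Subtype.ext hz)
  · have := y.2
    rw [hz] at this
    exact this
  · rintro w ⟨hw1, hw2⟩
    have hw : (⟨Sum.inl w, hw2⟩ : K) ∈ E.erase x0 := by
      rw [Finset.mem_erase]
      refine ⟨fun h => hw1 (Sum.inl_injective (congrArg Subtype.val h)), ?_⟩
      exact Finset.mem_filter.2 ⟨Finset.mem_univ _, w, rfl⟩
    rw [hy, Finset.mem_singleton] at hw
    exact Sum.inl_injective ((congrArg Subtype.val hw).trans hz)

end Planarity

/-- The position of a dot along the boundary of the rectangle, starting at the bottom left corner: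
the bottom dots from left to right, then the top dots from right to left. -/
def pos (m n : ℕ) : Fin m ⊕ Fin n → ℕ := Sum.elim (fun i => i) (fun j => m + (n - 1 - j))

theorem pos_injective (m n : ℕ) : Function.Injective (pos m n) := by
  rintro (x | x) (y | y) h <;> simp only [pos, Sum.elim_inl, Sum.elim_inr] at h
  · exact congrArg _ (Fin.ext h)
  · omega
  · omega
  · exact congrArg _ (Fin.ext (by omega))

theorem sum_pairs {X : Type} [Fintype X] [DecidableEq X] (a b c d : X) (g : X → X → ZMod 2) :
    ∑ x, ∑ y, ((if x = a then 1 else 0) + (if x = c then 1 else 0)) *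
      ((if y = b then 1 else 0) + (if y = d then 1 else 0)) * g x y =
    g a b + g a d + (g c b + g c d) := by
  have h : ∀ (e f : X) (k : X → ZMod 2),
      ∑ x, ((if x = e then 1 else 0) + (if x = f then 1 else 0)) * k x = k e + k f := by
    intro e f k
    simp [add_mul, Finset.sum_add_distrib]
  simp_rw [mul_assoc, ← Finset.mul_sum, h]

theorem isNoncrossing_stack {m n p : ℕ} {r : Setoid (Fin m ⊕ Fin n)} {s : Setoid (Fin n ⊕ Fin p)}
    (hr : IsMatching r) (hs : IsMatching s)
    (hr' : IsNoncrossing (pos m n) r) (hs' : IsNoncrossing (pos n p) s) :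
    IsNoncrossing (pos m p) (stack r s) := by
  classical
  obtain ⟨σ, σ1, σ2, σ3⟩ := hr.exists_partner
  obtain ⟨τ, τ1, τ2, τ3⟩ := hs.exists_partner
  obtain ⟨ρ, ρ1, ρ2, ρ3⟩ := (isMatching_stack hr hs).exists_partner
  intro a b c d hab hbc hcd hac hbd
  -- the indicator function of a component
  let χ : (Fin m ⊕ Fin p) → (Fin m ⊕ Fin p) ⊕ Fin n → ZMod 2 :=
    fun x y => if glue r s (Sum.inl x) y then 1 else 0
  have gσ : ∀ y, glue r s (inFirst y) (inFirst (σ y)) := fun y =>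
    .rel _ _ (.inl ⟨y, σ y, (σ3 _ _).2 (.inr rfl), rfl, rfl⟩)
  have gτ : ∀ y, glue r s (inSecond y) (inSecond (τ y)) := fun y =>
    .rel _ _ (.inr ⟨y, τ y, (τ3 _ _).2 (.inr rfl), rfl, rfl⟩)
  have inv : ∀ x y z, glue r s y z → χ x z = χ x y := by
    intro x y z h
    have : glue r s (Sum.inl x) z ↔ glue r s (Sum.inl x) y :=
      ⟨fun h' => (glue r s).trans h' ((glue r s).symm h), fun h' => (glue r s).trans h' h⟩
    simp only [χ, this]
  have nab : ¬ glue r s (Sum.inl a) (Sum.inl b) := by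
    intro h
    rcases (ρ3 a c).1 hac with e | e
    · subst e; omega
    · rcases (ρ3 a b).1 h with e' | e'
      · subst e'; omega
      · rw [← e] at e'; subst e'; omega
  have disj : ∀ y, χ a y * χ b y = 0 := by
    intro y
    simp only [χ]
    split_ifs with h1 h2
    · exact absurd ((glue r s).trans h1 ((glue r s).symm h2)) nab
    all_goals simp
  have L1 := link_eq_zero (pos m n) (pos_injective m n) r hr' σ σ1 σ2 σ3 (χ a ∘ inFirst)
    (χ b ∘ inFirst) (fun y => inv _ _ _ (gσ y)) (fun y => inv _ _ _ (gσ y)) (fun y => disj _)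
  have L2 := link_eq_zero (pos n p) (pos_injective n p) s hs' τ τ1 τ2 τ3 (χ a ∘ inSecond)
    (χ b ∘ inSecond) (fun y => inv _ _ _ (gτ y)) (fun y => inv _ _ _ (gτ y)) (fun y => disj _)
  have P2 : ∀ x, ∑ y, (χ x ∘ inSecond) y = 0 := fun x =>
    sum_invariant_eq_zero τ τ1 τ2 _ fun y => by
      rw [Function.comp, Function.comp, inv _ _ _ (gτ y)]; exact CharTwo.add_self_eq_zero _
  have val : ∀ x y, x ≠ y → stack r s x y → ∀ z, χ x (Sum.inl z) =
      (if z = x then 1 else 0) + (if z = y then 1 else 0) := by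
    intro x y hne hxy z
    have : glue r s (Sum.inl x) (Sum.inl z) ↔ z = x ∨ z = y := by
      rcases (ρ3 x y).1 hxy with e | e
      · exact absurd e.symm hne
      · rw [e]; exact ρ3 x z
    simp only [χ, this]
    by_cases h1 : z = x <;> by_cases h2 : z = y <;> simp [h1, h2]
    · exact absurd (h1.symm.trans h2) hne
    · exact hne
    · exact hne.symm
  have L3 : ∑ x, ∑ y, χ a (Sum.inl x) * χ b (Sum.inl y) *
      (if pos m p x < pos m p y then 1 else 0) = 0 := by
    have Q4 := P2 b
    have hB : ∑ x, ∑ y, χ a (Sum.inr x) * χ b (Sum.inr y) *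
          (if pos n p (Sum.inl x) < pos n p (Sum.inl y) then 1 else 0) +
        ∑ x, ∑ y, χ a (Sum.inr x) * χ b (Sum.inr y) *
          (if pos m n (Sum.inr x) < pos m n (Sum.inr y) then 1 else 0) =
        (∑ x, χ a (Sum.inr x)) * ∑ y, χ b (Sum.inr y) := by
      rw [Finset.sum_mul_sum, ← Finset.sum_add_distrib]
      refine Finset.sum_congr rfl fun x _ => ?_
      rw [← Finset.sum_add_distrib]
      refine Finset.sum_congr rfl fun y _ => ?_
      rw [← mul_add]
      by_cases e : x = y
      · subst e; simp [disj]
      · have e' : (x : ℕ) ≠ y := fun h => e (Fin.ext h)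
        have hx := x.2
        have hy := y.2
        have e1 : pos n p (Sum.inl x) < pos n p (Sum.inl y) ↔ (x : ℕ) < y := Iff.rfl
        have e2 : pos m n (Sum.inr x) < pos m n (Sum.inr y) ↔ (y : ℕ) < x := by
          simp only [pos, Sum.elim_inr]; omega
        by_cases h : (x : ℕ) < y
        · rw [if_pos (e1.2 h), if_neg (fun h' => absurd (e2.1 h') (by omega))]; simp
        · rw [if_neg (fun h' => h (e1.1 h')), if_pos (e2.2 (by omega))]; simp
    have n1 : ∀ (x : Fin m) (y : Fin n), pos m n (Sum.inl x) < pos m n (Sum.inr y) := by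
      intro x y; simp only [pos, Sum.elim_inl, Sum.elim_inr]; omega
    have n2 : ∀ (x : Fin n) (y : Fin p), pos n p (Sum.inl x) < pos n p (Sum.inr y) := by
      intro x y; simp only [pos, Sum.elim_inl, Sum.elim_inr]; omega
    have n3 : ∀ (x : Fin m) (y : Fin p), pos m p (Sum.inl x) < pos m p (Sum.inr y) := by
      intro x y; simp only [pos, Sum.elim_inl, Sum.elim_inr]; omega
    have eA : ∀ x y : Fin m, (pos m n (Sum.inl x) < pos m n (Sum.inl y)) ↔
        (pos m p (Sum.inl x) < pos m p (Sum.inl y)) := fun _ _ => Iff.rfl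
    have eC : ∀ x y : Fin p, (pos n p (Sum.inr x) < pos n p (Sum.inr y)) ↔
        (pos m p (Sum.inr x) < pos m p (Sum.inr y)) := by
      intro x y; simp only [pos, Sum.elim_inr]; omega
    simp only [Fintype.sum_sum_type, Function.comp, inFirst, inSecond, Sum.elim_inl, Sum.elim_inr,
      n1, n2, n3, (n1 _ _).not_gt, (n2 _ _).not_gt, (n3 _ _).not_gt, if_true, if_false, mul_one,
      mul_zero, Finset.sum_const_zero, Finset.sum_add_distrib, eA, eC]
      at L1 L2 Q4 ⊢
    simp only [← Finset.mul_sum, ← Finset.sum_mul] at L1 L2 ⊢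
    have two : (2 : ZMod 2) = 0 := rfl
    linear_combination L1 + L2 - hB + ((∑ i, χ a (Sum.inl (Sum.inl i))) -
      ∑ i, χ a (Sum.inr i)) * Q4 -
      (∑ i, χ a (Sum.inl (Sum.inl i))) * (∑ i, χ b (Sum.inr i)) * two
  rw [show (∑ x, ∑ y, χ a (Sum.inl x) * χ b (Sum.inl y) *
      (if pos m p x < pos m p y then 1 else 0)) = (1 : ZMod 2) from ?_] at L3
  · exact absurd L3 (by decide)
  · have hac' : a ≠ c := by rintro rfl; omega
    have hbd' : b ≠ d := by rintro rfl; omega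
    simp only [val a c hac' hac, val b d hbd' hbd]
    rw [sum_pairs, if_pos hab, if_pos (hab.trans (hbc.trans hcd)), if_pos hcd, if_neg hbc.not_gt]
    decide

/-- A loop-free planar diagram `m → n`, up to isotopy: `m` dots on the bottom and `n` dots on the
top of a rectangle, every dot being joined to exactly one other dot, by non-crossing lines.
It is recorded by the relation of lying on the same line. -/
@[ext]
structure Diagram (m n : ℕ) where
  rel : Setoid (Fin m ⊕ Fin n)
  matching : IsMatching rel
  noncrossing : IsNoncrossing (pos m n) rel

theorem isMatching_idRel (n : ℕ) : IsMatching (idRel (Fin n)) := by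
  rintro (x | x)
  · refine ⟨Sum.inr x, ⟨by simp, rfl⟩, ?_⟩
    rintro (y | y) ⟨h1, h2⟩
    · exact absurd (congrArg Sum.inl (Eq.symm h2)) h1
    · exact congrArg Sum.inr (Eq.symm h2)
  · refine ⟨Sum.inl x, ⟨by simp, rfl⟩, ?_⟩
    rintro (y | y) ⟨h1, h2⟩
    · exact congrArg Sum.inl (Eq.symm h2)
    · exact absurd (congrArg Sum.inr (Eq.symm h2)) h1

theorem isNoncrossing_idRel (n : ℕ) : IsNoncrossing (pos n n) (idRel (Fin n)) := by
  intro a b c d hab hbc hcd hac hbd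
  have h1 : Sum.elim id id a = Sum.elim id id c := hac
  have h2 : Sum.elim id id b = Sum.elim id id d := hbd
  rcases a with a | a <;> rcases b with b | b <;> rcases c with c | c <;> rcases d with d | d <;>
    simp only [pos, Sum.elim_inl, Sum.elim_inr, id] at hab hbc hcd h1 h2 <;> subst h1 h2 <;> omega

/-- The identity diagram. -/
def Diagram.id (n : ℕ) : Diagram n n := ⟨idRel _, isMatching_idRel n, isNoncrossing_idRel n⟩

/-- Vertical stacking (`g` on top of `f`), with closed loops removed. -/
def Diagram.comp {m n p : ℕ} (f : Diagram m n) (g : Diagram n p) : Diagram m p :=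
  ⟨stack f.rel g.rel, isMatching_stack f.matching g.matching,
    isNoncrossing_stack f.matching g.matching f.noncrossing g.noncrossing⟩

/-- The number of closed loops which arise when stacking `g` on top of `f`. -/
noncomputable def Diagram.loops {m n p : ℕ} (f : Diagram m n) (g : Diagram n p) : ℕ :=
  TemperleyLieb.loops f.rel g.rel

/-- The cup, the unique diagram `0 → 2`. -/
def Diagram.cup : Diagram 0 2 where
  rel := ⊤
  matching := by
    rintro (x | x)
    · exact x.elim0
    · refine ⟨Sum.inr x.rev, ⟨?_, trivial⟩, ?_⟩
      · fin_cases x <;> decide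
      · rintro (y | y) ⟨h, -⟩
        · exact y.elim0
        · fin_cases x <;> fin_cases y <;> simp_all
  noncrossing := by
    rintro (a | a) (b | b) (c | c) (d | d) h1 h2 h3 <;>
      simp only [pos, Sum.elim_inl, Sum.elim_inr] at h1 h2 h3 <;> omega

/-- The cap, the unique diagram `2 → 0`. -/
def Diagram.cap : Diagram 2 0 where
  rel := ⊤
  matching := by
    rintro (x | x)
    · refine ⟨Sum.inl x.rev, ⟨?_, trivial⟩, ?_⟩
      · fin_cases x <;> decide
      · rintro (y | y) ⟨h, -⟩
        · fin_cases x <;> fin_cases y <;> simp_all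
        · exact y.elim0
    · exact x.elim0
  noncrossing := by
    rintro (a | a) (b | b) (c | c) (d | d) h1 h2 h3 <;>
      simp only [pos, Sum.elim_inl, Sum.elim_inr] at h1 h2 h3 <;> omega

section Tensor

variable {m m' n n' p p' : ℕ}

/-- The dots of the left and of the right factor in a horizontal juxtaposition. -/
def splitDots (m m' n n' : ℕ) :
    Fin (m + m') ⊕ Fin (n + n') ≃ (Fin m ⊕ Fin n) ⊕ (Fin m' ⊕ Fin n') :=
  (Equiv.sumCongr finSumFinEquiv.symm finSumFinEquiv.symm).trans (Equiv.sumSumSumComm _ _ _ _)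

/-- Horizontal juxtaposition: no dot on the left is joined to a dot on the right. -/
def juxtapose (r : Setoid (Fin m ⊕ Fin n)) (s : Setoid (Fin m' ⊕ Fin n')) :
    Setoid (Fin (m + m') ⊕ Fin (n + n')) where
  r x y := Sum.LiftRel r s (splitDots m m' n n' x) (splitDots m m' n n' y)
  iseqv :=
    { refl := fun x => by
        rcases splitDots m m' n n' x with a | a
        · exact .inl (r.refl a)
        · exact .inr (s.refl a)
      symm := fun {x y} h => by
        revert h
        generalize splitDots m m' n n' x = a
        generalize splitDots m m' n n' y = b
        rintro (h | h)
        · exact .inl (r.symm h)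
        · exact .inr (s.symm h)
      trans := fun {x y z} h h' => by
        revert h h'
        generalize splitDots m m' n n' x = a
        generalize splitDots m m' n n' y = b
        generalize splitDots m m' n n' z = c
        rintro (h | h) (h' | h')
        · exact .inl (r.trans h h')
        · exact .inr (s.trans h h') }

theorem juxtapose_iff (r : Setoid (Fin m ⊕ Fin n)) (s : Setoid (Fin m' ⊕ Fin n'))
    (x y : (Fin m ⊕ Fin n) ⊕ (Fin m' ⊕ Fin n')) :
    juxtapose r s ((splitDots m m' n n').symm x) ((splitDots m m' n n').symm y) ↔
      Sum.LiftRel r s x y := by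
  change Sum.LiftRel r s (splitDots m m' n n' _) (splitDots m m' n n' _) ↔ _
  rw [Equiv.apply_symm_apply, Equiv.apply_symm_apply]

theorem isMatching_juxtapose {r : Setoid (Fin m ⊕ Fin n)} {s : Setoid (Fin m' ⊕ Fin n')}
    (hr : IsMatching r) (hs : IsMatching s) : IsMatching (juxtapose r s) := by
  intro x
  obtain ⟨x, rfl⟩ := (splitDots m m' n n').symm.surjective x
  rcases x with x | x
  · obtain ⟨y, ⟨h1, h2⟩, h3⟩ := hr x
    refine ⟨(splitDots m m' n n').symm (Sum.inl y), ⟨by simpa using h1, ?_⟩, ?_⟩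
    · exact (juxtapose_iff r s _ _).2 (.inl h2)
    · rintro z ⟨z1, z2⟩
      obtain ⟨z, rfl⟩ := (splitDots m m' n n').symm.surjective z
      rw [juxtapose_iff] at z2
      cases z2 with
      | inl h => rw [h3 _ ⟨by simpa using z1, h⟩]
  · obtain ⟨y, ⟨h1, h2⟩, h3⟩ := hs x
    refine ⟨(splitDots m m' n n').symm (Sum.inr y), ⟨by simpa using h1, ?_⟩, ?_⟩
    · exact (juxtapose_iff r s _ _).2 (.inr h2)
    · rintro z ⟨z1, z2⟩
      obtain ⟨z, rfl⟩ := (splitDots m m' n n').symm.surjective z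
      rw [juxtapose_iff] at z2
      cases z2 with
      | inr h => rw [h3 _ ⟨by simpa using z1, h⟩]

theorem pos_splitDots (x : (Fin m ⊕ Fin n) ⊕ (Fin m' ⊕ Fin n')) :
    pos (m + m') (n + n') ((splitDots m m' n n').symm x) =
      Sum.elim (Sum.elim (fun i : Fin m => (i : ℕ)) (fun j : Fin n => m + m' + n' + (n - 1 - j)))
        (fun y => m + pos m' n' y) x := by
  rcases x with (x | x) | (x | x) <;> simp [splitDots, pos] <;> omega

theorem isNoncrossing_juxtapose {r : Setoid (Fin m ⊕ Fin n)} {s : Setoid (Fin m' ⊕ Fin n')}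
    (hr : IsNoncrossing (pos m n) r) (hs : IsNoncrossing (pos m' n') s) :
    IsNoncrossing (pos (m + m') (n + n')) (juxtapose r s) := by
  intro a b c d hab hbc hcd hac hbd
  obtain ⟨a, rfl⟩ := (splitDots m m' n n').symm.surjective a
  obtain ⟨b, rfl⟩ := (splitDots m m' n n').symm.surjective b
  obtain ⟨c, rfl⟩ := (splitDots m m' n n').symm.surjective c
  obtain ⟨d, rfl⟩ := (splitDots m m' n n').symm.surjective d
  rw [juxtapose_iff] at hac hbd
  simp only [pos_splitDots] at hab hbc hcd
  have lt' : ∀ y, pos m' n' y < m' + n' := by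
    rintro (y | y) <;> simp only [pos, Sum.elim_inl, Sum.elim_inr] <;> omega
  rcases hac with @⟨a, c, hac⟩ | @⟨a, c, hac⟩ <;> rcases hbd with @⟨b, d, hbd⟩ | @⟨b, d, hbd⟩ <;>
    simp only [Sum.elim_inl, Sum.elim_inr] at hab hbc hcd
  · refine hr a b c d ?_ ?_ ?_ hac hbd
    · rcases a with a | a <;> rcases b with b | b <;>
        simp only [Sum.elim_inl, Sum.elim_inr, pos] at hab ⊢ <;> omega
    · rcases b with b | b <;> rcases c with c | c <;>
        simp only [Sum.elim_inl, Sum.elim_inr, pos] at hbc ⊢ <;> omega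
    · rcases c with c | c <;> rcases d with d | d <;>
        simp only [Sum.elim_inl, Sum.elim_inr, pos] at hcd ⊢ <;> omega
  · have hb := lt' b
    have hd := lt' d
    rcases c with c | c <;> simp only [Sum.elim_inl, Sum.elim_inr] at hbc hcd <;> omega
  · have ha := lt' a
    have hc := lt' c
    rcases b with b | b <;> simp only [Sum.elim_inl, Sum.elim_inr] at hab hbc <;> omega
  · exact hs a b c d (by omega) (by omega) (by omega) hac hbd

/-- Horizontal juxtaposition of diagrams. -/
def Diagram.tensor (f : Diagram m n) (g : Diagram m' n') : Diagram (m + m') (n + n') :=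
  ⟨juxtapose f.rel g.rel, isMatching_juxtapose f.matching g.matching,
    isNoncrossing_juxtapose f.noncrossing g.noncrossing⟩

theorem mat_juxtapose (r : Setoid (Fin m ⊕ Fin n)) (s : Setoid (Fin m' ⊕ Fin n'))
    (α : Fin m → Bool) (α' : Fin m' → Bool) (β : Fin n → Bool) (β' : Fin n' → Bool) :
    mat (juxtapose r s) (Fin.append α α') (Fin.append β β') = mat r α β * mat s α' β' := by
  have h : Resp (juxtapose r s) (Sum.elim (Fin.append α α') (Fin.append β β')) ↔
      Resp r (Sum.elim α β) ∧ Resp s (Sum.elim α' β') := by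
    have hv : ∀ x, Sum.elim (Fin.append α α') (Fin.append β β')
        ((splitDots m m' n n').symm x) = Sum.elim (Sum.elim α β) (Sum.elim α' β') x := by
      rintro ((x | x) | (x | x)) <;> simp [splitDots]
    constructor
    · intro h
      constructor
      · intro x y hxy
        have := h _ _ ((juxtapose_iff r s (Sum.inl x) (Sum.inl y)).2 (.inl hxy))
        rwa [hv, hv] at this
      · intro x y hxy
        have := h _ _ ((juxtapose_iff r s (Sum.inr x) (Sum.inr y)).2 (.inr hxy))
        rwa [hv, hv] at this
    · rintro ⟨h1, h2⟩ x y hxy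
      obtain ⟨x, rfl⟩ := (splitDots m m' n n').symm.surjective x
      obtain ⟨y, rfl⟩ := (splitDots m m' n n').symm.surjective y
      rw [juxtapose_iff] at hxy
      rw [hv, hv]
      cases hxy with
      | inl h => exact h1 _ _ h
      | inr h => exact h2 _ _ h
  unfold mat
  by_cases h1 : Resp r (Sum.elim α β) <;> by_cases h2 : Resp s (Sum.elim α' β') <;>
    simp [h, h1, h2]

theorem append_surj (α : Fin (m + m') → Bool) :
    ∃ α₁ α₂, α = Fin.append (m := m) (n := m') α₁ α₂ :=
  ⟨_, _, (Fin.append_castAdd_natAdd (f := α)).symm⟩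

theorem stack_juxtapose (r : Setoid (Fin m ⊕ Fin n)) (r' : Setoid (Fin m' ⊕ Fin n'))
    (s : Setoid (Fin n ⊕ Fin p)) (s' : Setoid (Fin n' ⊕ Fin p')) :
    loops (juxtapose r r') (juxtapose s s') = loops r s + loops r' s' ∧
      stack (juxtapose r r') (juxtapose s s') = juxtapose (stack r s) (stack r' s') := by
  apply scaled_mat_inj
  intro α γ
  obtain ⟨α, α', rfl⟩ := append_surj α
  obtain ⟨γ, γ', rfl⟩ := append_surj γ
  rw [← mat_stack, mat_juxtapose, pow_add, mul_mul_mul_comm, ← mat_stack, ← mat_stack,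
    Finset.sum_mul_sum, ← Fintype.sum_prod_type', ← (Fin.appendEquiv n n').sum_comp]
  refine Finset.sum_congr rfl fun β _ => ?_
  simp only [Fin.appendEquiv, Equiv.coe_fn_mk, mat_juxtapose]
  exact mul_mul_mul_comm _ _ _ _

theorem juxtapose_id (m n : ℕ) :
    juxtapose (idRel (Fin m)) (idRel (Fin n)) = idRel (Fin (m + n)) := by
  classical
  apply mat_inj
  funext α β
  obtain ⟨α, α', rfl⟩ := append_surj α
  obtain ⟨β, β', rfl⟩ := append_surj β
  rw [mat_juxtapose, mat_idRel, mat_idRel, mat_idRel]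
  have : Fin.append α α' = Fin.append β β' ↔ α = β ∧ α' = β' := by
    have := (Fin.appendEquiv (α := Bool) m n).injective.eq_iff (a := (α, α')) (b := (β, β'))
    simpa [Fin.appendEquiv] using this
  simp only [this, ite_and]
  split_ifs <;> rfl

end Tensor

theorem Diagram.id_comp {m n : ℕ} (f : Diagram m n) :
    (Diagram.id m).comp f = f ∧ (Diagram.id m).loops f = 0 :=
  ⟨Diagram.ext (id_stack f.rel).2, (id_stack f.rel).1⟩

theorem Diagram.comp_id {m n : ℕ} (f : Diagram m n) :
    f.comp (Diagram.id n) = f ∧ f.loops (Diagram.id n) = 0 :=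
  ⟨Diagram.ext (stack_id f.rel).2, (stack_id f.rel).1⟩

theorem Diagram.assoc {m n p q : ℕ} (f : Diagram m n) (g : Diagram n p) (h : Diagram p q) :
    (f.comp g).comp h = f.comp (g.comp h) ∧
      f.loops g + (f.comp g).loops h = g.loops h + f.loops (g.comp h) :=
  ⟨Diagram.ext (stack_assoc f.rel g.rel h.rel).2, (stack_assoc f.rel g.rel h.rel).1⟩

theorem Diagram.tensor_comp {m m' n n' p p' : ℕ} (f : Diagram m n) (f' : Diagram m' n')
    (g : Diagram n p) (g' : Diagram n' p') :
    (f.tensor f').comp (g.tensor g') = (f.comp g).tensor (f'.comp g') ∧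
      (f.tensor f').loops (g.tensor g') = f.loops g + f'.loops g' :=
  ⟨Diagram.ext (stack_juxtapose f.rel f'.rel g.rel g'.rel).2,
    (stack_juxtapose f.rel f'.rel g.rel g'.rel).1⟩

theorem Diagram.tensor_id (m n : ℕ) :
    (Diagram.id m).tensor (Diagram.id n) = Diagram.id (m + n) :=
  Diagram.ext (juxtapose_id m n)

theorem tensor_rel_iff {m m' n n' : ℕ} (f : Diagram m n) (g : Diagram m' n')
    (x y : (Fin m ⊕ Fin n) ⊕ (Fin m' ⊕ Fin n')) :
    (f.tensor g).rel ((splitDots m m' n n').symm x) ((splitDots m m' n n').symm y) ↔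
      Sum.LiftRel f.rel g.rel x y :=
  juxtapose_iff f.rel g.rel x y

section Relations

variable {m₁ m₂ m₃ n₁ n₂ n₃ : ℕ}

theorem tensor_assoc_rel (f : Diagram m₁ n₁) (g : Diagram m₂ n₂) (h : Diagram m₃ n₃)
    (x y : Fin (m₁ + m₂ + m₃) ⊕ Fin (n₁ + n₂ + n₃)) :
    ((f.tensor g).tensor h).rel x y ↔ (f.tensor (g.tensor h)).rel
      (Sum.map (Fin.cast (Nat.add_assoc _ _ _)) (Fin.cast (Nat.add_assoc _ _ _)) x)
      (Sum.map (Fin.cast (Nat.add_assoc _ _ _)) (Fin.cast (Nat.add_assoc _ _ _)) y) := by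
  have e : ∀ x : Fin (m₁ + m₂ + m₃) ⊕ Fin (n₁ + n₂ + n₃),
      splitDots m₁ (m₂ + m₃) n₁ (n₂ + n₃)
        (Sum.map (Fin.cast (Nat.add_assoc _ _ _)) (Fin.cast (Nat.add_assoc _ _ _)) x) =
      Sum.elim (fun z => Sum.map _root_.id (fun w => (splitDots m₂ m₃ n₂ n₃).symm (Sum.inl w))
          (splitDots m₁ m₂ n₁ n₂ z))
        (fun w => Sum.inr ((splitDots m₂ m₃ n₂ n₃).symm (Sum.inr w)))
        (splitDots (m₁ + m₂) m₃ (n₁ + n₂) n₃ x) := by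
    intro x
    obtain ⟨x, rfl⟩ := (splitDots (m₁ + m₂) m₃ (n₁ + n₂) n₃).symm.surjective x
    rw [Equiv.apply_symm_apply, ← Equiv.eq_symm_apply]
    rcases x with x | (x | x)
    · obtain ⟨x, rfl⟩ := (splitDots m₁ m₂ n₁ n₂).symm.surjective x
      rcases x with (x | x) | (x | x) <;> simp [splitDots] <;> rfl
    · simp [splitDots]; ext; simp [Nat.add_assoc]
    · simp [splitDots]; ext; simp [Nat.add_assoc]
  change Sum.LiftRel _ _ _ _ ↔ Sum.LiftRel _ _ _ _
  rw [e, e]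
  generalize splitDots (m₁ + m₂) m₃ (n₁ + n₂) n₃ x = a
  generalize splitDots (m₁ + m₂) m₃ (n₁ + n₂) n₃ y = b
  rcases a with a | a <;> rcases b with b | b <;>
    simp only [Sum.elim_inl, Sum.elim_inr, Sum.liftRel_inl_inl, Sum.liftRel_inr_inr,
      Sum.not_liftRel_inl_inr, Sum.not_liftRel_inr_inl]
  · change Sum.LiftRel _ _ _ _ ↔ _
    generalize splitDots m₁ m₂ n₁ n₂ a = a
    generalize splitDots m₁ m₂ n₁ n₂ b = b
    rcases a with a | a <;> rcases b with b | b <;>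
      simp [tensor_rel_iff]
  · generalize splitDots m₁ m₂ n₁ n₂ a = a
    rcases a with a | a <;> simp [tensor_rel_iff]
  · generalize splitDots m₁ m₂ n₁ n₂ b = b
    rcases b with b | b <;> simp [tensor_rel_iff]
  · rw [tensor_rel_iff, Sum.liftRel_inr_inr]

end Relations

theorem mat_cup (α : Fin 0 → Bool) (β : Fin 2 → Bool) :
    mat Diagram.cup.rel α β = if β 0 = β 1 then 1 else 0 := by
  unfold mat
  congr 1
  rw [eq_iff_iff]
  constructor
  · intro h
    exact h (Sum.inr 0) (Sum.inr 1) trivial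
  · rintro h (x | x) (y | y) -
    · exact x.elim0
    · exact x.elim0
    · exact y.elim0
    · fin_cases x <;> fin_cases y <;> simp [h]

theorem mat_cap (α : Fin 2 → Bool) (β : Fin 0 → Bool) :
    mat Diagram.cap.rel α β = if α 0 = α 1 then 1 else 0 := by
  unfold mat
  congr 1
  rw [eq_iff_iff]
  constructor
  · intro h
    exact h (Sum.inl 0) (Sum.inl 1) trivial
  · rintro h (x | x) (y | y) -
    · fin_cases x <;> fin_cases y <;> simp [h]
    · exact y.elim0
    · exact x.elim0
    · exact x.elim0

theorem Diagram.cup_cap : Diagram.cup.comp Diagram.cap = Diagram.id 0 ∧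
    Diagram.cup.loops Diagram.cap = 1 := by
  have h := scaled_mat_inj (r := stack Diagram.cup.rel Diagram.cap.rel) (s := idRel (Fin 0))
    (a := TemperleyLieb.loops Diagram.cup.rel Diagram.cap.rel) (b := 1) (by
      intro α β
      rw [← mat_stack]
      simp only [mat_cup, mat_cap, mat_idRel, Subsingleton.elim α β, if_true]
      decide)
  exact ⟨Diagram.ext h.2, h.1⟩

theorem mat_tensor {m m' n n' : ℕ} (f : Diagram m n) (g : Diagram m' n')
    (α : Fin (m + m') → Bool) (β : Fin (n + n') → Bool) :
    mat (f.tensor g).rel α β =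
      mat f.rel (fun i => α (Fin.castAdd m' i)) (fun i => β (Fin.castAdd n' i)) *
      mat g.rel (fun i => α (Fin.natAdd m i)) (fun i => β (Fin.natAdd n i)) := by
  obtain ⟨α, α', rfl⟩ := append_surj α
  obtain ⟨β, β', rfl⟩ := append_surj β
  simp [Diagram.tensor, mat_juxtapose]

theorem mat_id_one (α β : Fin 1 → Bool) :
    mat (Diagram.id 1).rel α β = if α 0 = β 0 then 1 else 0 := by
  have : α = β ↔ α 0 = β 0 := by rw [funext_iff, Fin.forall_fin_one]
  simp only [Diagram.id, mat_idRel, this]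

/-- The first zigzag relation. -/
theorem Diagram.zigzag :
    Diagram.comp (n := 3) (Diagram.tensor (Diagram.id 1) Diagram.cup) (Diagram.tensor Diagram.cap (Diagram.id 1)) =
      Diagram.id 1 ∧
    Diagram.loops (n := 3) (Diagram.tensor (Diagram.id 1) Diagram.cup) (Diagram.tensor Diagram.cap (Diagram.id 1)) = 0 := by
  have h1 : ∀ (α : Fin 1 → Bool) (β : Fin 3 → Bool),
      mat (A := Fin 1) (B := Fin 3) (Diagram.tensor (Diagram.id 1) Diagram.cup).rel α β =
        (if α 0 = β 0 then 1 else 0) * (if β 1 = β 2 then 1 else 0) := fun α β =>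
    (mat_tensor (Diagram.id 1) Diagram.cup α β).trans (by rw [mat_cup, mat_id_one]; first | done | rfl)
  have h2 : ∀ (β : Fin 3 → Bool) (γ : Fin 1 → Bool),
      mat (A := Fin 3) (B := Fin 1) (Diagram.tensor Diagram.cap (Diagram.id 1)).rel β γ =
        (if β 0 = β 1 then 1 else 0) * (if β 2 = γ 0 then 1 else 0) := fun β γ =>
    (mat_tensor Diagram.cap (Diagram.id 1) β γ).trans (by rw [mat_cap, mat_id_one]; first | done | rfl)
  have h := scaled_mat_inj
    (r := stack (B := Fin 3) (Diagram.tensor (Diagram.id 1) Diagram.cup).rel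
      (Diagram.tensor Diagram.cap (Diagram.id 1)).rel)
    (s := idRel (Fin 1))
    (a := TemperleyLieb.loops (B := Fin 3) (Diagram.tensor (Diagram.id 1) Diagram.cup).rel
      (Diagram.tensor Diagram.cap (Diagram.id 1)).rel) (b := 0) (fun α γ => by
      refine (mat_stack (B := Fin 3) _ _ _ _).symm.trans
        (((Finset.sum_congr rfl fun β _ => congrArg₂ _ (h1 α β) (h2 β γ))).trans ?_)
      refine Eq.trans ?_ (congrArg _ (mat_id_one α γ).symm)
      revert α γ
      decide)
  exact ⟨Diagram.ext h.2, h.1⟩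

/-- The second zigzag relation. -/
theorem Diagram.zigzag' :
    Diagram.comp (n := 3) (Diagram.tensor Diagram.cup (Diagram.id 1)) (Diagram.tensor (Diagram.id 1) Diagram.cap) =
      Diagram.id 1 ∧
    Diagram.loops (n := 3) (Diagram.tensor Diagram.cup (Diagram.id 1)) (Diagram.tensor (Diagram.id 1) Diagram.cap) = 0 := by
  have h1 : ∀ (α : Fin 1 → Bool) (β : Fin 3 → Bool),
      mat (A := Fin 1) (B := Fin 3) (Diagram.tensor Diagram.cup (Diagram.id 1)).rel α β =
        (if β 0 = β 1 then 1 else 0) * (if α 0 = β 2 then 1 else 0) := fun α β =>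
    (mat_tensor Diagram.cup (Diagram.id 1) α β).trans (by rw [mat_cup, mat_id_one]; first | done | rfl)
  have h2 : ∀ (β : Fin 3 → Bool) (γ : Fin 1 → Bool),
      mat (A := Fin 3) (B := Fin 1) (Diagram.tensor (Diagram.id 1) Diagram.cap).rel β γ =
        (if β 0 = γ 0 then 1 else 0) * (if β 1 = β 2 then 1 else 0) := fun β γ =>
    (mat_tensor (Diagram.id 1) Diagram.cap β γ).trans (by rw [mat_cap, mat_id_one]; first | done | rfl)
  have h := scaled_mat_inj
    (r := stack (B := Fin 3) (Diagram.tensor Diagram.cup (Diagram.id 1)).rel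
      (Diagram.tensor (Diagram.id 1) Diagram.cap).rel)
    (s := idRel (Fin 1))
    (a := TemperleyLieb.loops (B := Fin 3) (Diagram.tensor Diagram.cup (Diagram.id 1)).rel
      (Diagram.tensor (Diagram.id 1) Diagram.cap).rel) (b := 0) (fun α γ => by
      refine (mat_stack (B := Fin 3) _ _ _ _).symm.trans
        (((Finset.sum_congr rfl fun β _ => congrArg₂ _ (h1 α β) (h2 β γ))).trans ?_)
      refine Eq.trans ?_ (congrArg _ (mat_id_one α γ).symm)
      revert α γ
      decide)
  exact ⟨Diagram.ext h.2, h.1⟩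

/-- The root of unity `q = exp (π i / (k + 2))`. -/
noncomputable def q (k : ℕ) : ℂ := Complex.exp (Real.pi * Complex.I / (k + 2))

/-- The quantum integer `[n]`. -/
noncomputable def qint (k n : ℕ) : ℂ := (q k ^ n - (q k ^ n)⁻¹) / (q k - (q k)⁻¹)

/-- The value `δ = -[2]` of a closed loop. -/
noncomputable def loopValue (k : ℕ) : ℂ := -qint k 2

theorem q_pow_ne (k n : ℕ) (h1 : 1 ≤ n) (h2 : n ≤ k + 1) : q k ^ n - (q k ^ n)⁻¹ ≠ 0 := by
  intro h
  have hq : q k ^ n ≠ 0 := pow_ne_zero _ (Complex.exp_ne_zero _)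
  have h3 : q k ^ n * q k ^ n = 1 := by
    have := sub_eq_zero.1 h
    nth_rewrite 2 [this]
    exact mul_inv_cancel₀ hq
  rw [← pow_add, q, ← Complex.exp_nat_mul, Complex.exp_eq_one_iff] at h3
  obtain ⟨z, hz⟩ := h3
  have hk : (k : ℂ) + 2 ≠ 0 := by exact_mod_cast (by omega : k + 2 ≠ 0)
  have hpi : (Real.pi : ℂ) * Complex.I ≠ 0 :=
    mul_ne_zero (by exact_mod_cast Real.pi_ne_zero) Complex.I_ne_zero
  have h4 : ((n : ℂ)) = z * (k + 2) := by
    field_simp at hz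
    push_cast at hz
    linear_combination hz / 2
  have h6 : (n : ℤ) = z * (k + 2) := by exact_mod_cast h4
  rcases lt_trichotomy z 0 with hz0 | hz0 | hz0
  · nlinarith
  · subst hz0; omega
  · nlinarith

theorem q_ne_zero (k : ℕ) : q k ≠ 0 := Complex.exp_ne_zero _

theorem q_sub_inv_ne (k : ℕ) : q k - (q k)⁻¹ ≠ 0 := by
  simpa using q_pow_ne k 1 le_rfl (by omega)

theorem qint_ne_zero (k n : ℕ) (h1 : 1 ≤ n) (h2 : n ≤ k + 1) : qint k n ≠ 0 :=
  div_ne_zero (q_pow_ne k n h1 h2) (q_sub_inv_ne k)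

theorem qint_zero (k : ℕ) : qint k 0 = 0 := by simp [qint]

theorem qint_one (k : ℕ) : qint k 1 = 1 := by simp [qint, div_self (q_sub_inv_ne k)]

theorem qint_rec (k n : ℕ) : qint k 2 * qint k (n + 1) = qint k (n + 2) + qint k n := by
  have h1 := q_ne_zero k
  have h2 := q_sub_inv_ne k
  simp only [qint, div_mul_div_comm, ← add_div]
  rw [div_eq_div_iff (mul_ne_zero h2 h2) h2]
  field_simp
  ring

/-- The linear diagram category: objects are natural numbers, morphisms are linear combinations of
diagrams, and every closed loop is equal to the constant `δ`. Since each loop may be removed at the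
cost of a factor `δ`, the loop-free diagrams `m → n` form a basis of the morphisms `m ⟶ n`. -/
structure LinDiag (k : ℕ) where
  /-- the number of dots -/
  dots : ℕ

namespace LinDiag

variable {k : ℕ}

/-- Bilinear extension of stacking, each closed loop giving a factor `δ`. -/
noncomputable def compL (k m n p : ℕ) :
    (Diagram m n →₀ ℂ) →ₗ[ℂ] (Diagram n p →₀ ℂ) →ₗ[ℂ] (Diagram m p →₀ ℂ) :=
  Finsupp.linearCombination ℂ fun f => Finsupp.linearCombination ℂ fun g =>
    loopValue k ^ f.loops g • Finsupp.single (f.comp g) 1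

/-- Bilinear extension of juxtaposition. -/
noncomputable def tensorL (m n m' n' : ℕ) :
    (Diagram m n →₀ ℂ) →ₗ[ℂ] (Diagram m' n' →₀ ℂ) →ₗ[ℂ] (Diagram (m + m') (n + n') →₀ ℂ) :=
  Finsupp.linearCombination ℂ fun f => Finsupp.linearCombination ℂ fun g =>
    Finsupp.single (f.tensor g) 1

theorem compL_single {m n p : ℕ} (f : Diagram m n) (g : Diagram n p) :
    compL k m n p (Finsupp.single f 1) (Finsupp.single g 1) =
      loopValue k ^ f.loops g • Finsupp.single (f.comp g) 1 := by
  simp [compL]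

theorem tensorL_single {m n m' n' : ℕ} (f : Diagram m n) (g : Diagram m' n') :
    tensorL m n m' n' (Finsupp.single f 1) (Finsupp.single g 1) =
      Finsupp.single (f.tensor g) 1 := by
  simp [tensorL]

/-- Linear maps out of the span of the diagrams are determined on diagrams. -/
theorem induction_diagram {m n : ℕ} {P : (Diagram m n →₀ ℂ) → Prop} (f : Diagram m n →₀ ℂ)
    (h0 : P 0) (hadd : ∀ f g, P f → P g → P (f + g)) (hsmul : ∀ (c : ℂ) f, P f → P (c • f))
    (h : ∀ d, P (Finsupp.single d 1)) : P f := by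
  induction f using Finsupp.induction_linear with
  | zero => exact h0
  | add f g hf hg => exact hadd f g hf hg
  | single d c =>
    have := hsmul c _ (h d)
    rwa [Finsupp.smul_single_one] at this

noncomputable instance : Category (LinDiag k) where
  Hom X Y := Diagram X.dots Y.dots →₀ ℂ
  id X := Finsupp.single (Diagram.id X.dots) 1
  comp f g := compL k _ _ _ f g
  id_comp f := by
    induction f using induction_diagram with
    | h0 => simp
    | hadd f g hf hg => rw [map_add, hf, hg]
    | hsmul c f hf => rw [map_smul, hf]
    | h d => rw [compL_single, d.id_comp.1, d.id_comp.2, pow_zero, one_smul]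
  comp_id f := by
    induction f using induction_diagram with
    | h0 => simp
    | hadd f g hf hg => rw [map_add, LinearMap.add_apply, hf, hg]
    | hsmul c f hf => rw [map_smul, LinearMap.smul_apply, hf]
    | h d => rw [compL_single, d.comp_id.1, d.comp_id.2, pow_zero, one_smul]
  assoc f g h := by
    induction f using induction_diagram with
    | h0 => simp
    | hadd f f' hf hf' => simp only [map_add, LinearMap.add_apply, hf, hf']
    | hsmul c f hf => simp only [map_smul, LinearMap.smul_apply, hf]
    | h d =>
    induction g using induction_diagram with
    | h0 => simp
    | hadd f f' hf hf' => simp only [map_add, LinearMap.add_apply, hf, hf']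
    | hsmul c f hf => simp only [map_smul, LinearMap.smul_apply, hf]
    | h d' =>
    induction h using induction_diagram with
    | h0 => simp
    | hadd f f' hf hf' => simp only [map_add, hf, hf']
    | hsmul c f hf => simp only [map_smul, hf]
    | h d'' =>
      simp only [compL_single, map_smul, LinearMap.smul_apply, smul_smul, ← pow_add]
      rw [(Diagram.assoc d d' d'').1, (Diagram.assoc d d' d'').2]

noncomputable instance : Preadditive (LinDiag k) where
  homGroup X Y := inferInstanceAs (AddCommGroup (Diagram X.dots Y.dots →₀ ℂ))
  add_comp X Y Z f f' g := LinearMap.map_add₂ (compL k X.dots Y.dots Z.dots) f f' g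
  comp_add X Y Z f g g' := LinearMap.map_add (compL k X.dots Y.dots Z.dots f) g g'

noncomputable instance : Linear ℂ (LinDiag k) where
  homModule X Y := inferInstanceAs (Module ℂ (Diagram X.dots Y.dots →₀ ℂ))
  smul_comp X Y Z c f g := LinearMap.map_smul₂ (compL k X.dots Y.dots Z.dots) c f g
  comp_smul X Y Z f c g := LinearMap.map_smul (compL k X.dots Y.dots Z.dots f) c g

/-- A single diagram, as a morphism of the linear diagram category. -/
noncomputable def ofDiagram {m n : ℕ} (d : Diagram m n) : (mk m : LinDiag k) ⟶ mk n :=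
  Finsupp.single d 1

theorem ofDiagram_comp {m n p : ℕ} (d : Diagram m n) (d' : Diagram n p) :
    (ofDiagram d : (mk m : LinDiag k) ⟶ _) ≫ ofDiagram d' =
      loopValue k ^ d.loops d' • ofDiagram (d.comp d') :=
  compL_single d d'

theorem ofDiagram_id (n : ℕ) : (ofDiagram (Diagram.id n) : (mk n : LinDiag k) ⟶ _) = 𝟙 _ := rfl

/-- The monoidal product on objects: addition. -/
def tensorObj (X Y : LinDiag k) : LinDiag k := mk (X.dots + Y.dots)

/-- The monoidal product on morphisms: bilinear extension of juxtaposition. -/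
noncomputable def tensorHom {X Y X' Y' : LinDiag k} (f : X ⟶ Y) (g : X' ⟶ Y') :
    tensorObj X X' ⟶ tensorObj Y Y' := tensorL _ _ _ _ f g

section

variable {X Y Z X' Y' Z' : LinDiag k}

theorem add_tensor (f f' : X ⟶ Y) (g : X' ⟶ Y') :
    tensorHom (f + f') g = tensorHom f g + tensorHom f' g :=
  LinearMap.map_add₂ (tensorL X.dots Y.dots X'.dots Y'.dots) f f' g

theorem tensor_add (f : X ⟶ Y) (g g' : X' ⟶ Y') :
    tensorHom f (g + g') = tensorHom f g + tensorHom f g' :=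
  map_add (tensorL X.dots Y.dots X'.dots Y'.dots f) g g'

theorem smul_tensor (c : ℂ) (f : X ⟶ Y) (g : X' ⟶ Y') :
    tensorHom (c • f) g = c • tensorHom f g :=
  LinearMap.map_smul₂ (tensorL X.dots Y.dots X'.dots Y'.dots) c f g

theorem tensor_smul (c : ℂ) (f : X ⟶ Y) (g : X' ⟶ Y') :
    tensorHom f (c • g) = c • tensorHom f g :=
  map_smul (tensorL X.dots Y.dots X'.dots Y'.dots f) c g

theorem zero_tensor (g : X' ⟶ Y') : tensorHom (0 : X ⟶ Y) g = 0 := by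
  have := smul_tensor 0 (0 : X ⟶ Y) g
  simpa using this

theorem tensor_zero (f : X ⟶ Y) : tensorHom f (0 : X' ⟶ Y') = 0 := by
  have := tensor_smul 0 f (0 : X' ⟶ Y')
  simpa using this

theorem tensor_ofDiagram {m n m' n' : ℕ} (d : Diagram m n) (d' : Diagram m' n') :
    tensorHom (k := k) (ofDiagram d) (ofDiagram d') = ofDiagram (d.tensor d') :=
  tensorL_single d d'

theorem tensor_id (X Y : LinDiag k) : tensorHom (𝟙 X) (𝟙 Y) = 𝟙 (tensorObj X Y) :=
  (tensorL_single _ _).trans (congrArg (fun d => Finsupp.single d 1) (Diagram.tensor_id _ _))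

theorem hom_induction {P : (X ⟶ Y) → Prop} (f : X ⟶ Y)
    (hadd : ∀ f g, P f → P g → P (f + g)) (hsmul : ∀ (c : ℂ) f, P f → P (c • f))
    (h : ∀ d : Diagram X.dots Y.dots, P (ofDiagram (k := k) d)) (h0 : P 0) : P f :=
  induction_diagram f h0 hadd hsmul h

theorem tensor_comp (f : X ⟶ Y) (g : Y ⟶ Z) (f' : X' ⟶ Y') (g' : Y' ⟶ Z') :
    tensorHom (f ≫ g) (f' ≫ g') = tensorHom f f' ≫ tensorHom g g' := by
  induction f using hom_induction with
  | h0 => simp only [zero_tensor, Limits.zero_comp]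
  | hadd f₁ f₂ h₁ h₂ => simp only [Preadditive.add_comp, add_tensor, h₁, h₂]
  | hsmul c f h => simp only [Linear.smul_comp, smul_tensor, h]
  | h d =>
  induction g using hom_induction with
  | h0 => simp only [zero_tensor, Limits.comp_zero]
  | hadd f₁ f₂ h₁ h₂ => simp only [Preadditive.comp_add, add_tensor, h₁, h₂]
  | hsmul c f h => simp only [Linear.comp_smul, smul_tensor, h]
  | h e =>
  induction f' using hom_induction with
  | h0 => simp only [tensor_zero, Limits.zero_comp]
  | hadd f₁ f₂ h₁ h₂ => simp only [Preadditive.add_comp, tensor_add, h₁, h₂]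
  | hsmul c f h => simp only [Linear.smul_comp, tensor_smul, h]
  | h d' =>
  induction g' using hom_induction with
  | h0 => simp only [tensor_zero, Limits.comp_zero]
  | hadd f₁ f₂ h₁ h₂ => simp only [Preadditive.comp_add, tensor_add, h₁, h₂]
  | hsmul c f h => simp only [Linear.comp_smul, tensor_smul, h]
  | h e' =>
    refine (congrArg₂ tensorHom (ofDiagram_comp d e) (ofDiagram_comp d' e')).trans ?_
    refine Eq.trans ?_ (congrArg₂ _ (tensor_ofDiagram d d') (tensor_ofDiagram e e')).symm
    refine Eq.trans ?_ (ofDiagram_comp _ _).symm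
    rw [(Diagram.tensor_comp d d' e e').1, (Diagram.tensor_comp d d' e e').2, smul_tensor,
      tensor_smul, smul_smul, pow_add]
    exact congrArg _ (tensor_ofDiagram _ _)

end

end LinDiag

namespace LinDiag

variable {k : ℕ}

/-- `n` parallel strands. -/
abbrev strands (k n : ℕ) : LinDiag k := mk n

/-- The cup `0 ⟶ 2`. -/
noncomputable def cup (k : ℕ) : strands k 0 ⟶ strands k 2 := ofDiagram Diagram.cup

/-- The cap `2 ⟶ 0`. -/
noncomputable def cap (k : ℕ) : strands k 2 ⟶ strands k 0 := ofDiagram Diagram.cap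

/-- The cap-cup morphism `n + 2 ⟶ n + 2` on the last two of `n + 2` strands. -/
noncomputable def capCup (k n : ℕ) : strands k (n + 2) ⟶ strands k (n + 2) :=
  tensorHom (𝟙 (strands k n)) (cap k ≫ cup k)

/-- Adding one vertical strand on the right. -/
noncomputable def addStrand {m n : ℕ} (f : strands k m ⟶ strands k n) :
    strands k (m + 1) ⟶ strands k (n + 1) :=
  tensorHom f (𝟙 (strands k 1))

/-- The Jones-Wenzl projections. -/
noncomputable def jonesWenzl (k : ℕ) : (n : ℕ) → (strands k n ⟶ strands k n)
  | 0 => 𝟙 _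
  | 1 => 𝟙 _
  | n + 2 => addStrand (jonesWenzl k (n + 1)) + (qint k (n + 1) / qint k (n + 2)) •
      (addStrand (jonesWenzl k (n + 1)) ≫ capCup k n ≫ addStrand (jonesWenzl k (n + 1)))

theorem addStrand_comp {m n p : ℕ} (f : strands k m ⟶ strands k n) (g : strands k n ⟶ strands k p) :
    addStrand (f ≫ g) = addStrand f ≫ addStrand g := by
  have := tensor_comp f g (𝟙 (strands k 1)) (𝟙 _)
  rwa [Category.comp_id] at this

theorem addStrand_id (n : ℕ) : addStrand (𝟙 (strands k n)) = 𝟙 _ := tensor_id _ _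

theorem addStrand_add {m n : ℕ} (f g : strands k m ⟶ strands k n) :
    addStrand (f + g) = addStrand f + addStrand g := add_tensor _ _ _

theorem addStrand_smul {m n : ℕ} (c : ℂ) (f : strands k m ⟶ strands k n) :
    addStrand (c • f) = c • addStrand f := smul_tensor _ _ _

theorem cup_cap (k : ℕ) : cup k ≫ cap k = loopValue k • 𝟙 _ := by
  refine (ofDiagram_comp Diagram.cup Diagram.cap).trans ?_
  rw [Diagram.cup_cap.1, Diagram.cup_cap.2, pow_one, ofDiagram_id]

theorem capCup_sq (k n : ℕ) : capCup k n ≫ capCup k n = loopValue k • capCup k n := by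
  have h : (cap k ≫ cup k) ≫ cap k ≫ cup k = loopValue k • (cap k ≫ cup k) := by
    rw [Category.assoc, ← Category.assoc (cup k), cup_cap, Linear.smul_comp, Category.id_comp,
      Linear.comp_smul]
  have := tensor_comp (𝟙 (strands k n)) (𝟙 _) (cap k ≫ cup k) (cap k ≫ cup k)
  rw [Category.comp_id, h, tensor_smul] at this
  exact this.symm

theorem tensor_one_one (m n : ℕ) (d : Diagram m n) :
    (d.tensor (Diagram.id 1)).tensor (Diagram.id 1) = d.tensor (Diagram.id 2) := by
  have h := fun x y => tensor_assoc_rel d (Diagram.id 1) (Diagram.id 1) x y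
  rw [Diagram.tensor_id] at h
  apply Diagram.ext
  ext x y
  refine (h x y).trans ?_
  rw [show (Fin.cast (Nat.add_assoc m 1 1)) = _root_.id from rfl,
    show (Fin.cast (Nat.add_assoc n 1 1)) = _root_.id from rfl, Sum.map_id_id]
  rfl

theorem addStrand_addStrand {m n : ℕ} (f : strands k m ⟶ strands k n) :
    addStrand (addStrand f) = tensorHom f (𝟙 (strands k 2)) := by
  induction f using hom_induction with
  | h0 => simp only [addStrand, zero_tensor]; rfl
  | hadd f g hf hg => rw [addStrand_add, addStrand_add, hf, hg, add_tensor]; rfl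
  | hsmul c f hf => rw [addStrand_smul, addStrand_smul, hf, smul_tensor]; rfl
  | h d =>
    have h1 : addStrand (k := k) (ofDiagram d) = ofDiagram (d.tensor (Diagram.id 1)) :=
      tensor_ofDiagram _ _
    have h2 : tensorHom (k := k) (ofDiagram d) (𝟙 (strands k 2)) =
      ofDiagram (d.tensor (Diagram.id 2)) := tensor_ofDiagram _ _
    refine (congrArg addStrand h1).trans (Eq.trans ?_ h2.symm)
    rw [← tensor_one_one]
    exact tensor_ofDiagram _ _

/-- Morphisms of the first `n` strands commute with the cap-cup on the last two strands. -/
theorem addStrand_capCup {n : ℕ} (f : strands k n ⟶ strands k n) :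
    addStrand (addStrand f) ≫ capCup k n = capCup k n ≫ addStrand (addStrand f) := by
  rw [addStrand_addStrand]
  refine (tensor_comp _ _ _ _).symm.trans (Eq.trans ?_ (tensor_comp _ _ _ _))
  simp

theorem zigzag (k : ℕ) : (tensorHom (𝟙 (strands k 1)) (cup k) : strands k 1 ⟶ strands k 3) ≫
    (tensorHom (cap k) (𝟙 (strands k 1)) : strands k 3 ⟶ strands k 1) = 𝟙 _ := by
  refine (congrArg₂ (fun (f : strands k 1 ⟶ strands k 3) (g : strands k 3 ⟶ strands k 1) => f ≫ g)
    (tensor_ofDiagram (Diagram.id 1) Diagram.cup)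
    (tensor_ofDiagram Diagram.cap (Diagram.id 1))).trans ?_
  refine (ofDiagram_comp (n := 3) _ _).trans ?_
  rw [Diagram.zigzag.1, Diagram.zigzag.2, pow_zero, one_smul]
  rfl

theorem zigzag' (k : ℕ) : (tensorHom (cup k) (𝟙 (strands k 1)) : strands k 1 ⟶ strands k 3) ≫
    (tensorHom (𝟙 (strands k 1)) (cap k) : strands k 3 ⟶ strands k 1) = 𝟙 _ := by
  refine (congrArg₂ (fun (f : strands k 1 ⟶ strands k 3) (g : strands k 3 ⟶ strands k 1) => f ≫ g)
    (tensor_ofDiagram Diagram.cup (Diagram.id 1))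
    (tensor_ofDiagram (Diagram.id 1) Diagram.cap)).trans ?_
  refine (ofDiagram_comp (n := 3) _ _).trans ?_
  rw [Diagram.zigzag'.1, Diagram.zigzag'.2, pow_zero, one_smul]
  rfl

theorem id_zero_tensor (d : Diagram 2 2) : (Diagram.id 0).tensor d = d := by
  apply Diagram.ext
  refine mat_inj (A := Fin 2) (B := Fin 2) ?_
  funext α β
  refine (mat_tensor (Diagram.id 0) d α β).trans ?_
  have h : ∀ i : Fin 2, (Fin.natAdd 0 i : Fin (0 + 2)) = i := fun i => Fin.ext (Nat.zero_add _)
  simp only [Diagram.id, mat_idRel, h]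
  rw [if_pos (Subsingleton.elim _ _), one_mul]

theorem capCup_zero (k : ℕ) : capCup k 0 = cap k ≫ cup k := by
  have : ∀ f : strands k 2 ⟶ strands k 2, tensorHom (𝟙 (strands k 0)) f = f := by
    intro f
    induction f using hom_induction with
    | h0 => exact tensor_zero _
    | hadd f g hf hg => exact (tensor_add _ _ _).trans (congrArg₂ _ hf hg)
    | hsmul c f hf => exact (tensor_smul _ _ _).trans (congrArg _ hf)
    | h d => exact (tensor_ofDiagram (Diagram.id 0) d).trans (congrArg ofDiagram (id_zero_tensor d))
  exact this _

theorem comp_cancel {C : Type*} [Category* C] {X Y : C} (a : X ⟶ Y) (b : Y ⟶ X) (c : X ⟶ Y)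
    (d : Y ⟶ X) (hbc : b ≫ c = 𝟙 _) (hda : d ≫ a = 𝟙 _) :
    (a ≫ b) ≫ (c ≫ d) ≫ a ≫ b = a ≫ b := by
  rw [Category.assoc, Category.assoc, ← Category.assoc b c, hbc, Category.id_comp,
    ← Category.assoc d a, hda, Category.id_comp]

theorem comp_slide {C : Type*} [Category* C] {X : C} (u v h : X ⟶ X) (hu : h ≫ u = u ≫ h)
    (hh : h ≫ h = h) (uvu : u ≫ v ≫ u = u) : u ≫ (h ≫ v ≫ h) ≫ u = h ≫ u := by
  calc u ≫ (h ≫ v ≫ h) ≫ u = (u ≫ h) ≫ v ≫ (h ≫ u) := by simp only [Category.assoc]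
    _ = (h ≫ u) ≫ v ≫ (u ≫ h) := by rw [hu]
    _ = h ≫ (u ≫ v ≫ u) ≫ h := by simp only [Category.assoc]
    _ = h ≫ u := by rw [uvu, ← hu, ← Category.assoc, hh]

/-- The relation `U₂ U₁ U₂ = U₂` on three strands. -/
theorem capCup_one (k : ℕ) :
    capCup k 1 ≫ addStrand (capCup k 0) ≫ capCup k 1 = capCup k 1 := by
  have h1 : capCup k 1 = (tensorHom (𝟙 (strands k 1)) (cap k) : strands k 3 ⟶ strands k 1) ≫
      (tensorHom (𝟙 (strands k 1)) (cup k) : strands k 1 ⟶ strands k 3) := by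
    refine Eq.trans ?_ (tensor_comp _ _ _ _)
    rw [Category.comp_id]
    rfl
  have h2 : addStrand (capCup k 0) =
      (tensorHom (cap k) (𝟙 (strands k 1)) : strands k 3 ⟶ strands k 1) ≫
      (tensorHom (cup k) (𝟙 (strands k 1)) : strands k 1 ⟶ strands k 3) := by
    rw [capCup_zero]
    exact addStrand_comp _ _
  rw [h1, h2]
  exact comp_cancel (X := strands k 3) (Y := strands k 1) _ _ _ _ (zigzag k) (zigzag' k)

theorem tensor_assoc_one_two {m n : ℕ} (d : Diagram m n) (e : Diagram 1 1) (e' : Diagram 2 2) :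
    (d.tensor e).tensor e' = d.tensor (e.tensor e') := by
  apply Diagram.ext
  ext x y
  refine (tensor_assoc_rel d e e' x y).trans ?_
  rw [show (Fin.cast (Nat.add_assoc m 1 2)) = _root_.id from rfl,
    show (Fin.cast (Nat.add_assoc n 1 2)) = _root_.id from rfl, Sum.map_id_id]
  rfl

theorem tensor_assoc_two_one {m n : ℕ} (d : Diagram m n) (e : Diagram 2 2) (e' : Diagram 1 1) :
    (d.tensor e).tensor e' = d.tensor (e.tensor e') := by
  apply Diagram.ext
  ext x y
  refine (tensor_assoc_rel d e e' x y).trans ?_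
  rw [show (Fin.cast (Nat.add_assoc m 2 1)) = _root_.id from rfl,
    show (Fin.cast (Nat.add_assoc n 2 1)) = _root_.id from rfl, Sum.map_id_id]
  rfl

theorem capCup_three (k n : ℕ) :
    capCup k (n + 1) ≫ addStrand (capCup k n) ≫ capCup k (n + 1) = capCup k (n + 1) := by
  have h1 : ∀ f : strands k 2 ⟶ strands k 2,
      @Eq (strands k (n + 3) ⟶ strands k (n + 3))
        (tensorHom (X := strands k (n + 1)) (Y := strands k (n + 1)) (𝟙 _) f)
        (tensorHom (𝟙 (strands k n))
          (tensorHom (𝟙 (strands k 1)) f : strands k 3 ⟶ strands k 3)) := by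
    intro f
    induction f using hom_induction with
    | h0 =>
      exact (tensor_zero _).trans
        ((congrArg (tensorHom (𝟙 (strands k n))) (tensor_zero (X' := strands k 2) (Y' := strands k 2)
          (𝟙 (strands k 1)))).trans (tensor_zero _)).symm
    | hadd f g hf hg =>
      exact (tensor_add _ _ _).trans ((congrArg₂ _ hf hg).trans
        ((congrArg (tensorHom (𝟙 (strands k n))) (tensor_add _ _ _)).trans
          (tensor_add _ _ _)).symm)
    | hsmul c f hf =>
      exact (tensor_smul _ _ _).trans ((congrArg _ hf).trans
        ((congrArg (tensorHom (𝟙 (strands k n))) (tensor_smul _ _ _)).trans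
          (tensor_smul _ _ _)).symm)
    | h d =>
      refine (tensor_ofDiagram (Diagram.id (n + 1)) d).trans (Eq.trans ?_
        ((congrArg (tensorHom (𝟙 (strands k n))) (tensor_ofDiagram (Diagram.id 1) d)).trans
          (tensor_ofDiagram (Diagram.id n) _)).symm)
      exact congrArg (ofDiagram (k := k) (m := n + 3) (n := n + 3))
        ((congrArg (fun e => Diagram.tensor e d) (Diagram.tensor_id n 1).symm).trans
          (tensor_assoc_one_two (Diagram.id n) (Diagram.id 1) d))
  have h2 : ∀ f : strands k 2 ⟶ strands k 2,
      (addStrand (tensorHom (𝟙 (strands k n)) f : strands k (n + 2) ⟶ strands k (n + 2))) =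
        tensorHom (𝟙 (strands k n)) (addStrand f) := by
    intro f
    induction f using hom_induction with
    | h0 =>
      exact (congrArg addStrand (tensor_zero _)).trans ((zero_tensor _).trans
        ((congrArg (tensorHom (𝟙 (strands k n))) (zero_tensor (X := strands k 2) (Y := strands k 2)
          (𝟙 (strands k 1)))).trans (tensor_zero _)).symm)
    | hadd f g hf hg =>
      exact (congrArg addStrand (tensor_add _ _ _)).trans
        ((addStrand_add _ _).trans ((congrArg₂ _ hf hg).trans
        ((congrArg (tensorHom (𝟙 (strands k n))) (addStrand_add _ _)).trans
          (tensor_add _ _ _)).symm))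
    | hsmul c f hf =>
      exact (congrArg addStrand (tensor_smul _ _ _)).trans
        ((addStrand_smul _ _).trans ((congrArg _ hf).trans
        ((congrArg (tensorHom (𝟙 (strands k n))) (addStrand_smul _ _)).trans
          (tensor_smul _ _ _)).symm))
    | h d =>
      refine (congrArg addStrand (tensor_ofDiagram (Diagram.id n) d)).trans
        ((tensor_ofDiagram _ (Diagram.id 1)).trans (Eq.trans ?_
        ((congrArg (tensorHom (𝟙 (strands k n))) (tensor_ofDiagram d (Diagram.id 1))).trans
          (tensor_ofDiagram (Diagram.id n) _)).symm))
      exact congrArg (ofDiagram (k := k) (m := n + 3) (n := n + 3))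
        (tensor_assoc_two_one (Diagram.id n) d (Diagram.id 1))
  have e1 : capCup k (n + 1) = tensorHom (𝟙 (strands k n)) (capCup k 1) := h1 _
  have e2 : addStrand (capCup k n) = tensorHom (𝟙 (strands k n)) (addStrand (capCup k 0)) := by
    rw [capCup_zero]
    exact h2 _
  rw [e1, e2]
  refine (congrArg (fun z => tensorHom (𝟙 (strands k n)) (capCup k 1) ≫ z)
    (tensor_comp _ _ _ _).symm).trans ((tensor_comp _ _ _ _).symm.trans ?_)
  exact congrArg₂ tensorHom ((Category.id_comp _).trans (Category.id_comp _)) (capCup_one k)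

theorem jonesWenzl_coeff (k n : ℕ) (h : n + 2 ≤ k + 1) :
    qint k (n + 1) / qint k (n + 2) * (loopValue k + qint k n / qint k (n + 1)) = -1 := by
  have h1 := qint_ne_zero k (n + 1) (by omega) (by omega)
  have h2 := qint_ne_zero k (n + 2) (by omega) (by omega)
  have h3 := qint_rec k n
  rw [loopValue]
  field_simp
  linear_combination -h3

theorem capCup_jonesWenzl_capCup (k n : ℕ)
    (hn : jonesWenzl k n ≫ jonesWenzl k n = jonesWenzl k n) :
    capCup k n ≫ addStrand (jonesWenzl k (n + 1)) ≫ capCup k n =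
      (loopValue k + qint k n / qint k (n + 1)) •
        (addStrand (addStrand (jonesWenzl k n)) ≫ capCup k n) := by
  cases n with
  | zero =>
    simp only [jonesWenzl, addStrand_id, Category.id_comp, capCup_sq, qint_zero, zero_div, add_zero]
  | succ n =>
    have hc := addStrand_capCup (jonesWenzl k (n + 1))
    rw [jonesWenzl, addStrand_add, addStrand_smul, Preadditive.add_comp, Preadditive.comp_add,
      Linear.smul_comp, Linear.comp_smul, addStrand_comp, addStrand_comp]
    set H := addStrand (addStrand (jonesWenzl k (n + 1))) with hH
    have hH2 : H ≫ H = H := by rw [hH, ← addStrand_comp, ← addStrand_comp, hn]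
    have e1 : capCup k (n + 1) ≫ H ≫ capCup k (n + 1) =
        loopValue k • (H ≫ capCup k (n + 1)) := by
      rw [← Category.assoc, ← hc, Category.assoc, capCup_sq, Linear.comp_smul]
    have e2 : capCup k (n + 1) ≫ (H ≫ addStrand (capCup k n) ≫ H) ≫ capCup k (n + 1) =
        H ≫ capCup k (n + 1) := comp_slide _ _ _ hc hH2 (capCup_three k n)
    rw [e1, e2, ← add_smul]

theorem jonesWenzl_absorb (k n : ℕ) (hn : jonesWenzl k n ≫ jonesWenzl k n = jonesWenzl k n) :
    jonesWenzl k (n + 1) ≫ addStrand (jonesWenzl k n) = jonesWenzl k (n + 1) := by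
  cases n with
  | zero => exact (congrArg _ (addStrand_id 0)).trans (Category.comp_id _)
  | succ n =>
    have h : addStrand (jonesWenzl k (n + 1)) ≫ addStrand (jonesWenzl k (n + 1)) =
        addStrand (jonesWenzl k (n + 1)) := by rw [← addStrand_comp, hn]
    rw [jonesWenzl, Preadditive.add_comp, Linear.smul_comp, Category.assoc, Category.assoc, h]

/-- The Jones-Wenzl projections are idempotent. -/
theorem jonesWenzl_idem (k n : ℕ) (hn : n ≤ k + 1) :
    jonesWenzl k n ≫ jonesWenzl k n = jonesWenzl k n := by
  induction n using Nat.strong_induction_on with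
  | _ n ih =>
  match n with
  | 0 => exact Category.id_comp _
  | 1 => exact Category.id_comp _
  | n + 2 =>
    have i1 := ih (n + 1) (by omega) (by omega)
    have i0 := ih n (by omega) (by omega)
    have key := capCup_jonesWenzl_capCup k n i0
    have hc := jonesWenzl_coeff k n hn
    rw [jonesWenzl]
    set g := addStrand (jonesWenzl k (n + 1)) with hg
    set a := qint k (n + 1) / qint k (n + 2)
    set U := capCup k n
    have gg : g ≫ g = g := by rw [hg, ← addStrand_comp, i1]
    have gH : g ≫ addStrand (addStrand (jonesWenzl k n)) = g := by
      rw [hg, ← addStrand_comp, jonesWenzl_absorb k n i0]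
    have e : (g ≫ U ≫ g) ≫ g ≫ U ≫ g =
        (loopValue k + qint k n / qint k (n + 1)) • (g ≫ U ≫ g) := by
      calc (g ≫ U ≫ g) ≫ g ≫ U ≫ g = g ≫ (U ≫ (g ≫ g) ≫ U) ≫ g := by simp only [Category.assoc]
        _ = _ := by
          rw [gg, key, Linear.smul_comp, Linear.comp_smul, Category.assoc, ← Category.assoc g, gH]
    have e1 : g ≫ g ≫ U ≫ g = g ≫ U ≫ g := by rw [← Category.assoc, gg]
    have e2 : (g ≫ U ≫ g) ≫ g = g ≫ U ≫ g := by simp only [Category.assoc, gg]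
    simp only [Preadditive.add_comp, Preadditive.comp_add, Linear.smul_comp, Linear.comp_smul]
    rw [gg, e1, e2, e, smul_smul, hc, neg_one_smul, add_neg_cancel, smul_zero, add_zero]

end LinDiag

namespace LinDiag

variable {k : ℕ}

/-- `n` nested cups `0 ⟶ n + n`, obtained from `n - 1` nested cups by inserting a cup in the
middle. -/
noncomputable def nestedCup (k : ℕ) : (n : ℕ) → (strands k 0 ⟶ strands k (n + n))
  | 0 => 𝟙 _
  | n + 1 => nestedCup k n ≫
      (tensorHom (tensorHom (𝟙 (strands k n)) (cup k)) (𝟙 (strands k n)) :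
        strands k (n + n) ⟶ strands k (n + 2 + n)) ≫
      eqToHom (congrArg mk (by change n + 2 + n = n + 1 + (n + 1); omega))

/-- `n` nested caps `n + n ⟶ 0`, the innermost one being in the middle. -/
noncomputable def nestedCap (k : ℕ) : (n : ℕ) → (strands k (n + n) ⟶ strands k 0)
  | 0 => 𝟙 _
  | n + 1 => eqToHom (congrArg mk (by change n + 1 + (n + 1) = n + 2 + n; omega)) ≫
      (tensorHom (tensorHom (𝟙 (strands k n)) (cap k)) (𝟙 (strands k n)) :
        strands k (n + 2 + n) ⟶ strands k (n + n)) ≫ nestedCap k n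

theorem sum_tensor {X Y X' Y' : LinDiag k} {ι : Type} (s : Finset ι) (f : ι → (X ⟶ Y))
    (g : X' ⟶ Y') : tensorHom (∑ i ∈ s, f i) g = ∑ i ∈ s, tensorHom (f i) g :=
  map_sum (AddMonoidHom.mk' (fun f : X ⟶ Y => tensorHom f g) fun _ _ => add_tensor _ _ _) f s

theorem tensor_sum {X Y X' Y' : LinDiag k} {ι : Type} (s : Finset ι) (f : X ⟶ Y)
    (g : ι → (X' ⟶ Y')) : tensorHom f (∑ i ∈ s, g i) = ∑ i ∈ s, tensorHom f (g i) :=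
  map_sum (AddMonoidHom.mk' (fun g : X' ⟶ Y' => tensorHom f g) fun _ _ => tensor_add _ _ _) g s

end LinDiag

/-- The additive completion of the linear diagram category. -/
abbrev AddTL (k : ℕ) : Type 1 := Mat_ (LinDiag k)

namespace AddTL

variable {k : ℕ}

/-- The monoidal product of formal direct sums. -/
def tensorObj (M N : AddTL k) : AddTL k :=
  ⟨M.ι × N.ι, fun i => LinDiag.tensorObj (M.X i.1) (N.X i.2)⟩

/-- The monoidal product of matrices (Kronecker product). -/
noncomputable def tensorHom {M N M' N' : AddTL k} (f : M ⟶ N) (g : M' ⟶ N') :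
    tensorObj M M' ⟶ tensorObj N N' :=
  fun i j => LinDiag.tensorHom (f i.1 j.1) (g i.2 j.2)

theorem tensor_id (M N : AddTL k) : tensorHom (𝟙 M) (𝟙 N) = 𝟙 (tensorObj M N) := by
  apply Mat_.hom_ext
  rintro ⟨i, i'⟩ ⟨j, j'⟩
  change LinDiag.tensorHom ((𝟙 M : M ⟶ M) i j) ((𝟙 N : N ⟶ N) i' j') = _
  by_cases h : i = j
  · subst h
    by_cases h' : i' = j'
    · subst h'
      rw [Mat_.id_apply_self, Mat_.id_apply_self]
      exact (LinDiag.tensor_id _ _).trans (Mat_.id_apply_self (tensorObj M N) (i, i')).symm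
    · rw [Mat_.id_apply_of_ne N _ _ h', LinDiag.tensor_zero]
      exact (Mat_.id_apply_of_ne (tensorObj M N) (i, i') (i, j')
        fun e => h' (congrArg Prod.snd e)).symm
  · rw [Mat_.id_apply_of_ne M _ _ h, LinDiag.zero_tensor]
    exact (Mat_.id_apply_of_ne (tensorObj M N) (i, i') (j, j')
      fun e => h (congrArg Prod.fst e)).symm

theorem tensor_comp {M N K M' N' K' : AddTL k} (f : M ⟶ N) (g : N ⟶ K) (f' : M' ⟶ N')
    (g' : N' ⟶ K') : tensorHom (f ≫ g) (f' ≫ g') = tensorHom f f' ≫ tensorHom g g' := by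
  apply Mat_.hom_ext
  rintro ⟨i, i'⟩ ⟨j, j'⟩
  change LinDiag.tensorHom (∑ a : N.ι, f i a ≫ g a j) (∑ b : N'.ι, f' i' b ≫ g' b j') =
    ∑ ab : N.ι × N'.ι, LinDiag.tensorHom (f i ab.1) (f' i' ab.2) ≫
      LinDiag.tensorHom (g ab.1 j) (g' ab.2 j')
  rw [LinDiag.sum_tensor, Fintype.sum_prod_type]
  refine Finset.sum_congr rfl fun a _ => ?_
  rw [LinDiag.tensor_sum]
  exact Finset.sum_congr rfl fun b _ => LinDiag.tensor_comp _ _ _ _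

theorem add_tensor {M N M' N' : AddTL k} (f f' : M ⟶ N) (g : M' ⟶ N') :
    tensorHom (f + f') g = tensorHom f g + tensorHom f' g :=
  Mat_.hom_ext _ _ fun _ _ => LinDiag.add_tensor _ _ _

theorem tensor_add {M N M' N' : AddTL k} (f : M ⟶ N) (g g' : M' ⟶ N') :
    tensorHom f (g + g') = tensorHom f g + tensorHom f g' :=
  Mat_.hom_ext _ _ fun _ _ => LinDiag.tensor_add _ _ _

/-- The object `n` of the diagram category, as an object of the additive completion. -/
noncomputable abbrev strands (k n : ℕ) : AddTL k :=
  (Mat_.embedding (LinDiag k)).obj (LinDiag.strands k n)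

/-- Nested cups, as a one by one matrix. -/
noncomputable def nestedCup (k n : ℕ) :
    strands k 0 ⟶ tensorObj (strands k n) (strands k n) :=
  fun _ _ => LinDiag.nestedCup k n

/-- Nested caps, as a one by one matrix. -/
noncomputable def nestedCap (k n : ℕ) :
    tensorObj (strands k n) (strands k n) ⟶ strands k 0 :=
  fun _ _ => LinDiag.nestedCap k n

end AddTL

/-- The Temperley-Lieb category `TL`: the idempotent completion of the additive completion of the
linear diagram category. -/
abbrev TL (k : ℕ) : Type 1 := Idempotents.Karoubi (AddTL k)

namespace TL

variable {k : ℕ}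

/-- The monoidal product of objects of `TL`. -/
noncomputable def tensorObj (P Q : TL k) : TL k where
  X := AddTL.tensorObj P.X Q.X
  p := AddTL.tensorHom P.p Q.p
  idem := by rw [← AddTL.tensor_comp, P.idem, Q.idem]

/-- The monoidal product of morphisms of `TL`. -/
noncomputable def tensorHom {P Q P' Q' : TL k} (f : P ⟶ Q) (g : P' ⟶ Q') :
    tensorObj P P' ⟶ tensorObj Q Q' where
  f := AddTL.tensorHom f.f g.f
  comm := by
    change AddTL.tensorHom P.p P'.p ≫ AddTL.tensorHom f.f g.f ≫ AddTL.tensorHom Q.p Q'.p = _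
    rw [← AddTL.tensor_comp, ← AddTL.tensor_comp, f.comm, g.comm]

theorem tensor_id (P Q : TL k) : tensorHom (𝟙 P) (𝟙 Q) = 𝟙 (tensorObj P Q) := rfl

theorem tensor_comp {P Q R P' Q' R' : TL k} (f : P ⟶ Q) (g : Q ⟶ R) (f' : P' ⟶ Q')
    (g' : Q' ⟶ R') : tensorHom (f ≫ g) (f' ≫ g') = tensorHom f f' ≫ tensorHom g g' :=
  Idempotents.Karoubi.hom_ext _ _ (AddTL.tensor_comp _ _ _ _)

theorem add_tensor {P Q P' Q' : TL k} (f f' : P ⟶ Q) (g : P' ⟶ Q') :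
    tensorHom (f + f') g = tensorHom f g + tensorHom f' g :=
  Idempotents.Karoubi.hom_ext _ _ (AddTL.add_tensor _ _ _)

theorem tensor_add {P Q P' Q' : TL k} (f : P ⟶ Q) (g g' : P' ⟶ Q') :
    tensorHom f (g + g') = tensorHom f g + tensorHom f g' :=
  Idempotents.Karoubi.hom_ext _ _ (AddTL.tensor_add _ _ _)

theorem sub_tensor {P Q P' Q' : TL k} (f f' : P ⟶ Q) (g : P' ⟶ Q') :
    tensorHom (f - f') g = tensorHom f g - tensorHom f' g := by
  rw [eq_sub_iff_add_eq, ← add_tensor, sub_add_cancel]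

theorem tensor_sub {P Q P' Q' : TL k} (f : P ⟶ Q) (g g' : P' ⟶ Q') :
    tensorHom f (g - g') = tensorHom f g - tensorHom f g' := by
  rw [eq_sub_iff_add_eq, ← tensor_add, sub_add_cancel]

/-- The unit object: no strands. -/
noncomputable def unit (k : ℕ) : TL k := ⟨AddTL.strands k 0, 𝟙 _, Category.comp_id _⟩

/-- The object `F n` given by the idempotent `jonesWenzl k n`. -/
noncomputable def F (k n : ℕ) (hn : n ≤ k + 1) : TL k where
  X := AddTL.strands k n
  p := (Mat_.embedding (LinDiag k)).map (LinDiag.jonesWenzl k n)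
  idem := by rw [← Functor.map_comp, LinDiag.jonesWenzl_idem k n hn]

/-- The evaluation `F n ⊗ F n ⟶ 𝟙`: nested caps composed with `f n ⊗ f n`. -/
noncomputable def ev (k n : ℕ) (hn : n ≤ k + 1) : tensorObj (F k n hn) (F k n hn) ⟶ unit k where
  f := (tensorObj (F k n hn) (F k n hn)).p ≫ AddTL.nestedCap k n
  comm := (congrArg ((tensorObj (F k n hn) (F k n hn)).p ≫ ·) (Category.comp_id _)).trans
    ((Category.assoc _ _ _).symm.trans
      (congrArg (· ≫ AddTL.nestedCap k n) (tensorObj (F k n hn) (F k n hn)).idem))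

/-- The coevaluation `𝟙 ⟶ F n ⊗ F n`: `f n ⊗ f n` composed with nested cups. -/
noncomputable def coev (k n : ℕ) (hn : n ≤ k + 1) :
    unit k ⟶ tensorObj (F k n hn) (F k n hn) where
  f := AddTL.nestedCup k n ≫ (tensorObj (F k n hn) (F k n hn)).p
  comm := (Category.id_comp _).trans ((Category.assoc _ _ _).trans
    (congrArg (AddTL.nestedCup k n ≫ ·) (tensorObj (F k n hn) (F k n hn)).idem))

/-- The ideal of morphisms generated by the object `F (k + 1)`: the smallest class of morphisms
which contains the identity of `F (k + 1)` and is closed under sums, under composition with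
arbitrary morphisms, and under the monoidal product with arbitrary morphisms. -/
inductive InIdeal (k : ℕ) : {P Q : TL k} → (P ⟶ Q) → Prop
  | gen : InIdeal k (𝟙 (F k (k + 1) le_rfl))
  | zero (P Q : TL k) : InIdeal k (0 : P ⟶ Q)
  | add {P Q : TL k} (f g : P ⟶ Q) : InIdeal k f → InIdeal k g → InIdeal k (f + g)
  | comp_left {P Q R : TL k} (f : P ⟶ Q) (g : Q ⟶ R) : InIdeal k g → InIdeal k (f ≫ g)
  | comp_right {P Q R : TL k} (f : P ⟶ Q) (g : Q ⟶ R) : InIdeal k f → InIdeal k (f ≫ g)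
  | tensor_left {P Q P' Q' : TL k} (f : P ⟶ Q) (g : P' ⟶ Q') :
      InIdeal k g → InIdeal k (tensorHom f g)
  | tensor_right {P Q P' Q' : TL k} (f : P ⟶ Q) (g : P' ⟶ Q') :
      InIdeal k f → InIdeal k (tensorHom f g)

theorem InIdeal.neg {P Q : TL k} {f : P ⟶ Q} (h : InIdeal k f) : InIdeal k (-f) := by
  have := InIdeal.comp_left (-𝟙 P) f h
  rwa [Preadditive.neg_comp, Category.id_comp] at this

/-- Two morphisms are identified if their difference lies in the ideal. -/
def idealRel (k : ℕ) : HomRel (TL k) := fun _ _ f g => InIdeal k (f - g)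

instance : Congruence (idealRel k) where
  equivalence :=
    { refl := fun f => by
        change InIdeal k (f - f)
        rw [sub_self]
        exact .zero _ _
      symm := fun {f g} h => by
        change InIdeal k (g - f)
        rw [← neg_sub]
        exact InIdeal.neg h
      trans := fun {f g h} h₁ h₂ => by
        change InIdeal k (f - h)
        rw [← sub_add_sub_cancel f g h]
        exact .add _ _ h₁ h₂ }
  comp_left f g g' h := by
    change InIdeal k (_ - _)
    rw [← Preadditive.comp_sub]
    exact .comp_left _ _ h
  comp_right g h := by
    change InIdeal k (_ - _)
    rw [← Preadditive.sub_comp]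
    exact .comp_right _ _ h

end TL

/-- The reduced Temperley-Lieb category: the quotient of `TL` by the ideal generated by
`F (k + 1)`. -/
abbrev ReducedTL (k : ℕ) : Type 1 := Quotient (TL.idealRel k)

namespace ReducedTL

variable {k : ℕ}

noncomputable instance : Preadditive (ReducedTL k) :=
  Quotient.preadditive _ fun _ _ f₁ f₂ g₁ g₂ h h' => by
    change TL.InIdeal k (f₁ + g₁ - (f₂ + g₂))
    rw [add_sub_add_comm]
    exact .add _ _ h h'

/-- The quotient functor from `TL` to the reduced Temperley-Lieb category. -/
noncomputable abbrev quotientFunctor (k : ℕ) : TL k ⥤ ReducedTL k := Quotient.functor (TL.idealRel k)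

/-- The monoidal product of objects, inherited from `TL`. -/
noncomputable def tensorObj (P Q : ReducedTL k) : ReducedTL k :=
  (quotientFunctor k).obj (TL.tensorObj P.as Q.as)

/-- The monoidal product of morphisms, inherited from `TL`. -/
noncomputable def tensorHom {P Q P' Q' : ReducedTL k} (f : P ⟶ Q) (g : P' ⟶ Q') :
    tensorObj P P' ⟶ tensorObj Q Q' :=
  Quot.liftOn₂ f g (fun a b => (quotientFunctor k).map (TL.tensorHom a b))
    (fun a b b' h => by
      rw [HomRel.compClosure_iff_self] at h
      refine (Quotient.functor_map_eq_iff _ _ _).2 ?_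
      change TL.InIdeal k (_ - _)
      rw [← TL.tensor_sub]
      exact .tensor_left _ _ h)
    (fun a a' b h => by
      rw [HomRel.compClosure_iff_self] at h
      refine (Quotient.functor_map_eq_iff _ _ _).2 ?_
      change TL.InIdeal k (_ - _)
      rw [← TL.sub_tensor]
      exact .tensor_right _ _ h)

/-- The unit object. -/
noncomputable def unit (k : ℕ) : ReducedTL k := (quotientFunctor k).obj (TL.unit k)

/-- The object `F n`, for `0 ≤ n ≤ k`. -/
noncomputable def F (k n : ℕ) (hn : n ≤ k) : ReducedTL k :=
  (quotientFunctor k).obj (TL.F k n (Nat.le_succ_of_le hn))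

/-- The evaluation `e n : F n ⊗ F n ⟶ 𝟙`. -/
noncomputable def ev (k n : ℕ) (hn : n ≤ k) : tensorObj (F k n hn) (F k n hn) ⟶ unit k :=
  (quotientFunctor k).map (TL.ev k n (Nat.le_succ_of_le hn))

/-- The coevaluation `c n : 𝟙 ⟶ F n ⊗ F n`. -/
noncomputable def coev (k n : ℕ) (hn : n ≤ k) : unit k ⟶ tensorObj (F k n hn) (F k n hn) :=
  (quotientFunctor k).map (TL.coev k n (Nat.le_succ_of_le hn))

end ReducedTL

end TemperleyLieb

/-!
Let `≡` denote equality modulo the ideal generated by `f_{k+1}`. A cup placed against the last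
strand of `f_{k+1}` expands `[k+1] f_{k+1}` into `∑ [i+1] f_k cup_i`, summed over all positions
`0 ≤ i ≤ k` of the cup; this sum is therefore `≡ 0`. Compose it with `f_k ⊗ f_k` on one side and
with nested caps followed by `f_{m+1}` on the other. All terms but one vanish, because they contain
a cup on `f_{m+1}` or, after sliding along the nested caps, a cap on the second `f_k`. The remaining
term shows that `f_k ⊗ f_k` followed by `k - m` nested caps in the middle is `≡ 0` when composed
with `f_{m+1}`. By the recursion for `f_{m+1}`, one can hence trade `f_m` for an additional cap and
cup, at the cost of the factor `-[m]/[m+1]`. Doing so for `m = k, …, 1` turns `f_k ⊗ f_k` into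
`c_k e_k`, with the coefficient `(-1)^k / [k+1]`, and `[k+1] = 1`.
-/

namespace TemperleyLieb

theorem qint_succ_eq_one (k : ℕ) : qint k (k + 1) = 1 := by
  have hq : q k ^ (k + 1) * q k = -1 := by
    have hk : (k : ℂ) + 2 ≠ 0 := by exact_mod_cast (by omega : k + 2 ≠ 0)
    rw [← pow_succ, q, ← Complex.exp_nat_mul, ← Complex.exp_pi_mul_I]
    congr 1
    push_cast
    field_simp
    ring
  have hinv : q k ^ (k + 1) = -(q k)⁻¹ := by
    rw [← neg_one_mul, ← hq, mul_inv_cancel_right₀ (q_ne_zero k)]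
  rw [qint, hinv, inv_neg, inv_inv, div_eq_one_iff_eq (q_sub_inv_ne k)]
  ring

namespace Diagram

variable {m n p : ℕ}

/-- `α` on the bottom dots and `β` on the top dots form a two-colouring which is constant on the
lines of `d`. Colourings are indexed by all of `ℕ`, so that they need no casts when dots are added
or removed; the values beyond the last dot are irrelevant. -/
def IsColoring (d : Diagram m n) (α β : ℕ → Bool) : Prop :=
  Resp d.rel (Sum.elim (fun i : Fin m => α i) (fun j : Fin n => β j))

theorem exists_extension (f : Fin n → Bool) : ∃ α : ℕ → Bool, (fun i : Fin n => α i) = f :=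
  ⟨fun t => if h : t < n then f ⟨t, h⟩ else false, by ext i; simp⟩

theorem ext_isColoring {d e : Diagram m n} (h : ∀ α β, d.IsColoring α β ↔ e.IsColoring α β) :
    d = e := by
  refine Diagram.ext (resp_ext fun φ => ?_)
  obtain ⟨α, hα⟩ := exists_extension (φ ∘ Sum.inl)
  obtain ⟨β, hβ⟩ := exists_extension (φ ∘ Sum.inr)
  simpa only [IsColoring, hα, hβ, Sum.elim_comp_inl_inr] using h α β

theorem isColoring_congr (d : Diagram m n) {α α' β β' : ℕ → Bool}
    (hα : ∀ t < m, α t = α' t) (hβ : ∀ t < n, β t = β' t) :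
    d.IsColoring α β ↔ d.IsColoring α' β' := by
  unfold IsColoring
  rw [show (fun i : Fin m => α i) = fun i : Fin m => α' i from funext fun i => hα i i.2,
    show (fun i : Fin n => β i) = fun i : Fin n => β' i from funext fun i => hβ i i.2]

theorem mat_ne_zero_iff {d : Diagram m n} {α β : ℕ → Bool} :
    mat d.rel (fun i => α i) (fun j => β j) ≠ 0 ↔ d.IsColoring α β := by
  simp only [mat, IsColoring, ne_eq, ite_eq_right_iff, one_ne_zero, imp_false, not_not]

theorem isColoring_comp (d : Diagram m n) (e : Diagram n p) (α γ : ℕ → Bool) :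
    (d.comp e).IsColoring α γ ↔ ∃ β, d.IsColoring α β ∧ e.IsColoring β γ := by
  rw [← mat_ne_zero_iff, ← mul_ne_zero_iff_left (pow_ne_zero (d.loops e) two_ne_zero),
    comp, loops, ← mat_stack, ne_eq, Finset.sum_eq_zero_iff, not_forall]
  simp only [Finset.mem_univ, true_imp_iff, ← ne_eq, mul_ne_zero_iff]
  constructor
  · rintro ⟨b, h⟩
    obtain ⟨β, rfl⟩ := exists_extension b
    exact ⟨β, h.imp mat_ne_zero_iff.1 mat_ne_zero_iff.1⟩
  · rintro ⟨β, h⟩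
    exact ⟨fun i => β i, h.imp mat_ne_zero_iff.2 mat_ne_zero_iff.2⟩

theorem isColoring_id (n : ℕ) (α β : ℕ → Bool) :
    (Diagram.id n).IsColoring α β ↔ ∀ t < n, α t = β t := by
  rw [← mat_ne_zero_iff, Diagram.id, mat_idRel]
  simp only [ne_eq, ite_eq_right_iff, one_ne_zero, imp_false, not_not, funext_iff, Fin.forall_iff]

theorem isColoring_cap (α β : ℕ → Bool) : Diagram.cap.IsColoring α β ↔ α 0 = α 1 := by
  rw [← mat_ne_zero_iff, mat_cap]
  simp only [ne_eq, ite_eq_right_iff, one_ne_zero, imp_false, not_not, Fin.val_zero, Fin.val_one]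

theorem isColoring_cup (α β : ℕ → Bool) : Diagram.cup.IsColoring α β ↔ β 0 = β 1 := by
  rw [← mat_ne_zero_iff, mat_cup]
  simp only [ne_eq, ite_eq_right_iff, one_ne_zero, imp_false, not_not, Fin.val_zero, Fin.val_one]

theorem isColoring_tensor {m' n' : ℕ} (d : Diagram m n) (e : Diagram m' n') (α β : ℕ → Bool) :
    (d.tensor e).IsColoring α β ↔
      d.IsColoring α β ∧ e.IsColoring (fun t => α (m + t)) (fun t => β (n + t)) := by
  rw [← mat_ne_zero_iff, mat_tensor, mul_ne_zero_iff, ← mat_ne_zero_iff, ← mat_ne_zero_iff]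
  simp only [Fin.val_castAdd, Fin.val_natAdd]

theorem two_pow_loops (d : Diagram m n) (e : Diagram n p) :
    2 ^ d.loops e = ∑ β, mat d.rel (fun _ => false) β * mat e.rel β (fun _ => false) := by
  rw [mat_stack, mat_false, mul_one, loops]

theorem loops_eq_zero (d : Diagram m n) (e : Diagram n p)
    (h : ∀ β : ℕ → Bool, d.IsColoring (fun _ => false) β → e.IsColoring β (fun _ => false) →
      ∀ t < n, β t = false) : d.loops e = 0 := by
  suffices h1 : 2 ^ d.loops e = 1 from (Nat.pow_eq_one.1 h1).resolve_left (by norm_num)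
  rw [two_pow_loops, Finset.sum_eq_single (fun _ => false), mat_false, mat_false]
  · intro b _ hb
    obtain ⟨β, rfl⟩ := exists_extension b
    by_contra hn
    obtain ⟨h1, h2⟩ := mul_ne_zero_iff.1 hn
    exact hb (funext fun i => h β (mat_ne_zero_iff.1 h1) (mat_ne_zero_iff.1 h2) i i.2)
  · exact fun hn => absurd (Finset.mem_univ _) hn

section Flip

theorem pos_swap_lt_iff {m n : ℕ} (x y : Fin m ⊕ Fin n) :
    pos n m x.swap < pos n m y.swap ↔ pos m n y < pos m n x := by
  rcases x with x | x <;> rcases y with y | y <;> have := x.2 <;> have := y.2 <;>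
    simp only [pos, Sum.swap_inl, Sum.swap_inr, Sum.elim_inl, Sum.elim_inr] <;> omega

/-- The mirror image of a diagram in a horizontal line. -/
def flip (d : Diagram m n) : Diagram n m where
  rel := d.rel.comap Sum.swap
  matching x := by
    obtain ⟨y, ⟨hne, hxy⟩, huniq⟩ := d.matching x.swap
    refine ⟨y.swap, ⟨fun h => hne (by rw [← h, Sum.swap_swap]), ?_⟩, fun z ⟨hz, hxz⟩ => ?_⟩
    · rwa [Setoid.comap_rel, Sum.swap_swap]
    · rw [← huniq z.swap ⟨fun h => hz (Sum.swap_leftInverse.injective h), hxz⟩, Sum.swap_swap]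
  noncrossing a b c e hab hbc hce hac hbe := by
    rw [← Sum.swap_swap a, ← Sum.swap_swap b, pos_swap_lt_iff] at hab
    rw [← Sum.swap_swap b, ← Sum.swap_swap c, pos_swap_lt_iff] at hbc
    rw [← Sum.swap_swap c, ← Sum.swap_swap e, pos_swap_lt_iff] at hce
    exact d.noncrossing _ _ _ _ hce hbc hab (d.rel.symm hbe) (d.rel.symm hac)

theorem mat_flip (d : Diagram m n) (α : Fin n → Bool) (β : Fin m → Bool) :
    mat d.flip.rel α β = mat d.rel β α := by
  have hswap : ∀ x, Sum.elim α β x = Sum.elim β α x.swap := by rintro (x | x) <;> rfl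
  have hresp : Resp d.flip.rel (Sum.elim α β) ↔ Resp d.rel (Sum.elim β α) := by
    refine ⟨fun h x y hxy => ?_, fun h x y hxy => ?_⟩
    · have := h x.swap y.swap (by rwa [flip, Setoid.comap_rel, Sum.swap_swap, Sum.swap_swap])
      rwa [hswap, hswap, Sum.swap_swap, Sum.swap_swap] at this
    · rw [hswap, hswap]
      exact h _ _ hxy
  unfold mat
  rw [hresp]

theorem isColoring_flip (d : Diagram m n) (α β : ℕ → Bool) :
    d.flip.IsColoring α β ↔ d.IsColoring β α := by
  rw [← mat_ne_zero_iff, mat_flip, mat_ne_zero_iff]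

theorem loops_flip (d : Diagram m n) (e : Diagram n p) :
    e.flip.loops d.flip = d.loops e := by
  refine Nat.pow_right_injective le_rfl ?_
  simp only [two_pow_loops, mat_flip, mul_comm]

theorem flip_flip (d : Diagram m n) : d.flip.flip = d :=
  ext_isColoring fun _ _ => by rw [isColoring_flip, isColoring_flip]

theorem flip_comp (d : Diagram m n) (e : Diagram n p) :
    (d.comp e).flip = e.flip.comp d.flip :=
  ext_isColoring fun α β => by
    simp only [isColoring_flip, isColoring_comp, and_comm]

theorem flip_id (n : ℕ) : (Diagram.id n).flip = Diagram.id n :=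
  ext_isColoring fun α β => by simp only [isColoring_flip, isColoring_id, eq_comm]

theorem flip_cap : Diagram.cap.flip = Diagram.cup :=
  ext_isColoring fun α β => by rw [isColoring_flip, isColoring_cap, isColoring_cup]

theorem flip_tensor {m' n' : ℕ} (d : Diagram m n) (e : Diagram m' n') :
    (d.tensor e).flip = d.flip.tensor e.flip :=
  ext_isColoring fun α β => by simp only [isColoring_flip, isColoring_tensor]

end Flip

section CapAt

/-- Change of the numbers of dots along equalities. -/
def cast {m' n' : ℕ} (hm : m = m') (hn : n = n') (d : Diagram m n) : Diagram m' n' :=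
  hm ▸ hn ▸ d

theorem isColoring_cast {m' n' : ℕ} (hm : m = m') (hn : n = n') (d : Diagram m n)
    (α β : ℕ → Bool) : (d.cast hm hn).IsColoring α β ↔ d.IsColoring α β := by
  subst hm hn; rfl

/-- The index of the `t`-th dot which remains when the dots `i` and `i + 1` are removed. -/
def skip (i t : ℕ) : ℕ := if t < i then t else t + 2

theorem skip_lt {i t : ℕ} (ht : t < n) : skip i t < n + 2 := by
  unfold skip; split_ifs <;> omega

theorem exists_skip_eq {i t : ℕ} (h : t ≠ i) (h' : t ≠ i + 1) : ∃ s, skip i s = t := by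
  rcases lt_or_ge t i with hlt | hge
  · exact ⟨t, if_pos hlt⟩
  · exact ⟨t - 2, by unfold skip; split_ifs <;> omega⟩

theorem skip_comm {i l : ℕ} (hil : i ≤ l) (t : ℕ) :
    skip (l + 2) (skip i t) = skip i (skip l t) := by
  unfold skip; split_ifs <;> omega

/-- The colouring obtained from `α` by inserting two dots of colour `c` at `i` and `i + 1`. -/
def insertPair (i : ℕ) (c : Bool) (α : ℕ → Bool) (t : ℕ) : Bool :=
  if t < i then α t else if t ≤ i + 1 then c else α (t - 2)

/-- The diagram `m ⟶ n` with a single cap, which joins the dots `i` and `i + 1`. -/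
def capAt (m n i : ℕ) (hm : m = n + 2) (hi : i ≤ n) : Diagram m n :=
  (((Diagram.id i).tensor Diagram.cap).tensor (Diagram.id (n - i))).cast (by omega) (by omega)

variable {i l : ℕ}

theorem isColoring_capAt (hm : m = n + 2) (hi : i ≤ n) (α β : ℕ → Bool) :
    (capAt m n i hm hi).IsColoring α β ↔ α i = α (i + 1) ∧ ∀ t < n, β t = α (skip i t) := by
  simp only [capAt, isColoring_cast, isColoring_tensor, isColoring_id, isColoring_cap, skip]
  constructor
  · rintro ⟨⟨hlow, hcap⟩, hhigh⟩
    refine ⟨hcap, fun t ht => ?_⟩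
    split_ifs with h
    · exact (hlow t h).symm
    · have := hhigh (t - i) (by omega)
      rw [show i + 2 + (t - i) = t + 2 by omega, show i + 0 + (t - i) = t by omega] at this
      exact this.symm
  · rintro ⟨hcap, hskip⟩
    refine ⟨⟨fun t ht => ?_, hcap⟩, fun t ht => ?_⟩
    · rw [hskip t (by omega), if_pos ht]
    · rw [hskip (i + 0 + t) (by omega), if_neg (by omega)]
      congr 1; omega

theorem isColoring_capAt_comp (hm : m = n + 2) (hi : i ≤ n) (d : Diagram n p) (α γ : ℕ → Bool) :
    ((capAt m n i hm hi).comp d).IsColoring α γ ↔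
      α i = α (i + 1) ∧ d.IsColoring (fun t => α (skip i t)) γ := by
  simp only [isColoring_comp, isColoring_capAt]
  constructor
  · rintro ⟨β, ⟨hcap, hskip⟩, hd⟩
    exact ⟨hcap, (isColoring_congr d hskip fun _ _ => rfl).1 hd⟩
  · rintro ⟨hcap, hd⟩
    exact ⟨_, ⟨hcap, fun _ _ => rfl⟩, hd⟩

theorem isColoring_flip_capAt_comp (hm : m = n + 2) (hi : i ≤ n) (d : Diagram m p)
    (α γ : ℕ → Bool) : ((capAt m n i hm hi).flip.comp d).IsColoring α γ ↔
      ∃ c, d.IsColoring (insertPair i c α) γ := by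
  simp only [isColoring_comp, isColoring_flip, isColoring_capAt]
  constructor
  · rintro ⟨β, ⟨hcap, hskip⟩, hd⟩
    refine ⟨β i, (isColoring_congr d (fun t ht => ?_) fun _ _ => rfl).1 hd⟩
    have hlow := hskip t
    have hhigh := hskip (t - 2)
    simp only [skip, insertPair] at hlow hhigh ⊢
    grind
  · rintro ⟨c, hd⟩
    refine ⟨_, ⟨?_, fun t _ => ?_⟩, hd⟩ <;> grind [insertPair, skip]

theorem loops_capAt (hm : m = n + 2) (hi : i ≤ n) (d : Diagram n p) :
    (capAt m n i hm hi).loops d = 0 :=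
  loops_eq_zero _ _ fun _ h _ => ((isColoring_capAt hm hi _ _).1 h).2

theorem loops_flip_capAt_capAt (hm : m = n + 2) (hi : i ≤ n) (hl : l ≤ n) (hil : i ≠ l) :
    (capAt m n i hm hi).flip.loops (capAt m n l hm hl) = 0 := by
  refine loops_eq_zero _ _ fun β h h' t ht => ?_
  rw [isColoring_flip, isColoring_capAt] at h
  rw [isColoring_capAt] at h'
  have hfar : ∀ s < m, s ≠ i → s ≠ i + 1 → β s = false := fun s hs hsi hsi' => by
    obtain ⟨u, rfl⟩ := exists_skip_eq hsi hsi'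
    exact (h.2 u (by unfold skip at hs; grind)).symm
  have hfar' : ∀ s < m, s ≠ l → s ≠ l + 1 → β s = false := fun s hs hsl hsl' => by
    obtain ⟨u, rfl⟩ := exists_skip_eq hsl hsl'
    exact (h'.2 u (by unfold skip at hs; grind)).symm
  grind

theorem flip_capAt_comp_capAt_succ (hm : m = n + 2) (hi : i + 1 ≤ n) :
    (capAt m n i hm (by omega)).flip.comp (capAt m n (i + 1) hm hi) = Diagram.id n := by
  refine ext_isColoring fun α γ => ?_
  rw [isColoring_flip_capAt_comp, isColoring_id]
  simp only [isColoring_capAt]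
  constructor
  · rintro ⟨c, hcap, hskip⟩ t ht
    have := hskip t ht
    grind [insertPair, skip]
  · intro h
    exact ⟨α i, by grind [insertPair], by grind [insertPair, skip]⟩

theorem capAt_comp_capAt (hm : m = n + 2) (hn : n = p + 2) (hil : i ≤ l) (hl : l ≤ p) :
    (capAt m n (l + 2) hm (by omega)).comp (capAt n p i hn (by omega)) =
      (capAt m n i hm (by omega)).comp (capAt n p l hn hl) := by
  refine ext_isColoring fun α γ => ?_
  simp only [isColoring_capAt_comp, isColoring_capAt, skip_comm hil]
  grind [skip]

theorem flip_capAt_comp_capAt (hm : m = n + 2) (hn : n = p + 2) (hil : i ≤ l) (hl : l ≤ p) :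
    (capAt m n i hm (by omega)).flip.comp (capAt m n (l + 2) hm (by omega)) =
      (capAt n p l hn hl).comp (capAt n p i hn (by omega)).flip := by
  refine ext_isColoring fun α γ => ?_
  rw [isColoring_flip_capAt_comp, isColoring_capAt_comp, isColoring_flip]
  simp only [isColoring_capAt]
  constructor
  · rintro ⟨c, hcap, hskip⟩
    have hi := hskip i (by omega)
    have hi' := hskip (i + 1) (by omega)
    have hfar := fun t (ht : t < p) => hskip _ (hn ▸ skip_lt (i := i) ht)
    refine ⟨by grind [insertPair], by grind [insertPair, skip], fun t ht => ?_⟩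
    rw [hfar t ht, skip_comm hil]
    grind [insertPair, skip]
  · rintro ⟨hcap, hcup, hskip⟩
    refine ⟨γ i, by grind [insertPair], fun t ht => ?_⟩
    have hlow := hskip t
    have hhigh := hskip (t - 2)
    grind [insertPair, skip]

theorem capAt_tensor_id (hm : m = n + 2) (hi : i ≤ n) (r : ℕ) :
    (capAt m n i hm hi).tensor (Diagram.id r) =
      capAt (m + r) (n + r) i (by omega) (by omega) := by
  refine ext_isColoring fun α β => ?_
  simp only [isColoring_tensor, isColoring_capAt, isColoring_id]
  constructor
  · rintro ⟨⟨hcap, hskip⟩, hr⟩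
    refine ⟨hcap, fun t ht => ?_⟩
    have := hr (t - n)
    grind [skip]
  · rintro ⟨hcap, hskip⟩
    exact ⟨⟨hcap, fun t ht => hskip t (by omega)⟩, fun t ht => by grind [skip]⟩

theorem id_tensor_capAt (hm : m = n + 2) (hi : i ≤ n) (r : ℕ) :
    (Diagram.id r).tensor (capAt m n i hm hi) =
      capAt (r + m) (r + n) (r + i) (by omega) (by omega) := by
  refine ext_isColoring fun α β => ?_
  simp only [isColoring_tensor, isColoring_capAt, isColoring_id]
  constructor
  · rintro ⟨hr, hcap, hskip⟩
    refine ⟨hcap, fun t ht => ?_⟩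
    have := hskip (t - r)
    grind [skip]
  · rintro ⟨hcap, hskip⟩
    exact ⟨fun t ht => by grind [skip], hcap, fun t ht => by grind [skip]⟩

theorem cap_eq_capAt : Diagram.cap = capAt 2 0 0 rfl le_rfl :=
  ext_isColoring fun α β => by rw [isColoring_cap, isColoring_capAt]; simp

end CapAt

end Diagram

namespace LinDiag

variable {k : ℕ}

theorem ofDiagram_comp_of_loops {m n p : ℕ} {d : Diagram m n} {e : Diagram n p}
    (h : d.loops e = 0) :
    (ofDiagram d : strands k m ⟶ strands k n) ≫ ofDiagram e = ofDiagram (d.comp e) := by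
  rw [ofDiagram_comp, h, pow_zero, one_smul]

section Flip

variable {X Y Z X' Y' : LinDiag k}

/-- The linear extension of taking mirror images in a horizontal line; it exchanges cups and
caps. -/
noncomputable def flip : (X ⟶ Y) →ₗ[ℂ] (Y ⟶ X) :=
  Finsupp.lmapDomain ℂ ℂ (Diagram.flip : Diagram X.dots Y.dots → Diagram Y.dots X.dots)

theorem flip_ofDiagram {m n : ℕ} (d : Diagram m n) :
    flip (ofDiagram d : strands k m ⟶ strands k n) = ofDiagram d.flip :=
  Finsupp.mapDomain_single

theorem flip_flip (f : X ⟶ Y) : flip (flip f) = f := by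
  induction f using hom_induction with
  | h0 => rw [map_zero, map_zero]
  | hadd f g hf hg => rw [map_add, map_add, hf, hg]
  | hsmul c f hf => rw [map_smul, map_smul, hf]
  | h d =>
    refine Eq.trans (congrArg flip (flip_ofDiagram d)) ?_
    exact (flip_ofDiagram _).trans (congrArg _ d.flip_flip)

theorem flip_id : flip (𝟙 X) = 𝟙 X :=
  (flip_ofDiagram (Diagram.id X.dots)).trans (congrArg _ (Diagram.flip_id _))

theorem flip_comp (f : X ⟶ Y) (g : Y ⟶ Z) : flip (f ≫ g) = flip g ≫ flip f := by
  induction f using hom_induction with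
  | h0 => rw [Limits.zero_comp, map_zero, map_zero, Limits.comp_zero]
  | hadd f₁ f₂ h₁ h₂ => rw [Preadditive.add_comp, map_add, map_add, Preadditive.comp_add, h₁, h₂]
  | hsmul c f hf => rw [Linear.smul_comp, map_smul, map_smul, Linear.comp_smul, hf]
  | h d =>
  induction g using hom_induction with
  | h0 => rw [Limits.comp_zero, map_zero, map_zero, Limits.zero_comp]
  | hadd g₁ g₂ h₁ h₂ => rw [Preadditive.comp_add, map_add, map_add, Preadditive.add_comp, h₁, h₂]
  | hsmul c g hg => rw [Linear.comp_smul, map_smul, map_smul, Linear.smul_comp, hg]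
  | h e =>
    refine (congrArg flip (ofDiagram_comp d e)).trans (Eq.trans ?_
      (congrArg₂ (· ≫ ·) (flip_ofDiagram e) (flip_ofDiagram d)).symm)
    rw [map_smul]
    refine Eq.trans ?_ (ofDiagram_comp e.flip d.flip).symm
    rw [Diagram.loops_flip, ← Diagram.flip_comp]
    exact congrArg _ (flip_ofDiagram _)

theorem flip_tensorHom (f : X ⟶ Y) (g : X' ⟶ Y') :
    flip (tensorHom f g) = tensorHom (flip f) (flip g) := by
  induction f using hom_induction with
  | h0 => rw [zero_tensor, map_zero, map_zero, zero_tensor]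
  | hadd f₁ f₂ h₁ h₂ => rw [add_tensor, map_add, map_add, add_tensor, h₁, h₂]
  | hsmul c f hf => rw [smul_tensor, map_smul, map_smul, smul_tensor, hf]
  | h d =>
  induction g using hom_induction with
  | h0 => rw [tensor_zero, map_zero, map_zero, tensor_zero]
  | hadd g₁ g₂ h₁ h₂ => rw [tensor_add, map_add, map_add, tensor_add, h₁, h₂]
  | hsmul c g hg => rw [tensor_smul, map_smul, map_smul, tensor_smul, hg]
  | h e =>
    refine (congrArg flip (tensor_ofDiagram d e)).trans (Eq.trans ?_
      (congrArg₂ tensorHom (flip_ofDiagram d) (flip_ofDiagram e)).symm)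
    exact (flip_ofDiagram _).trans
      ((congrArg _ (Diagram.flip_tensor d e)).trans (tensor_ofDiagram _ _).symm)

theorem flip_cap (k : ℕ) : flip (cap k) = cup k :=
  (flip_ofDiagram _).trans (congrArg _ Diagram.flip_cap)

end Flip

section Padding

variable {m n p : ℕ}

/-- Adding `r` vertical strands on the right. -/
noncomputable def addStrandsRight (r : ℕ) :
    (strands k m ⟶ strands k n) →ₗ[ℂ] (strands k (m + r) ⟶ strands k (n + r)) where
  toFun f := tensorHom f (𝟙 (strands k r))
  map_add' f g := add_tensor f g _
  map_smul' c f := smul_tensor c f _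

/-- Adding `r` vertical strands on the left. -/
noncomputable def addStrandsLeft (r : ℕ) :
    (strands k m ⟶ strands k n) →ₗ[ℂ] (strands k (r + m) ⟶ strands k (r + n)) where
  toFun f := tensorHom (𝟙 (strands k r)) f
  map_add' f g := tensor_add _ f g
  map_smul' c f := tensor_smul c _ f

theorem addStrandsRight_id (r : ℕ) : addStrandsRight r (𝟙 (strands k n)) = 𝟙 _ := tensor_id _ _

theorem addStrandsLeft_id (r : ℕ) : addStrandsLeft r (𝟙 (strands k n)) = 𝟙 _ := tensor_id _ _

theorem addStrandsRight_comp (r : ℕ) (f : strands k m ⟶ strands k n)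
    (g : strands k n ⟶ strands k p) :
    addStrandsRight r (f ≫ g) = addStrandsRight r f ≫ addStrandsRight r g := by
  have := tensor_comp f g (𝟙 (strands k r)) (𝟙 _)
  rwa [Category.comp_id] at this

theorem addStrandsLeft_comp (r : ℕ) (f : strands k m ⟶ strands k n)
    (g : strands k n ⟶ strands k p) :
    addStrandsLeft r (f ≫ g) = addStrandsLeft r f ≫ addStrandsLeft r g := by
  have := tensor_comp (𝟙 (strands k r)) (𝟙 _) f g
  rwa [Category.comp_id] at this

end Padding

section CapAt

/-- The cap `m ⟶ n` joining the strands `i` and `i + 1`, which makes sense for `m = n + 2` and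
`i ≤ n`; taking `m` as a free index avoids casts. -/
noncomputable def capAt (k m n i : ℕ) : strands k m ⟶ strands k n :=
  if h : m = n + 2 ∧ i ≤ n then ofDiagram (Diagram.capAt m n i h.1 h.2) else 0

/-- The cup `n ⟶ m` joining the strands `i` and `i + 1`, for `m = n + 2` and `i ≤ n`. -/
noncomputable def cupAt (k n m i : ℕ) : strands k n ⟶ strands k m := flip (capAt k m n i)

/-- The generator of the Temperley–Lieb algebra on `n` strands which acts on the strands `i` and
`i + 1`, for `i + 2 ≤ n`. -/
noncomputable def capCupAt (k n i : ℕ) : strands k n ⟶ strands k n :=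
  capAt k n (n - 2) i ≫ cupAt k (n - 2) n i

variable {m n p i l t : ℕ}

theorem flip_capAt : flip (capAt k m n i) = cupAt k n m i := rfl

theorem flip_cupAt : flip (cupAt k n m i) = capAt k m n i := flip_flip _

theorem flip_capCupAt : flip (capCupAt k n i) = capCupAt k n i := by
  rw [capCupAt, flip_comp, flip_cupAt, flip_capAt]

theorem capAt_eq (hm : m = n + 2) (hi : i ≤ n) :
    capAt k m n i = ofDiagram (Diagram.capAt m n i hm hi) := dif_pos ⟨hm, hi⟩

theorem cupAt_eq (hm : m = n + 2) (hi : i ≤ n) :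
    cupAt k n m i = ofDiagram (Diagram.capAt m n i hm hi).flip := by
  rw [← flip_capAt, capAt_eq hm hi, flip_ofDiagram]

theorem capAt_comp_cupAt (hm : m = n + 2) :
    capAt k m n i ≫ cupAt k n m i = capCupAt k m i := by
  subst hm; rfl

theorem cupAt_comp_capAt_succ (hm : m = n + 2) (hi : i + 1 ≤ n) :
    cupAt k n m i ≫ capAt k m n (i + 1) = 𝟙 _ := by
  rw [capAt_eq hm hi, cupAt_eq hm (by omega),
    ofDiagram_comp_of_loops (Diagram.loops_flip_capAt_capAt hm _ hi (by omega)),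
    Diagram.flip_capAt_comp_capAt_succ hm hi, ofDiagram_id]

theorem cupAt_succ_comp_capAt (hm : m = n + 2) (hi : i + 1 ≤ n) :
    cupAt k n m (i + 1) ≫ capAt k m n i = 𝟙 _ := by
  have := congrArg flip (cupAt_comp_capAt_succ (k := k) hm hi)
  rwa [flip_comp, flip_cupAt, flip_capAt, flip_id] at this

theorem capAt_comp_capAt (hm : m = n + 2) (hn : n = p + 2) (hil : i ≤ l) (hl : l ≤ p) :
    capAt k m n (l + 2) ≫ capAt k n p i = capAt k m n i ≫ capAt k n p l := by
  rw [capAt_eq hm (by omega), capAt_eq hm (by omega), capAt_eq hn (by omega), capAt_eq hn hl,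
    ofDiagram_comp_of_loops (Diagram.loops_capAt _ _ _),
    ofDiagram_comp_of_loops (Diagram.loops_capAt _ _ _), Diagram.capAt_comp_capAt hm hn hil hl]

theorem cupAt_comp_capAt (hm : m = n + 2) (hn : n = p + 2) (hil : i ≤ l) (hl : l ≤ p) :
    cupAt k n m i ≫ capAt k m n (l + 2) = capAt k n p l ≫ cupAt k p n i := by
  rw [cupAt_eq hm (by omega), capAt_eq hm (by omega), capAt_eq hn hl, cupAt_eq hn (by omega),
    ofDiagram_comp_of_loops (Diagram.loops_flip_capAt_capAt hm _ _ (by omega)),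
    ofDiagram_comp_of_loops (Diagram.loops_capAt _ _ _),
    Diagram.flip_capAt_comp_capAt hm hn hil hl]

theorem capCupAt_comp_capAt (hm : m = n + 2) (ht : t + 2 ≤ i) (hi : i ≤ n) :
    capCupAt k m t ≫ capAt k m n i = capAt k m n i ≫ capCupAt k n t := by
  obtain ⟨p, rfl⟩ : ∃ p, n = p + 2 := ⟨n - 2, by omega⟩
  obtain ⟨l, rfl⟩ : ∃ l, i = l + 2 := ⟨i - 2, by omega⟩
  rw [← capAt_comp_cupAt hm, ← capAt_comp_cupAt rfl, Category.assoc,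
    cupAt_comp_capAt hm rfl (by omega) (by omega), ← Category.assoc, ← Category.assoc,
    capAt_comp_capAt hm rfl (by omega) (by omega)]

theorem capCupAt_comm (ht : t + 2 ≤ i) (hi : i + 2 ≤ n) :
    capCupAt k n t ≫ capCupAt k n i = capCupAt k n i ≫ capCupAt k n t := by
  obtain ⟨p, rfl⟩ : ∃ p, n = p + 2 := ⟨n - 2, by omega⟩
  have hcap := capCupAt_comp_capAt (k := k) rfl ht (by omega : i ≤ p)
  have hcup := congrArg flip hcap
  rw [flip_comp, flip_comp, flip_capCupAt, flip_capCupAt] at hcup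
  rw [← capAt_comp_cupAt (i := i) rfl, ← Category.assoc, hcap, Category.assoc, Category.assoc]
  exact congrArg _ hcup.symm

theorem addStrandsRight_capAt (hm : m = n + 2) (hi : i ≤ n) (r : ℕ) :
    addStrandsRight r (capAt k m n i) = capAt k (m + r) (n + r) i := by
  rw [capAt_eq hm hi, capAt_eq (by omega) (by omega), ← Diagram.capAt_tensor_id hm hi]
  exact tensor_ofDiagram _ _

theorem addStrandsLeft_capAt (hm : m = n + 2) (hi : i ≤ n) (r : ℕ) :
    addStrandsLeft r (capAt k m n i) = capAt k (r + m) (r + n) (r + i) := by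
  rw [capAt_eq hm hi, capAt_eq (by omega) (by omega), ← Diagram.id_tensor_capAt hm hi]
  exact tensor_ofDiagram _ _

theorem flip_addStrandsRight (r : ℕ) (f : strands k m ⟶ strands k n) :
    flip (addStrandsRight r f) = addStrandsRight r (flip f) :=
  (flip_tensorHom _ _).trans (congrArg _ flip_id)

theorem flip_addStrandsLeft (r : ℕ) (f : strands k m ⟶ strands k n) :
    flip (addStrandsLeft r f) = addStrandsLeft r (flip f) :=
  (flip_tensorHom _ _).trans (congrArg (tensorHom · _) flip_id)

theorem addStrandsRight_capCupAt (hi : i + 2 ≤ n) (r : ℕ) :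
    addStrandsRight r (capCupAt k n i) = capCupAt k (n + r) i := by
  obtain ⟨p, rfl⟩ : ∃ p, n = p + 2 := ⟨n - 2, by omega⟩
  have hcap := addStrandsRight_capAt (k := k) rfl (by omega : i ≤ p) r
  rw [← capAt_comp_cupAt rfl, addStrandsRight_comp, ← flip_capAt, ← flip_addStrandsRight, hcap]
  exact capAt_comp_cupAt (by omega)

theorem addStrandsLeft_capCupAt (hi : i + 2 ≤ n) (r : ℕ) :
    addStrandsLeft r (capCupAt k n i) = capCupAt k (r + n) (r + i) := by
  obtain ⟨p, rfl⟩ : ∃ p, n = p + 2 := ⟨n - 2, by omega⟩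
  have hcap := addStrandsLeft_capAt (k := k) rfl (by omega : i ≤ p) r
  rw [← capAt_comp_cupAt rfl, addStrandsLeft_comp, ← flip_capAt, ← flip_addStrandsLeft, hcap]
  exact capAt_comp_cupAt (by omega)

theorem cap_eq_capAt (k : ℕ) : cap k = capAt k 2 0 0 := by
  rw [cap, Diagram.cap_eq_capAt, capAt_eq rfl le_rfl]

theorem capCup_eq_capCupAt (k n : ℕ) : capCup k n = capCupAt k (n + 2) n := by
  have hcapCup : cap k ≫ cup k = capCupAt k 2 0 := by
    rw [← flip_cap, cap_eq_capAt]
    exact capAt_comp_cupAt rfl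
  rw [capCup, hcapCup]
  exact addStrandsLeft_capCupAt le_rfl n

end CapAt

section JonesWenzl

variable {m n n' s s' i j j' t : ℕ}

/-- The Jones–Wenzl projection acting on the strands `s, …, s + j - 1` among `n` strands, for
`s + j ≤ n`. -/
noncomputable def jonesWenzlAt (k n s : ℕ) : ℕ → (strands k n ⟶ strands k n)
  | 0 => 𝟙 _
  | 1 => 𝟙 _
  | j + 2 => jonesWenzlAt k n s (j + 1) + (qint k (j + 1) / qint k (j + 2)) •
      (jonesWenzlAt k n s (j + 1) ≫ capCupAt k n (s + j) ≫ jonesWenzlAt k n s (j + 1))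

theorem map_jonesWenzlAt (Φ : (strands k n ⟶ strands k n) →ₗ[ℂ] (strands k n' ⟶ strands k n'))
    (hid : Φ (𝟙 _) = 𝟙 _) (hcomp : ∀ f g, Φ (f ≫ g ≫ f) = Φ f ≫ Φ g ≫ Φ f)
    (h : ∀ t, t + 2 ≤ j → Φ (capCupAt k n (s + t)) = capCupAt k n' (s' + t)) :
    Φ (jonesWenzlAt k n s j) = jonesWenzlAt k n' s' j := by
  induction j using Nat.twoStepInduction with
  | zero => exact hid
  | one => exact hid
  | more j _ ih =>
    have ih := ih fun t ht => h t (by omega)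
    rw [jonesWenzlAt, jonesWenzlAt, map_add, map_smul, hcomp, ih, h j le_rfl]

theorem flip_jonesWenzlAt : flip (jonesWenzlAt k n s j) = jonesWenzlAt k n s j :=
  map_jonesWenzlAt flip flip_id (fun f g => by rw [flip_comp, flip_comp, Category.assoc])
    fun _ _ => flip_capCupAt

theorem addStrandsRight_jonesWenzlAt (h : s + j ≤ n) (r : ℕ) :
    addStrandsRight r (jonesWenzlAt k n s j) = jonesWenzlAt k (n + r) s j :=
  map_jonesWenzlAt _ (addStrandsRight_id r)
    (fun f g => by rw [addStrandsRight_comp, addStrandsRight_comp])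
    fun t _ => addStrandsRight_capCupAt (by omega) r

theorem addStrandsLeft_jonesWenzlAt (h : s + j ≤ n) (r : ℕ) :
    addStrandsLeft r (jonesWenzlAt k n s j) = jonesWenzlAt k (r + n) (r + s) j :=
  map_jonesWenzlAt _ (addStrandsLeft_id r)
    (fun f g => by rw [addStrandsLeft_comp, addStrandsLeft_comp])
    fun t _ => by rw [add_assoc, addStrandsLeft_capCupAt (by omega)]

theorem jonesWenzl_eq (k n : ℕ) : jonesWenzl k n = jonesWenzlAt k n 0 n := by
  induction n using Nat.twoStepInduction with
  | zero => rfl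
  | one => rfl
  | more n _ ih =>
    have h : addStrand (jonesWenzl k (n + 1)) = jonesWenzlAt k (n + 2) 0 (n + 1) := by
      rw [ih]
      exact addStrandsRight_jonesWenzlAt (by omega) 1
    rw [jonesWenzl, jonesWenzlAt, h, capCup_eq_capCupAt, Nat.zero_add]

theorem addStrandsRight_jonesWenzl (k j r : ℕ) :
    addStrandsRight r (jonesWenzl k j) = jonesWenzlAt k (j + r) 0 j := by
  rw [jonesWenzl_eq, addStrandsRight_jonesWenzlAt (by omega)]

theorem addStrandsLeft_jonesWenzl (k s j : ℕ) :
    addStrandsLeft s (jonesWenzl k j) = jonesWenzlAt k (s + j) s j := by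
  rw [jonesWenzl_eq, addStrandsLeft_jonesWenzlAt (by omega), add_zero]

theorem jonesWenzlAt_slide (x : strands k n ⟶ strands k n')
    (h : ∀ t, t + 2 ≤ j → x ≫ capCupAt k n' (s' + t) = capCupAt k n (s + t) ≫ x) :
    x ≫ jonesWenzlAt k n' s' j = jonesWenzlAt k n s j ≫ x := by
  induction j using Nat.twoStepInduction with
  | zero => exact (Category.comp_id x).trans (Category.id_comp x).symm
  | one => exact (Category.comp_id x).trans (Category.id_comp x).symm
  | more j _ ih =>
    have ih := ih fun t ht => h t (by omega)
    rw [jonesWenzlAt, jonesWenzlAt, Preadditive.comp_add, Preadditive.add_comp, Linear.comp_smul,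
      Linear.smul_comp, ← Category.assoc, ih, Category.assoc, ← Category.assoc x, h j le_rfl,
      Category.assoc, ih, Category.assoc, Category.assoc]

theorem capAt_comp_jonesWenzlAt (hm : m = n + 2) (h : s + j ≤ i) (hi : i ≤ n) :
    capAt k m n i ≫ jonesWenzlAt k n s j = jonesWenzlAt k m s j ≫ capAt k m n i :=
  jonesWenzlAt_slide _ fun _ _ => (capCupAt_comp_capAt hm (by omega) hi).symm

theorem jonesWenzlAt_comp_cupAt (hm : m = n + 2) (h : s + j ≤ i) (hi : i ≤ n) :
    jonesWenzlAt k n s j ≫ cupAt k n m i = cupAt k n m i ≫ jonesWenzlAt k m s j := by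
  simpa only [flip_comp, flip_capAt, flip_jonesWenzlAt] using
    congrArg flip (capAt_comp_jonesWenzlAt (k := k) hm h hi)

theorem jonesWenzlAt_comm (h : s + j ≤ s') (hs : s' + j' ≤ n) :
    jonesWenzlAt k n s j ≫ jonesWenzlAt k n s' j' =
      jonesWenzlAt k n s' j' ≫ jonesWenzlAt k n s j :=
  jonesWenzlAt_slide _ fun t' _ => (jonesWenzlAt_slide (capCupAt k n (s' + t'))
    fun _ _ => (capCupAt_comm (by omega) (by omega)).symm).symm

theorem jonesWenzlAt_eq (k s j r : ℕ) :
    jonesWenzlAt k (s + (j + r)) s j = addStrandsLeft s (addStrandsRight r (jonesWenzl k j)) := by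
  rw [addStrandsRight_jonesWenzl, addStrandsLeft_jonesWenzlAt (by omega), add_zero]

theorem jonesWenzlAt_idem (h : s + j ≤ n) (hj : j ≤ k + 1) :
    jonesWenzlAt k n s j ≫ jonesWenzlAt k n s j = jonesWenzlAt k n s j := by
  obtain ⟨r, rfl⟩ : ∃ r, n = s + (j + r) := ⟨n - s - j, by omega⟩
  rw [jonesWenzlAt_eq, ← addStrandsLeft_comp, ← addStrandsRight_comp, jonesWenzl_idem k j hj]

theorem jonesWenzlAt_comp_of_le (h : s + j ≤ n) (hj : j ≤ k + 1) (hj' : j' ≤ j) :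
    jonesWenzlAt k n s j ≫ jonesWenzlAt k n s j' = jonesWenzlAt k n s j := by
  induction j, hj' using Nat.le_induction with
  | base => exact jonesWenzlAt_idem h hj
  | succ j hj' ih =>
    have ih := ih (by omega) (by omega)
    match j with
    | 0 =>
      obtain rfl : j' = 0 := by omega
      exact Category.comp_id _
    | j + 1 =>
      rw [jonesWenzlAt, Preadditive.add_comp, Linear.smul_comp, Category.assoc, Category.assoc, ih]

theorem comp_jonesWenzlAt_of_le (h : s + j ≤ n) (hj : j ≤ k + 1) (hj' : j' ≤ j) :
    jonesWenzlAt k n s j' ≫ jonesWenzlAt k n s j = jonesWenzlAt k n s j := by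
  simpa only [flip_comp, flip_jonesWenzlAt] using
    congrArg flip (jonesWenzlAt_comp_of_le (k := k) h hj hj')

theorem jonesWenzl_comp_capCup_eq_zero (k n : ℕ) (hn : n + 2 ≤ k + 1) :
    jonesWenzl k (n + 2) ≫ capCup k n = 0 := by
  have hidem := jonesWenzl_idem k n (by omega)
  have habsorb : addStrand (jonesWenzl k (n + 1)) ≫ addStrand (addStrand (jonesWenzl k n)) =
      addStrand (jonesWenzl k (n + 1)) := by
    rw [← addStrand_comp, jonesWenzl_absorb k n hidem]
  rw [jonesWenzl, Preadditive.add_comp, Linear.smul_comp, Category.assoc, Category.assoc,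
    capCup_jonesWenzl_capCup k n hidem, Linear.comp_smul, smul_smul, jonesWenzl_coeff k n hn,
    ← Category.assoc, habsorb, neg_one_smul, add_neg_cancel]

theorem jonesWenzlAt_comp_capCupAt_eq_zero (h : s + j ≤ n) (hj : j ≤ k + 1) (hs : s ≤ t)
    (ht : t + 2 ≤ s + j) : jonesWenzlAt k n s j ≫ capCupAt k n t = 0 := by
  obtain ⟨i, rfl⟩ : ∃ i, t = s + i := ⟨t - s, by omega⟩
  obtain ⟨r, rfl⟩ : ∃ r, n = s + (i + 2 + r) := ⟨n - s - i - 2, by omega⟩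
  have hcapCup : addStrandsLeft s (addStrandsRight r (capCup k i)) =
      capCupAt k (s + (i + 2 + r)) (s + i) := by
    rw [capCup_eq_capCupAt, addStrandsRight_capCupAt le_rfl, addStrandsLeft_capCupAt (by omega)]
  rw [← jonesWenzlAt_comp_of_le h hj (by omega : i + 2 ≤ j), Category.assoc, jonesWenzlAt_eq,
    ← hcapCup, ← addStrandsLeft_comp, ← addStrandsRight_comp,
    jonesWenzl_comp_capCup_eq_zero k i (by omega), map_zero, map_zero, Limits.comp_zero]

theorem jonesWenzlAt_comp_capAt_eq_zero (hm : m = n + 2) (hn : 1 ≤ n) (h : s + j ≤ m)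
    (hj : j ≤ k + 1) (hs : s ≤ i) (hi : i + 2 ≤ s + j) :
    jonesWenzlAt k m s j ≫ capAt k m n i = 0 := by
  have hkill : (jonesWenzlAt k m s j ≫ capAt k m n i) ≫ cupAt k n m i = 0 := by
    rw [Category.assoc, capAt_comp_cupAt hm, jonesWenzlAt_comp_capCupAt_eq_zero h hj hs hi]
  obtain ⟨x, hx⟩ : ∃ x, cupAt k n m i ≫ x = 𝟙 _ := by
    rcases i with _ | i
    · exact ⟨_, cupAt_comp_capAt_succ hm hn⟩
    · exact ⟨_, cupAt_succ_comp_capAt hm (by omega)⟩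
  rw [← Category.comp_id (_ ≫ _), ← hx, ← Category.assoc, hkill, Limits.zero_comp]

theorem cupAt_comp_jonesWenzlAt_eq_zero (hm : m = n + 2) (hn : 1 ≤ n) (h : s + j ≤ m)
    (hj : j ≤ k + 1) (hs : s ≤ i) (hi : i + 2 ≤ s + j) :
    cupAt k n m i ≫ jonesWenzlAt k m s j = 0 := by
  simpa only [flip_comp, flip_capAt, flip_jonesWenzlAt, map_zero] using
    congrArg flip (jonesWenzlAt_comp_capAt_eq_zero (k := k) hm hn h hj hs hi)

theorem qint_smul_cupAt_comp_jonesWenzlAt (hm : m = n + 2) (hj : j ≤ k) (hn : j ≤ n) :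
    qint k (j + 1) • (cupAt k n m j ≫ jonesWenzlAt k m 0 (j + 1)) =
      ∑ i ∈ Finset.range (j + 1), qint k (i + 1) • (jonesWenzlAt k n 0 j ≫ cupAt k n m i) := by
  induction j with
  | zero =>
    rw [Finset.sum_range_one, jonesWenzlAt, jonesWenzlAt, Category.comp_id, Category.id_comp]
  | succ j ih =>
    have ih := ih (by omega) (by omega)
    have hne : qint k (j + 2) ≠ 0 := qint_ne_zero k _ (by omega) (by omega)
    have hslide := jonesWenzlAt_comp_cupAt (k := k) (i := j + 1) (s := 0) (j := j + 1) hm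
      (by omega) hn
    have hzigzag : cupAt k n m (j + 1) ≫ capCupAt k m j = cupAt k n m j := by
      rw [← capAt_comp_cupAt hm, ← Category.assoc, cupAt_succ_comp_capAt hm hn, Category.id_comp]
    have hstep : cupAt k n m (j + 1) ≫ jonesWenzlAt k m 0 (j + 2) =
        jonesWenzlAt k n 0 (j + 1) ≫ cupAt k n m (j + 1) + (qint k (j + 1) / qint k (j + 2)) •
          (jonesWenzlAt k n 0 (j + 1) ≫ cupAt k n m j ≫ jonesWenzlAt k m 0 (j + 1)) := by
      rw [jonesWenzlAt, Preadditive.comp_add, Linear.comp_smul, ← hslide, zero_add,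
        ← Category.assoc, ← hslide, Category.assoc, ← Category.assoc (cupAt k n m (j + 1)),
        hzigzag]
    rw [hstep, smul_add, smul_smul, mul_div_cancel₀ _ hne,
      ← Linear.comp_smul _ _ _ _ (qint k (j + 1)), ih,
      Preadditive.comp_sum, Finset.sum_range_succ _ (j + 1), add_comm]
    refine congrArg₂ (· + ·) (Finset.sum_congr rfl fun i _ => ?_) rfl
    rw [Linear.comp_smul, ← Category.assoc, jonesWenzlAt_comp_of_le (by omega) (by omega)
      (by omega)]

end JonesWenzl

section NestedCaps

variable {m n a i i' j s M N N' : ℕ}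

/-- The `j` nested caps `M ⟶ N`, for `M = N + 2 * j`, on the strands `a, …, a + 2 * j - 1`; taking
`M` as a free index avoids casts. -/
noncomputable def capsAt (k N a : ℕ) : (j M : ℕ) → (strands k M ⟶ strands k N)
  | 0, M => if h : M = N then eqToHom (congrArg mk h) else 0
  | j + 1, M => capAt k M (N + 2 * j) (a + j) ≫ capsAt k N a j (N + 2 * j)

/-- The `j` nested cups `N ⟶ M`, for `M = N + 2 * j`, on the strands `a, …, a + 2 * j - 1`. -/
noncomputable def cupsAt (k N a j M : ℕ) : strands k N ⟶ strands k M := flip (capsAt k N a j M)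

theorem flip_capsAt : flip (capsAt k N a j M) = cupsAt k N a j M := rfl

theorem capsAt_zero (k N a : ℕ) : capsAt k N a 0 N = 𝟙 _ := dif_pos rfl

theorem cupsAt_zero (k N a : ℕ) : cupsAt k N a 0 N = 𝟙 _ := by
  rw [← flip_capsAt, capsAt_zero, flip_id]

theorem capsAt_succ (hM : M = N + 2 * j) (M' : ℕ) :
    capsAt k N a (j + 1) M' = capAt k M' M (a + j) ≫ capsAt k N a j M := by
  subst hM; rfl

theorem capsAt_comp_jonesWenzlAt (hM : M = N + 2 * j) (ha : a ≤ N) (hs : s ≤ a) :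
    capsAt k N a j M ≫ jonesWenzlAt k N 0 s = jonesWenzlAt k M 0 s ≫ capsAt k N a j M := by
  induction j generalizing M with
  | zero =>
    obtain rfl : M = N := hM
    rw [capsAt_zero, Category.id_comp, Category.comp_id]
  | succ j ih =>
    rw [capsAt, Category.assoc, ih rfl, ← Category.assoc,
      capAt_comp_jonesWenzlAt (by omega) (by omega) (by omega), Category.assoc]

theorem jonesWenzlAt_comp_cupsAt (hM : M = N + 2 * j) (ha : a ≤ N) (hs : s ≤ a) :
    jonesWenzlAt k N 0 s ≫ cupsAt k N a j M = cupsAt k N a j M ≫ jonesWenzlAt k M 0 s := by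
  simpa only [flip_comp, flip_jonesWenzlAt, flip_capsAt] using
    congrArg flip (capsAt_comp_jonesWenzlAt (k := k) hM ha hs)

theorem capsAt_succ_comp_capAt (hN : N' = N + 2) (hM : M = N' + 2 * j) :
    capsAt k N' (a + 1) j M ≫ capAt k N' N a = capsAt k N a (j + 1) M := by
  induction j generalizing M with
  | zero =>
    obtain rfl : M = N' := hM
    rw [capsAt_zero, Category.id_comp, capsAt_succ (M := N) rfl, capsAt_zero, Category.comp_id,
      add_zero]
  | succ j ih =>
    rw [capsAt_succ (M := N' + 2 * j) (N := N') rfl, Category.assoc, ih rfl,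
      capsAt_succ (M := N' + 2 * j) (N := N) (j := j + 1) (by omega), add_right_comm, add_assoc]

theorem cupAt_comp_cupsAt_succ (hN : N' = N + 2) (hM : M = N' + 2 * j) :
    cupAt k N N' a ≫ cupsAt k N' (a + 1) j M = cupsAt k N a (j + 1) M := by
  simpa only [flip_comp, flip_capAt, flip_capsAt] using
    congrArg flip (capsAt_succ_comp_capAt (k := k) (a := a) hN hM)

theorem cupAt_comp_capsAt_succ (hM : M = N + 2) (hN : N = n + 2 * j) (ha : a + 1 ≤ n) :
    cupAt k N M a ≫ capsAt k n (a + 1) (j + 1) M = capsAt k n a j N := by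
  rw [capsAt_succ hN, ← Category.assoc]
  induction j generalizing N M with
  | zero =>
    obtain rfl : N = n := hN
    rw [add_zero, cupAt_comp_capAt_succ hM ha, Category.id_comp, capsAt_zero, capsAt_zero]
  | succ j ih =>
    rw [show a + 1 + (j + 1) = a + j + 2 by omega,
      cupAt_comp_capAt (p := n + 2 * j) hM (by omega) (by omega) (by omega), Category.assoc,
      capsAt_succ (M := n + 2 * j) (N := n) (a := a + 1) rfl, ← Category.assoc (cupAt k _ _ _),
      ih (by omega) rfl, capsAt_succ (M := n + 2 * j) rfl]

/-- The nested caps join the strands `i` and `i + 1` to `i' + 3` and `i' + 2`, which are renumbered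
`i' + 1` and `i'` once `i` and `i + 1` have been removed. -/
theorem cupAt_comp_capsAt (hM : M = N + 2) (hN : N = N' + 2) (hN' : N' = n + 2 * j) (ha : a ≤ n)
    (hi : a ≤ i) (hij : i ≤ a + j) (hi' : i + i' = 2 * (a + j)) :
    cupAt k N M i ≫ capsAt k n a (j + 2) M = capAt k N N' i' ≫ capsAt k n a j N' := by
  rw [capsAt_succ (M := N) (by omega), ← Category.assoc]
  induction j generalizing N M N' i' with
  | zero =>
    obtain ⟨rfl, rfl⟩ : i = a ∧ i' = a := by omega
    rw [zero_add, cupAt_comp_capAt_succ hM (by omega), Category.id_comp, capsAt_succ hN', add_zero]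
  | succ j ih =>
    obtain rfl | hlt : i = a + (j + 1) ∨ i < a + (j + 1) := by omega
    · obtain rfl : i' = a + (j + 1) := by omega
      rw [show a + (j + 1 + 1) = a + (j + 1) + 1 from rfl, cupAt_comp_capAt_succ hM (by omega),
        Category.id_comp, capsAt_succ hN']
    obtain ⟨l, rfl⟩ : ∃ l, i' = l + 2 := ⟨i' - 2, by omega⟩
    rw [show a + (j + 1 + 1) = a + j + 2 by omega,
      cupAt_comp_capAt hM hN (by omega) (by omega), Category.assoc,
      capsAt_succ hN', ← Category.assoc (cupAt k _ _ _), ih hN (N' := N' - 2) (i' := l)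
        (by omega) (by omega) (by omega) (by omega), ← Category.assoc,
      ← capAt_comp_capAt hN (by omega) (by omega) (by omega), Category.assoc,
      capsAt_succ (M := N' - 2) (by omega)]

theorem cupAt_comp_capsAt_comp_jonesWenzlAt_eq_zero (hM : M = N + 2) (hN : 1 ≤ N)
    (hMn : M = n + 2 * j) (ha : a ≤ n) (hsa : s ≤ a) (hs : s ≤ k + 1) (hi : i + 2 ≤ s) :
    cupAt k N M i ≫ capsAt k n a j M ≫ jonesWenzlAt k n 0 s = 0 := by
  rw [capsAt_comp_jonesWenzlAt hMn ha hsa, ← Category.assoc,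
    cupAt_comp_jonesWenzlAt_eq_zero hM hN (by omega) hs (by omega) (by omega), Limits.zero_comp]

theorem eqToHom_comp_capAt (h : m = M) :
    eqToHom (congrArg mk h) ≫ capAt k M n i = capAt k m n i := by
  subst h
  exact Category.id_comp _

theorem cupAt_comp_eqToHom (h : m = M) :
    cupAt k n m i ≫ eqToHom (congrArg mk h) = cupAt k n M i := by
  subst h
  exact Category.comp_id _

theorem addStrands_cap (k n : ℕ) :
    addStrandsRight n (addStrandsLeft n (cap k)) = capAt k (n + 2 + n) (n + n) n := by
  rw [cap_eq_capAt, addStrandsLeft_capAt rfl le_rfl, addStrandsRight_capAt rfl le_rfl]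
  rfl

theorem nestedCap_succ (k n : ℕ) :
    nestedCap k (n + 1) = capAt k (n + 1 + (n + 1)) (n + n) n ≫ nestedCap k n := by
  have h : nestedCap k (n + 1) = eqToHom (congrArg mk (by omega)) ≫
    addStrandsRight n (addStrandsLeft n (cap k)) ≫ nestedCap k n := rfl
  rw [h, addStrands_cap, ← Category.assoc, eqToHom_comp_capAt (by omega)]

theorem nestedCup_succ (k n : ℕ) :
    nestedCup k (n + 1) = nestedCup k n ≫ cupAt k (n + n) (n + 1 + (n + 1)) n := by
  have h : nestedCup k (n + 1) = nestedCup k n ≫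
    flip (addStrandsRight n (addStrandsLeft n (cap k))) ≫ eqToHom (congrArg mk (by omega)) := by
    rw [flip_addStrandsRight n (addStrandsLeft n (cap k)), flip_addStrandsLeft n (cap k), flip_cap]
    rfl
  rw [h, addStrands_cap, flip_capAt, cupAt_comp_eqToHom (by omega)]

theorem nestedCap_eq (k n : ℕ) : nestedCap k n = capsAt k 0 0 n (n + n) := by
  induction n with
  | zero => exact (capsAt_zero k 0 0).symm
  | succ n ih => rw [nestedCap_succ, ih, capsAt_succ (M := n + n) (by omega), zero_add]

theorem nestedCup_eq (k n : ℕ) : nestedCup k n = cupsAt k 0 0 n (n + n) := by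
  induction n with
  | zero => exact (cupsAt_zero k 0 0).symm
  | succ n ih =>
    rw [nestedCup_succ, ih, ← flip_capsAt, ← flip_capsAt, capsAt_succ (M := n + n) (by omega),
      flip_comp, flip_capAt, zero_add]

end NestedCaps

end LinDiag

section Embedding

open Idempotents Karoubi

variable {k : ℕ}

theorem AddTL.comp_apply_of_unique {M N K : AddTL k} [Unique N.ι] (f : M ⟶ N) (g : N ⟶ K)
    (i : M.ι) (j : K.ι) : (f ≫ g) i j = f i default ≫ g default j :=
  Fintype.sum_unique _

instance (X : LinDiag k) : Unique ((Mat_.embedding (LinDiag k)).obj X).ι :=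
  inferInstanceAs (Unique PUnit)

instance (M N : AddTL k) [Unique M.ι] [Unique N.ι] : Unique (AddTL.tensorObj M N).ι :=
  Unique.mk' (M.ι × N.ι)

/-- The embedding of the diagram category in its additive completion is monoidal. -/
noncomputable def AddTL.embeddingTensorIso (X Y : LinDiag k) :
    AddTL.tensorObj ((Mat_.embedding _).obj X) ((Mat_.embedding _).obj Y) ≅
      (Mat_.embedding _).obj (LinDiag.tensorObj X Y) where
  hom _ _ := 𝟙 (LinDiag.tensorObj X Y)
  inv _ _ := 𝟙 (LinDiag.tensorObj X Y)
  hom_inv_id := by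
    ext i j
    obtain rfl := Subsingleton.elim i j
    refine (AddTL.comp_apply_of_unique _ _ i i).trans ?_
    exact (Category.comp_id _).trans (Mat_.id_apply_self _ i).symm
  inv_hom_id := by
    ext i j
    obtain rfl := Subsingleton.elim i j
    refine (AddTL.comp_apply_of_unique _ _ i i).trans ?_
    exact (Category.comp_id _).trans (Mat_.id_apply_self _ i).symm

theorem AddTL.embedding_map_tensorHom {X Y X' Y' : LinDiag k} (f : X ⟶ Y) (g : X' ⟶ Y') :
    (Mat_.embedding _).map (LinDiag.tensorHom f g) =
      (AddTL.embeddingTensorIso X X').inv ≫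
        AddTL.tensorHom ((Mat_.embedding _).map f) ((Mat_.embedding _).map g) ≫
          (AddTL.embeddingTensorIso Y Y').hom := by
  rw [Iso.eq_inv_comp]
  ext i j
  rw [AddTL.comp_apply_of_unique, AddTL.comp_apply_of_unique]
  exact (Category.id_comp _).trans (Category.comp_id _).symm

theorem AddTL.embedding_map_nestedCap (n : ℕ) : (Mat_.embedding _).map (LinDiag.nestedCap k n) =
    (AddTL.embeddingTensorIso _ _).inv ≫ AddTL.nestedCap k n := by
  ext i j
  refine Eq.trans ?_ (AddTL.comp_apply_of_unique _ _ i j).symm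
  exact (Category.id_comp _).symm

theorem AddTL.embedding_map_nestedCup (n : ℕ) : (Mat_.embedding _).map (LinDiag.nestedCup k n) =
    AddTL.nestedCup k n ≫ (AddTL.embeddingTensorIso _ _).hom := by
  ext i j
  refine Eq.trans ?_ (AddTL.comp_apply_of_unique _ _ i j).symm
  exact (Category.comp_id _).symm

theorem TL.inIdeal_toKaroubi_map_iff {P Q : TL k} (f : P ⟶ Q) :
    TL.InIdeal k ((toKaroubi _).map f.f) ↔ TL.InIdeal k f := by
  constructor <;> intro h
  · have hf : f = decompId_i P ≫ (toKaroubi _).map f.f ≫ decompId_p Q :=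
      hom_ext _ _ f.comm.symm
    rw [hf]
    exact .comp_left _ _ (.comp_right _ _ h)
  · have hf : (toKaroubi _).map f.f = decompId_p P ≫ f ≫ decompId_i Q :=
      hom_ext _ _ f.comm.symm
    rw [hf]
    exact .comp_left _ _ (.comp_right _ _ h)

end Embedding

namespace LinDiag

/-- The inclusion of the diagram category in `TL`. -/
noncomputable def toTL (k : ℕ) : LinDiag k ⥤ TL k :=
  Mat_.embedding (LinDiag k) ⋙ Idempotents.toKaroubi (AddTL k)

instance : (toTL k).Additive := ⟨rfl⟩

/-- The morphisms of the diagram category which become zero in `ReducedTL k`. -/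
def negligible {k : ℕ} (X Y : LinDiag k) : Submodule ℂ (X ⟶ Y) where
  carrier := {f | TL.InIdeal k ((toTL k).map f)}
  zero_mem' := by
    rw [Set.mem_ofPred_eq, Functor.map_zero]
    exact .zero _ _
  add_mem' hf hg := by
    rw [Set.mem_ofPred_eq, Functor.map_add]
    exact .add _ _ hf hg
  smul_mem' c f hf := by
    rw [Set.mem_ofPred_eq, ← Category.id_comp f, ← Linear.smul_comp, Functor.map_comp]
    exact .comp_left _ _ hf

section Negligible

variable {k : ℕ} {X Y Z : LinDiag k}

theorem comp_mem_negligible (f : X ⟶ Y) {g : Y ⟶ Z} (hg : g ∈ negligible Y Z) :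
    f ≫ g ∈ negligible X Z := by
  change TL.InIdeal k _
  rw [Functor.map_comp]
  exact .comp_left _ _ hg

theorem mem_negligible_comp {f : X ⟶ Y} (hf : f ∈ negligible X Y) (g : Y ⟶ Z) :
    f ≫ g ∈ negligible X Z := by
  change TL.InIdeal k _
  rw [Functor.map_comp]
  exact .comp_right _ _ hf

theorem smodEq_comp {f f' : X ⟶ Y} (h : f ≡ f' [SMOD negligible X Y]) (g : Y ⟶ Z) :
    f ≫ g ≡ f' ≫ g [SMOD negligible X Z] := by
  rw [SModEq.sub_mem, ← Preadditive.sub_comp]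
  exact mem_negligible_comp (SModEq.sub_mem.1 h) g

theorem tensorHom_mem_negligible {X' Y' : LinDiag k} {f : X ⟶ Y} (hf : f ∈ negligible X Y)
    (g : X' ⟶ Y') : tensorHom f g ∈ negligible (tensorObj X X') (tensorObj Y Y') := by
  have h := (TL.inIdeal_toKaroubi_map_iff (TL.tensorHom _ ((toTL k).map g))).2
    (.tensor_right _ _ hf)
  change TL.InIdeal k ((Idempotents.toKaroubi _).map ((Mat_.embedding _).map _))
  rw [AddTL.embedding_map_tensorHom, Functor.map_comp, Functor.map_comp]
  exact .comp_left _ _ (.comp_right _ _ h)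

theorem jonesWenzl_mem_negligible : jonesWenzl k (k + 1) ∈ negligible _ _ :=
  (TL.inIdeal_toKaroubi_map_iff (𝟙 (TL.F k (k + 1) le_rfl))).2 .gen

theorem jonesWenzlAt_mem_negligible {n : ℕ} (hn : k + 1 ≤ n) :
    jonesWenzlAt k n 0 (k + 1) ∈ negligible (strands k n) (strands k n) := by
  obtain ⟨r, rfl⟩ := Nat.exists_eq_add_of_le hn
  rw [← addStrandsRight_jonesWenzl]
  exact tensorHom_mem_negligible jonesWenzl_mem_negligible (𝟙 (strands k r))

theorem sum_qint_smul_jonesWenzlAt_comp_cupAt_mem_negligible {m n : ℕ} (hm : m = n + 2)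
    (hn : k ≤ n) :
    ∑ i ∈ Finset.range (k + 1), qint k (i + 1) • (jonesWenzlAt k n 0 k ≫ cupAt k n m i) ∈
      negligible (strands k n) (strands k m) := by
  rw [← qint_smul_cupAt_comp_jonesWenzlAt hm le_rfl hn]
  exact (negligible _ _).smul_mem _ (comp_mem_negligible _ (jonesWenzlAt_mem_negligible (by omega)))

end Negligible

section CappedPair

variable {k m j i : ℕ}

/-- The idempotent `f_k ⊗ f_k`. -/
noncomputable def jonesWenzlPair (k : ℕ) : strands k (k + k) ⟶ strands k (k + k) :=
  jonesWenzlAt k (k + k) 0 k ≫ jonesWenzlAt k (k + k) k k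

theorem tensorHom_jonesWenzl (k : ℕ) :
    tensorHom (jonesWenzl k k) (jonesWenzl k k) = jonesWenzlPair k := by
  rw [jonesWenzlPair, ← addStrandsRight_jonesWenzl, ← addStrandsLeft_jonesWenzl]
  have h := tensor_comp (jonesWenzl k k) (𝟙 (strands k k)) (𝟙 (strands k k)) (jonesWenzl k k)
  rwa [Category.comp_id, Category.id_comp] at h

theorem jonesWenzlPair_comp_right (k : ℕ) :
    jonesWenzlPair k ≫ jonesWenzlAt k (k + k) k k = jonesWenzlPair k := by
  rw [jonesWenzlPair, Category.assoc, jonesWenzlAt_idem le_rfl k.le_succ]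

theorem jonesWenzlPair_comp_left (k : ℕ) :
    jonesWenzlPair k ≫ jonesWenzlAt k (k + k) 0 k = jonesWenzlPair k := by
  rw [jonesWenzlPair, Category.assoc, ← jonesWenzlAt_comm (by omega) le_rfl, ← Category.assoc,
    jonesWenzlAt_idem (by omega) k.le_succ]

theorem jonesWenzlPair_comp_capAt_eq_zero {n : ℕ} (hn : k + k = n + 2) (hn' : 1 ≤ n) (hki : k ≤ i)
    (hi : i + 2 ≤ k + k) : jonesWenzlPair k ≫ capAt k (k + k) n i = 0 := by
  rw [jonesWenzlPair, Category.assoc,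
    jonesWenzlAt_comp_capAt_eq_zero hn hn' le_rfl k.le_succ hki hi, Limits.comp_zero]

/-- `f_k ⊗ f_k` followed by `j` nested caps in the middle, for `m + j = k`: on the `m + m`
remaining strands, the first `m` come from the left factor. -/
noncomputable def cappedPair (k m j : ℕ) : strands k (k + k) ⟶ strands k (m + m) :=
  jonesWenzlPair k ≫ capsAt k (m + m) m j (k + k)

theorem cappedPair_zero (k : ℕ) : cappedPair k k 0 = jonesWenzlPair k := by
  rw [cappedPair, capsAt_zero, Category.comp_id]

theorem cappedPair_comp_jonesWenzlAt (h : m + j = k) :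
    cappedPair k m j ≫ jonesWenzlAt k (m + m) 0 m = cappedPair k m j := by
  have habs : jonesWenzlPair k ≫ jonesWenzlAt k (k + k) 0 m = jonesWenzlPair k := by
    rw [← jonesWenzlPair_comp_left, Category.assoc,
      jonesWenzlAt_comp_of_le (by omega) k.le_succ (by omega)]
  rw [cappedPair, Category.assoc, capsAt_comp_jonesWenzlAt (by omega) (by omega) le_rfl,
    ← Category.assoc, habs]

theorem cappedPair_comp_capAt (h : m + 1 + j = k) :
    cappedPair k (m + 1) j ≫ capAt k (m + 1 + (m + 1)) (m + m) m = cappedPair k m (j + 1) := by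
  rw [cappedPair, Category.assoc, capsAt_succ_comp_capAt (by omega) (by omega), cappedPair]

theorem jonesWenzlPair_comp_cupAt_comp_capsAt_eq_zero (hm : 1 ≤ m) (h : m + j = k) (hik : i ≤ k)
    (him : i ≠ m) :
    jonesWenzlPair k ≫ cupAt k (k + k) (k + k + 2) i ≫
      capsAt k (m + m) (m + 1) (j + 1) (k + k + 2) ≫ jonesWenzlAt k (m + m) 0 (m + 1) = 0 := by
  obtain hlt | hgt := him.lt_or_gt
  · rw [cupAt_comp_capsAt_comp_jonesWenzlAt_eq_zero rfl (by omega) (by omega) (by omega) le_rfl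
      (by omega) (by omega), Limits.comp_zero]
  · obtain ⟨j, rfl⟩ : ∃ j', j = j' + 1 := ⟨j - 1, by omega⟩
    rw [← Category.assoc (cupAt k _ _ _), cupAt_comp_capsAt (N' := k + k - 2) (i' := k + k - i) rfl
      (by omega) (by omega) (by omega) (by omega) (by omega) (by omega), Category.assoc,
      ← Category.assoc,
      jonesWenzlPair_comp_capAt_eq_zero (by omega) (by omega) (by omega) (by omega),
      Limits.zero_comp]

theorem cappedPair_comp_jonesWenzlAt_succ_mem_negligible (hm : 1 ≤ m) (h : m + j = k) :
    cappedPair k m j ≫ jonesWenzlAt k (m + m) 0 (m + 1) ∈ negligible _ _ := by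
  have hrot := comp_mem_negligible (jonesWenzlPair k) <| mem_negligible_comp
    (sum_qint_smul_jonesWenzlAt_comp_cupAt_mem_negligible (k := k) (n := k + k) rfl (by omega))
    (capsAt k (m + m) (m + 1) (j + 1) (k + k + 2) ≫ jonesWenzlAt k (m + m) 0 (m + 1))
  have hterm (i : ℕ) : jonesWenzlPair k ≫ (qint k (i + 1) •
      (jonesWenzlAt k (k + k) 0 k ≫ cupAt k (k + k) (k + k + 2) i)) ≫
        capsAt k (m + m) (m + 1) (j + 1) (k + k + 2) ≫ jonesWenzlAt k (m + m) 0 (m + 1) =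
      qint k (i + 1) • (jonesWenzlPair k ≫ cupAt k (k + k) (k + k + 2) i ≫
        capsAt k (m + m) (m + 1) (j + 1) (k + k + 2) ≫ jonesWenzlAt k (m + m) 0 (m + 1)) := by
    rw [Linear.smul_comp, Linear.comp_smul, Category.assoc, ← Category.assoc (jonesWenzlPair k),
      jonesWenzlPair_comp_left]
  rw [Preadditive.sum_comp, Preadditive.comp_sum, Finset.sum_congr rfl fun i _ => hterm i,
    Finset.sum_eq_single_of_mem m (Finset.mem_range.2 (by omega)) fun i hi him => by
      rw [jonesWenzlPair_comp_cupAt_comp_capsAt_eq_zero hm h (by rw [Finset.mem_range] at hi; omega)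
        him, smul_zero],
    (negligible _ _).smul_mem_iff (qint_ne_zero k _ (by omega) (by omega)),
    ← Category.assoc (cupAt k _ _ _), cupAt_comp_capsAt_succ rfl (by omega) (by omega),
    ← Category.assoc] at hrot
  exact hrot

theorem cappedPair_succ_smodEq (h : m + 1 + j = k) :
    cappedPair k (m + 1) j ≡ (-(qint k (m + 1) / qint k (m + 2))) • (cappedPair k m (j + 1) ≫
      cupAt k (m + m) (m + 1 + (m + 1)) m ≫ jonesWenzlAt k (m + 1 + (m + 1)) 0 (m + 1))
      [SMOD negligible _ _] := by
  have hkill := cappedPair_comp_jonesWenzlAt_succ_mem_negligible (by omega) h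
  rw [jonesWenzlAt, Preadditive.comp_add, Linear.comp_smul, ← Category.assoc (cappedPair k _ _),
    cappedPair_comp_jonesWenzlAt h, zero_add, ← capAt_comp_cupAt (n := m + m) (by omega),
    Category.assoc, ← Category.assoc (cappedPair k _ _), cappedPair_comp_capAt h] at hkill
  rwa [SModEq.sub_mem, neg_smul, sub_neg_eq_add]

theorem jonesWenzlPair_smodEq (h : m + j = k) :
    jonesWenzlPair k ≡ ((-1) ^ j * qint k (m + 1)) • (cappedPair k m j ≫
      cupsAt k (m + m) m j (k + k) ≫ jonesWenzlAt k (k + k) 0 k) [SMOD negligible _ _] := by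
  induction j generalizing m with
  | zero =>
    obtain rfl : m = k := h
    rw [cappedPair_zero, cupsAt_zero, Category.id_comp, jonesWenzlPair_comp_left,
      qint_succ_eq_one, pow_zero, one_mul, one_smul]
  | succ j ih =>
    have hstep := (smodEq_comp (cappedPair_succ_smodEq (m := m) (j := j) (k := k) (by omega))
      (cupsAt k (m + 1 + (m + 1)) (m + 1) j (k + k) ≫ jonesWenzlAt k (k + k) 0 k)).smul
        ((-1) ^ j * qint k (m + 2))
    refine (ih (m := m + 1) (by omega)).trans (hstep.trans ?_)
    have hm := qint_ne_zero k (m + 2) (by omega) (by omega)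
    have hcoeff : (-1 : ℂ) ^ j * qint k (m + 2) * -(qint k (m + 1) / qint k (m + 2)) =
        (-1) ^ (j + 1) * qint k (m + 1) := by
      field_simp
      ring
    rw [Linear.smul_comp, smul_smul, hcoeff, Category.assoc, Category.assoc,
      ← Category.assoc (jonesWenzlAt k _ _ _),
      jonesWenzlAt_comp_cupsAt (by omega) (by omega) le_rfl, Category.assoc,
      comp_jonesWenzlAt_of_le (by omega) k.le_succ (by omega), ← Category.assoc (cupAt k _ _ _),
      cupAt_comp_cupsAt_succ (by omega) (by omega)]

theorem tensorHom_jonesWenzl_comp_nestedCap_comp_nestedCup_smodEq (k : ℕ) :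
    tensorHom (jonesWenzl k k) (jonesWenzl k k) ≫ nestedCap k k ≫ nestedCup k k ≫
      tensorHom (jonesWenzl k k) (jonesWenzl k k) ≡
      (-1 : ℂ) ^ k • tensorHom (jonesWenzl k k) (jonesWenzl k k) [SMOD negligible _ _] := by
  have h := ((smodEq_comp (jonesWenzlPair_smodEq (zero_add k))
    (jonesWenzlAt k (k + k) k k)).smul ((-1) ^ k)).symm
  rw [jonesWenzlPair_comp_right, Linear.smul_comp, smul_smul, zero_add, qint_one, mul_one,
    ← mul_pow, neg_one_mul, neg_neg, one_pow, one_smul, cappedPair, Category.assoc, Category.assoc,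
    Category.assoc] at h
  rw [tensorHom_jonesWenzl, nestedCap_eq, nestedCup_eq]
  exact h

end CappedPair

end LinDiag

theorem comp_comp_sub_zsmul_eq_conj {C D : Type*} [Category C] [Category D] [Preadditive C]
    [Preadditive D] (G : C ⥤ D) [G.Additive] {X Y : C} {A : D} (e : A ≅ G.obj X)
    {t : X ⟶ X} {u : X ⟶ Y} {v : Y ⟶ X} {p : A ⟶ A} {ε : A ⟶ G.obj Y} {η : G.obj Y ⟶ A}
    (ht : G.map t = e.inv ≫ p ≫ e.hom) (hu : G.map u = e.inv ≫ ε) (hv : G.map v = η ≫ e.hom)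
    (c : ℤ) : (p ≫ ε) ≫ η ≫ p - c • p = e.hom ≫ G.map (t ≫ u ≫ v ≫ t - c • t) ≫ e.inv := by
  simp [ht, hu, hv, Preadditive.comp_sub, Preadditive.sub_comp]

namespace TL

open Idempotents Karoubi

variable {k : ℕ}

theorem inIdeal_of_mem_negligible {P Q : TL k} {X Y : LinDiag k} {f : P ⟶ Q}
    (a : P.X ⟶ (Mat_.embedding _).obj X) {x : X ⟶ Y} (b : (Mat_.embedding _).obj Y ⟶ Q.X)
    (hf : f.f = a ≫ (Mat_.embedding _).map x ≫ b) (hx : x ∈ LinDiag.negligible X Y) :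
    InIdeal k f := by
  rw [← inIdeal_toKaroubi_map_iff, hf, Functor.map_comp, Functor.map_comp]
  exact .comp_left _ _ (.comp_right _ _ hx)

theorem ev_comp_coev_sub_zsmul_f {n : ℕ} (hn : n ≤ k + 1) (c : ℤ) :
    (ev k n hn ≫ coev k n hn - c • tensorHom (𝟙 (F k n hn)) (𝟙 (F k n hn))).f =
      (AddTL.embeddingTensorIso (LinDiag.strands k n) (LinDiag.strands k n)).hom ≫
        (Mat_.embedding _).map
          (LinDiag.tensorHom (LinDiag.jonesWenzl k n) (LinDiag.jonesWenzl k n) ≫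
            LinDiag.nestedCap k n ≫ LinDiag.nestedCup k n ≫
              LinDiag.tensorHom (LinDiag.jonesWenzl k n) (LinDiag.jonesWenzl k n) -
            c • LinDiag.tensorHom (LinDiag.jonesWenzl k n) (LinDiag.jonesWenzl k n)) ≫
        (AddTL.embeddingTensorIso _ _).inv := by
  have hsub := (map_sub (inclusionHom _ _) (ev k n hn ≫ coev k n hn) _).trans
    (congrArg _ (map_zsmul (inclusionHom _ _) c (tensorHom (𝟙 (F k n hn)) (𝟙 (F k n hn)))))
  exact hsub.trans (comp_comp_sub_zsmul_eq_conj _ _ (AddTL.embedding_map_tensorHom _ _)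
    (AddTL.embedding_map_nestedCap n) (AddTL.embedding_map_nestedCup n) c)

theorem inIdeal_ev_comp_coev_sub (k : ℕ) :
    InIdeal k (ev k k k.le_succ ≫ coev k k k.le_succ -
      (-1 : ℤ) ^ k • tensorHom (𝟙 (F k k k.le_succ)) (𝟙 (F k k k.le_succ))) := by
  have h := SModEq.sub_mem.1
    (LinDiag.tensorHom_jonesWenzl_comp_nestedCap_comp_nestedCup_smodEq k)
  refine inIdeal_of_mem_negligible _ _ (ev_comp_coev_sub_zsmul_f k.le_succ _) ?_
  rwa [← Int.cast_smul_eq_zsmul ℂ, Int.cast_pow, Int.cast_neg, Int.cast_one]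

end TL

instance (k : ℕ) : (ReducedTL.quotientFunctor k).Additive := ⟨rfl⟩

end TemperleyLieb

theorem lemma3p14 (k : ℕ) (hk : 1 ≤ k) :
    TemperleyLieb.ReducedTL.ev k k le_rfl ≫ TemperleyLieb.ReducedTL.coev k k le_rfl =
      ((-1 : ℤ) ^ k) • TemperleyLieb.ReducedTL.tensorHom
        (𝟙 (TemperleyLieb.ReducedTL.F k k le_rfl)) (𝟙 (TemperleyLieb.ReducedTL.F k k le_rfl)) := by
  have h := (Quotient.functor_map_eq_iff (TemperleyLieb.TL.idealRel k) _ _).2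
    (TemperleyLieb.TL.inIdeal_ev_comp_coev_sub k)
  rw [Functor.map_comp, Functor.map_zsmul] at h
  exact h
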